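/- Let $\alpha,\beta\in(0,1]$ and $\xi,\lambda>0$. For $m\le n$ in $\mathbb Z$ let $g_{m,n}$ and $W_{m,n}$ be the Taylor coefficients of order $n-m$ at $u=0$ of $\frac{(1-u)^\alpha}{\lambda+(1-u)^\alpha}$ and of $\frac{\lambda}{\lambda+(1-u)^\alpha}\bigl(1-(1-u)^\alpha\bigr)$, respectively, and $g_{m,n}=W_{m,n}=0$ for $m>n$ ($W$ is the discrete Mittag-Leffler transition matrix). Put $E_\beta(z)=\sum_{m\ge0}z^m/\Gamma(\beta m+1)$ and, for complex $|u|\le1$ (principal powers), $$\bar W(u)=\frac{\lambda\,(1-(1-u)^\alpha)}{\lambda+(1-u)^\alpha},\qquad c(u)=\frac{\xi(\lambda+1)(1-u)^\alpha}{\lambda+(1-u)^\alpha}.$$ Let $\frac{d^\beta}{dt^\beta}f(t)=\frac1{\Gamma(1-\beta)}\int_0^t(t-\tau)^{-\beta}f'(\tau)\,d\tau$ be the Caputo derivative ($=f'$ if $\beta=1$). Solutions of the Cauchy problems below are understood to be continuous on $[0,\infty)$ and differentiable on $(0,\infty)$ with derivative integrable on every $(0,t)$, the equations holding for all $t>0$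 (with convergent Caputo integral). The space-time Mittag-Leffler process is given by its state probabilities $p_n(t)$, $n\in\mathbb N_0$, solving $$\frac{d^\beta}{dt^\beta}p_n(t)=-\xi(\lambda+1)\sum_{m=0}^n p_m(t)\,g_{0,n-m},\qquad p_n(0)=\delta_{n,0}.\tag{1}$$ A Montroll–Weiss walk consists of i.i.d. waiting times $T_1,T_2,\dots\ge0$ with $\mathbb E\,e^{-sT_k}=\frac{\xi}{\xi+s^\beta}$ ($s>0$) and, independently of them, i.i.d. jumps $Z_1,Z_2,\ldots\in\mathbb N_0$ with $\mathbb P(Z_k=n)=W_{0,n}$. Let $N(t)=\#\{m\ge1:T_1+\dots+T_m\le t\}$ (the fractional Poisson process), and let $X(t)=\sum_{j=1}^{N(t)}Z_j$. Then: 1. $W_{i,j}\ge0$, $W_{i,j}=0$ for $j\le i$, $\sum_jW_{i,j}=1$, and $\sum_{n\ge0}W_{0,n}u^n=\bar W(u)$ for $|u|\le1$. 2. Problem (1) has exactly one solution on $[0,\infty)$. 3. A Montroll–Weiss walk exists on some probability space. 4. For every Montroll–Weiss walk, $\mathbb P(T_k>t)=E_\beta(-\xi t^\beta)$ for $t\ge0$,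 and $\mathbb E\,e^{-sT_k}=\frac{\xi}{\xi+s^\beta}$ for complex $s$ with $\Re s>0$. For all $n\in\mathbb N_0$, $t\ge0$, the state probabilities of the walk are those of the space-time Mittag-Leffler process and are given by the Cox series: $$\mathbb P(X(t)=n)=p_n(t)=\sum_{m=0}^\infty\mathbb P(N(t)=m)\,[W^m]_{0,n}.$$ For $|u|\le1$ and $t\ge0$, $\bar p(u,t):=\sum_{n}p_n(t)u^n=E_\beta(-c(u)t^\beta)$ (convergent), and $\bar p(u,\cdot)$ solves $$\frac{d^\beta}{dt^\beta}\bar p(u,t)=-c(u)\,\bar p(u,t),\qquad\bar p(u,0)=1.\tag{2}$$ For $\Re s>0$ and $\tilde\chi(s)=\frac{\xi}{\xi+s^\beta}$, the Laplace transforms in $t$ of the generating function of the Cox series and of that of the solution of (1) converge absolutely, and both are equal to $$\frac{1-\tilde\chi(s)}{s}\sum_{n=0}^\infty\bigl[\tilde\chi(s)\bar W(u)\bigr]^n=\frac{1-\tilde\chi(s)}{s}\,\frac{1}{1-\bar W(u)\tilde\chi(s)}=\frac{s^{\beta-1}}{s^\beta+c(u)} .$$ 5. For $|u|\le1$, a function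 $f$ on $[0,\infty)$ solves (2) if and only if it is continuous and, for all $s$ with $\Re s>0$, has the absolutely convergent Laplace transform $\frac{s^{\beta-1}}{s^\beta+c(u)}$. -/

import Mathlib

open MeasureTheory ProbabilityTheory Set
open scoped Nat

noncomputable section

namespace SpaceTimeML

/-- The Mittag-Leffler function `E_β(z) = ∑ₘ zᵐ / Γ(β m + 1)`. -/
def mittagLeffler (β : ℝ) (z : ℂ) : ℂ :=
  ∑' m : ℕ, z ^ m / (Real.Gamma (β * m + 1) : ℂ)

/-! ### Upper triangular circulant matrices -/

/-- The upper triangular circulant matrix on `ℤ` with generating function `f`: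
its `(m, n)` entry is the Taylor coefficient of `f` at `0` of order `n - m` if `m ≤ n`,
and `0` otherwise. -/
def circulantOf (f : ℝ → ℝ) (m n : ℤ) : ℝ :=
  if m ≤ n then iteratedDeriv (n - m).toNat f 0 / ((n - m).toNat ! : ℝ) else 0

/-- The Laplacian matrix function `𝓛^α / (λ + 𝓛^α)`, where `𝓛 = 1 - T₋₁` has generating
function `1 - u`. -/
def laplacianML (α lam : ℝ) : ℤ → ℤ → ℝ :=
  circulantOf fun u : ℝ => (1 - u) ^ α / (lam + (1 - u) ^ α)

/-- The discrete Mittag-Leffler one-step transition matrix. -/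
def transitionML (α lam : ℝ) : ℤ → ℤ → ℝ :=
  circulantOf fun u : ℝ => lam / (lam + (1 - u) ^ α) * (1 - (1 - u) ^ α)

/-- The `k`-step transition matrix `Wᵏ` of a walk on `ℤ` with one-step transition matrix `W`
(master equation). -/
def stepMatrix (W : ℤ → ℤ → ℝ) : ℕ → ℤ → ℤ → ℝ
  | 0, i, j => if i = j then 1 else 0
  | k + 1, i, j => ∑' r : ℤ, stepMatrix W k i r * W r j

/-- The closed form of the generating function of the Mittag-Leffler transition matrix, at a
complex argument. -/
def genTransitionML (α lam : ℝ) (u : ℂ) : ℂ :=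
  lam / (lam + (1 - u) ^ (α : ℂ)) * (1 - (1 - u) ^ (α : ℂ))

/-- `ξ (λ + 1) (1 - u)^α / (λ + (1 - u)^α)`. -/
def genRate (α ξ lam : ℝ) (u : ℂ) : ℂ :=
  ξ * (lam + 1) * (1 - u) ^ (α : ℂ) / (lam + (1 - u) ^ (α : ℂ))

/-! ### Caputo derivative and the Cauchy problems -/

section Caputo

variable {E : Type*} [NormedAddCommGroup E] [NormedSpace ℝ E]

/-- Functions on `[0, ∞)` that are continuous, differentiable at positive times, and whose
derivative is integrable on bounded intervals `(0, t)`. -/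
structure CaputoRegular (f : ℝ → E) : Prop where
  continuousOn : ContinuousOn f (Ici 0)
  differentiableAt : ∀ t, 0 < t → DifferentiableAt ℝ f t
  integrable : ∀ t, 0 < t → IntervalIntegrable (deriv f) volume 0 t

/-- `f` has Caputo derivative `v` of order `β ∈ (0, 1]` at time `t > 0`; for `β = 1` this is
the ordinary derivative. -/
def HasCaputoDerivAt (β : ℝ) (f : ℝ → E) (v : E) (t : ℝ) : Prop :=
  (β = 1 → HasDerivAt f v t) ∧
  (β ≠ 1 →
    IntervalIntegrable (fun τ => (t - τ) ^ (-β) • deriv f τ) volume 0 t ∧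
    (1 / Real.Gamma (1 - β)) • ∫ τ in (0 : ℝ)..t, (t - τ) ^ (-β) • deriv f τ = v)

end Caputo

/-- `p n t` are state probabilities of the space-time Mittag-Leffler process: they solve
`d^β p_n / dt^β = -ξ (λ + 1) [p · g(𝓛)]_n`, `p_n(0) = δ_{n,0}`, with
`g(𝓛) = 𝓛^α / (λ + 𝓛^α)`. -/
structure SolvesCauchy (α β ξ lam : ℝ) (p : ℕ → ℝ → ℝ) : Prop where
  regular : ∀ n, CaputoRegular (p n)
  init : ∀ n, p n 0 = if n = 0 then 1 else 0
  eqn : ∀ n t, 0 < t → HasCaputoDerivAt β (p n)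
    (-(ξ * (lam + 1)) *
      ∑ m ∈ Finset.range (n + 1), p m t * laplacianML α lam 0 ((n : ℤ) - (m : ℤ))) t

/-- `f` solves the Cauchy problem for the generating function at `u`:
`d^β f / dt^β = -ξ (λ + 1) (1 - u)^α / (λ + (1 - u)^α) f`, `f(0) = 1`. -/
structure SolvesGenCauchy (α β ξ lam : ℝ) (u : ℂ) (f : ℝ → ℂ) : Prop where
  regular : CaputoRegular f
  init : f 0 = 1
  eqn : ∀ t, 0 < t → HasCaputoDerivAt β f (-genRate α ξ lam u * f t) t

/-- `f` has time-Laplace transform `v` at `s` (the defining integral converges absolutely). -/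
def HasLaplaceAt (f : ℝ → ℂ) (s v : ℂ) : Prop :=
  IntegrableOn (fun t : ℝ => Complex.exp (-s * t) * f t) (Ioi 0) ∧
  ∫ t in Ioi (0 : ℝ), Complex.exp (-s * t) * f t = v

/-! ### The continuous-time random walk -/

section Walk

variable {Ω : Type*}

/-- Time of the `m`-th arrival, where `T k` is the waiting time between arrivals `k`
and `k + 1`. -/
def arrival (T : ℕ → Ω → ℝ) (m : ℕ) (ω : Ω) : ℝ := ∑ k ∈ Finset.range m, T k ω

/-- Number of arrivals up to time `t`. -/
def counting (T : ℕ → Ω → ℝ) (t : ℝ) (ω : Ω) : ℕ := {k : ℕ | arrival T (k + 1) ω ≤ t}.ncard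

/-- Position at time `t` of the walk with jumps `Z` at the arrival times. -/
def position (T : ℕ → Ω → ℝ) (Z : ℕ → Ω → ℕ) (t : ℝ) (ω : Ω) : ℕ :=
  ∑ j ∈ Finset.range (counting T t ω), Z j ω

/-- Montroll-Weiss data: i.i.d. waiting times with Laplace transform `ξ / (ξ + s^β)`
(so that `counting T` is a fractional Poisson counting family), and, independently of them,
i.i.d. jumps distributed according to the discrete Mittag-Leffler transition matrix. -/
structure IsMontrollWeiss [MeasurableSpace Ω] (P : Measure Ω) (α β ξ lam : ℝ)
    (T : ℕ → Ω → ℝ) (Z : ℕ → Ω → ℕ) : Prop where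
  measurable_wait : ∀ k, Measurable (T k)
  measurable_jump : ∀ k, Measurable (Z k)
  indep_wait : iIndepFun T P
  indep_jump : iIndepFun Z P
  indep : IndepFun (fun ω k => T k ω) (fun ω k => Z k ω) P
  wait_nonneg : ∀ k, ∀ᵐ ω ∂P, 0 ≤ T k ω
  wait_laplace : ∀ k, ∀ s : ℝ, 0 < s → ∫ ω, Real.exp (-s * T k ω) ∂P = ξ / (ξ + s ^ β)
  jump_law : ∀ k, ∀ n : ℕ, P.real {ω | Z k ω = n} = transitionML α lam 0 n

end Walk

end SpaceTimeML

end

/-! Everything is read off one power series. Let A be the generating series of W (`mlSeries`) and B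
= -ξ(1 - A), so that B(u) = -c(u) on the closed disc. The solution of (1) is p_n(t) = [u^n] E_β(B
t^β) = Σ_k t^{βk}/Γ(βk+1) [u^n] B^k (`pSeries`). Let S be the series of 1 - (1-u)^α, which has
nonnegative coefficients of sum at most 1. Clearing the denominator of A gives (λ+1)A = λS + AS, and
A inherits both properties. So A lies in the Wiener algebra of absolutely summable series, B^k has
norm at most (2ξ)^k, all series converge absolutely for |u| ≤ 1, and identities on the open disc
extend to the circle by continuity.

By a Beta integral the Caputo derivative shifts the coefficients of a series in t^β
(`hasCaputoDerivAt_fracSeries`), so E_β(B t^β) solves (1) coefficientwise and E_β(-c t^β) solves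
(2). Composition with an Abel kernel turns a Caputo equation into a Volterra equation, and an
exponentially weighted maximum then gives uniqueness (`eq_zero_of_caputo`). Problem (1) is
triangular in n, so it is settled one n at a time.

The case A = X defines the counting probabilities π_m (`poissonProb`). Since B^k is a polynomial in
A, p_n = Σ_m π_m [u^n] A^m: the Cox series is algebra. To see that π_m(t) = P(N(t) = m), write χ =
ξ/(ξ+s^β). The m-th arrival time has transform χ^m, so its survival function has transform
(1-χ^m)/s, which for large Re s is also that of π_0 + ... + π_{m-1}. Uniqueness of Laplace
transforms, by Fourier inversion, gives equality.

Conversely, the probabilistic meaning shows π_m ≥ 0 and gives its transform on all of Re s > 0,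
beyond the reach of growth bounds on the series. Summing the geometric series in χ W̄(u) yields the
Montroll-Weiss formula (`IsMontrollWeiss.hasLaplaceAt_fracSeries`). This is why even the purely
analytic equivalence with (2) uses the existence of a walk. For that existence, the waiting-time law
is a weak limit of discrete Mittag-Leffler laws with parameters β and ξh^β, scaled by h → 0
(`exists_mittagLeffler_law`). -/

open Filter Topology

namespace SpaceTimeML

/-! ### Taylor coefficients of the matrix functions -/

/-- Taylor coefficients of `(1 - u)^α` at `0`. -/
noncomputable def powCoeff (α : ℝ) (n : ℕ) : ℝ := Ring.choose α n * (-1) ^ n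

lemma powCoeff_zero (α : ℝ) : powCoeff α 0 = 1 := by simp [powCoeff]

lemma powCoeff_succ (α : ℝ) (n : ℕ) :
    powCoeff α (n + 1) = powCoeff α n * ((n - α) / (n + 1)) := by
  have hn : ((n : ℝ) + 1) ≠ 0 := by positivity
  have hf : (n ! : ℝ) ≠ 0 := by positivity
  simp only [powCoeff, Ring.choose_eq_smul, descPochhammer_succ_right, Polynomial.smeval_mul,
    Polynomial.smeval_sub, Polynomial.smeval_X, Polynomial.smeval_natCast, Nat.factorial_succ,
    smul_eq_mul, Nat.cast_mul, Nat.cast_succ, pow_succ, pow_zero, nsmul_eq_mul, mul_one]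
  field_simp
  ring

/-- The ratio (n-α)/(n+1) of consecutive coefficients is negative only at n = 0, because α ≤ 1, so
the sign changes exactly once. -/
lemma powCoeff_nonpos {α : ℝ} (hα₀ : 0 < α) (hα₁ : α ≤ 1) (n : ℕ) :
    powCoeff α (n + 1) ≤ 0 := by
  induction n with
  | zero => rw [powCoeff_succ, powCoeff_zero]; simp; linarith
  | succ n ih =>
    rw [powCoeff_succ]
    refine mul_nonpos_of_nonpos_of_nonneg ih (div_nonneg ?_ (by positivity))
    push_cast
    have : (0 : ℝ) ≤ n := by positivity
    linarith

lemma hasSum_powCoeff (α : ℝ) {u : ℂ} (hu : ‖u‖ < 1) :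
    HasSum (fun n : ℕ => (powCoeff α n : ℂ) * u ^ n) ((1 - u) ^ (α : ℂ)) := by
  have h := (Complex.one_add_cpow_hasFPowerSeriesOnBall_zero (a := (α : ℂ))).hasSum
    (y := -u) (by simpa [Metric.mem_eball, edist_zero_right, enorm_eq_nnnorm,
      ← NNReal.coe_lt_one] using hu)
  rw [zero_add, ← sub_eq_add_neg] at h
  have e : (fun n : ℕ => (powCoeff α n : ℂ) * u ^ n) =
      fun n : ℕ => (binomialSeries ℂ (α : ℂ) n) fun _ => -u := by
    ext n
    rw [binomialSeries_apply, powCoeff]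
    simp [neg_pow u, mul_assoc, Complex.ofReal_choose]
  rw [e]
  exact h

/-- Uniqueness of power series expansions: an entry of `circulantOf` is computed by exhibiting any
expansion convergent on (-1, 1). -/
lemma iteratedDeriv_div_factorial_of_hasSum {f : ℝ → ℝ} {a : ℕ → ℝ}
    (h : ∀ u : ℝ, |u| < 1 → HasSum (fun n => a n * u ^ n) (f u)) (n : ℕ) :
    iteratedDeriv n f 0 / (n ! : ℝ) = a n := by
  have hp : HasFPowerSeriesAt f (FormalMultilinearSeries.ofScalars ℝ a) 0 := by
    rw [hasFPowerSeriesAt_iff]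
    filter_upwards [Metric.ball_mem_nhds (0 : ℝ) one_pos] with z hz
    simpa [FormalMultilinearSeries.coeff_ofScalars, mul_comm] using h z (by simpa using hz)
  obtain ⟨r, hr⟩ := hp
  have := hr.factorial_smul 1 n
  rw [← iteratedDeriv_eq_iteratedFDeriv] at this
  rw [← this]
  have hf : (n ! : ℝ) ≠ 0 := by positivity
  simp [hf]

/-! ### Absolutely summable power series on the closed unit disc -/

/-- The sum of a real power series at a complex point. -/
noncomputable def psEval (A : PowerSeries ℝ) (u : ℂ) : ℂ := ∑' n, (A.coeff n : ℂ) * u ^ n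

/-- The coefficients of `A` are absolutely summable, with sum at most `r`. -/
def L1Bound (A : PowerSeries ℝ) (r : ℝ) : Prop :=
  Summable (fun n => |A.coeff n|) ∧ ∑' n, |A.coeff n| ≤ r

lemma L1Bound.of_sum_le {A : PowerSeries ℝ} {r : ℝ}
    (h : ∀ N, ∑ n ∈ Finset.range N, |A.coeff n| ≤ r) : L1Bound A r :=
  ⟨summable_of_sum_range_le (fun _ => abs_nonneg _) h,
    Real.tsum_le_of_sum_range_le (fun _ => abs_nonneg _) h⟩

lemma L1Bound.nonneg {A : PowerSeries ℝ} {r : ℝ} (h : L1Bound A r) : 0 ≤ r :=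
  (tsum_nonneg fun _ => abs_nonneg _).trans h.2

lemma L1Bound.coeff_le {A : PowerSeries ℝ} {r : ℝ} (h : L1Bound A r) (n : ℕ) :
    |A.coeff n| ≤ r :=
  (h.1.le_tsum n fun _ _ => abs_nonneg _).trans h.2

lemma L1Bound.summable_norm {A : PowerSeries ℝ} {r : ℝ} (h : L1Bound A r) {u : ℂ}
    (hu : ‖u‖ ≤ 1) : Summable fun n => ‖(A.coeff n : ℂ) * u ^ n‖ := by
  refine h.1.of_nonneg_of_le (fun _ => norm_nonneg _) fun n => ?_
  rw [norm_mul, norm_pow, Complex.norm_real, Real.norm_eq_abs]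
  exact mul_le_of_le_one_right (abs_nonneg _) (pow_le_one₀ (norm_nonneg _) hu)

lemma L1Bound.hasSum {A : PowerSeries ℝ} {r : ℝ} (h : L1Bound A r) {u : ℂ}
    (hu : ‖u‖ ≤ 1) : HasSum (fun n => (A.coeff n : ℂ) * u ^ n) (psEval A u) :=
  (h.summable_norm hu).of_norm.hasSum

/-- Submultiplicativity of the Wiener algebra norm. Iterated, it bounds the coefficients of B^k by
r^k, the geometric control that the series in t^β require. -/
lemma L1Bound.mul {A B : PowerSeries ℝ} {a b : ℝ} (hA : L1Bound A a) (hB : L1Bound B b) :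
    L1Bound (A * B) (a * b) := by
  have hs : ∀ n, |(A * B).coeff n| ≤
      ∑ kl ∈ Finset.HasAntidiagonal.antidiagonal n, |A.coeff kl.1| * |B.coeff kl.2| := fun n => by
    rw [PowerSeries.coeff_mul]
    exact (Finset.abs_sum_le_sum_abs _ _).trans_eq (by simp [abs_mul])
  have hA' : Summable fun n => ‖|A.coeff n|‖ := by simpa using hA.1
  have hB' : Summable fun n => ‖|B.coeff n|‖ := by simpa using hB.1
  have hsum := summable_norm_sum_mul_antidiagonal_of_summable_norm hA' hB'
  have hsum' : Summable fun n =>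
      ∑ kl ∈ Finset.HasAntidiagonal.antidiagonal n, |A.coeff kl.1| * |B.coeff kl.2| :=
    hsum.of_norm
  have h1 := hsum'.of_nonneg_of_le (fun _ => abs_nonneg _) hs
  refine ⟨h1, (h1.tsum_le_tsum hs hsum').trans ?_⟩
  rw [← tsum_mul_tsum_eq_tsum_sum_antidiagonal_of_summable_norm hA' hB']
  exact mul_le_mul hA.2 hB.2 (tsum_nonneg fun _ => abs_nonneg _) hA.nonneg

lemma L1Bound.one : L1Bound 1 1 := by
  have h : ∀ n, n ∉ ({0} : Finset ℕ) → |(1 : PowerSeries ℝ).coeff n| = 0 := fun n hn => by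
    simp only [Finset.mem_singleton] at hn
    simp [PowerSeries.coeff_one, hn]
  refine ⟨summable_of_ne_finset_zero h, ?_⟩
  rw [tsum_eq_sum h]
  simp

lemma L1Bound.pow {A : PowerSeries ℝ} {a : ℝ} (hA : L1Bound A a) (k : ℕ) :
    L1Bound (A ^ k) (a ^ k) := by
  induction k with
  | zero => simpa using L1Bound.one
  | succ k ih => simpa [pow_succ] using ih.mul hA

lemma psEval_one (u : ℂ) : psEval 1 u = 1 := by
  rw [psEval, tsum_eq_single 0 fun n hn => by simp [PowerSeries.coeff_one, hn]]
  simp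

lemma L1Bound.psEval_mul {A B : PowerSeries ℝ} {a b : ℝ} (hA : L1Bound A a) (hB : L1Bound B b)
    {u : ℂ} (hu : ‖u‖ ≤ 1) : psEval (A * B) u = psEval A u * psEval B u := by
  rw [psEval, psEval, psEval, tsum_mul_tsum_eq_tsum_sum_antidiagonal_of_summable_norm
    (hA.summable_norm hu) (hB.summable_norm hu)]
  refine tsum_congr fun n => ?_
  rw [PowerSeries.coeff_mul, Complex.ofReal_sum, Finset.sum_mul]
  refine Finset.sum_congr rfl fun kl hkl => ?_
  rw [← Finset.HasAntidiagonal.mem_antidiagonal.1 hkl, pow_add]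
  push_cast
  ring

lemma L1Bound.psEval_pow {A : PowerSeries ℝ} {a : ℝ} (hA : L1Bound A a) {u : ℂ}
    (hu : ‖u‖ ≤ 1) (k : ℕ) : psEval (A ^ k) u = psEval A u ^ k := by
  induction k with
  | zero => simpa using psEval_one u
  | succ k ih => rw [pow_succ, (hA.pow k).psEval_mul hA hu, ih, pow_succ]

lemma L1Bound.norm_psEval_le {A : PowerSeries ℝ} {a : ℝ} (hA : L1Bound A a) {u : ℂ}
    (hu : ‖u‖ ≤ 1) : ‖psEval A u‖ ≤ a := by
  refine (norm_tsum_le_tsum_norm (hA.summable_norm hu)).trans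
    (((hA.summable_norm hu).tsum_le_tsum (fun n => ?_) hA.1).trans hA.2)
  rw [norm_mul, norm_pow, Complex.norm_real, Real.norm_eq_abs]
  exact mul_le_of_le_one_right (abs_nonneg _) (pow_le_one₀ (norm_nonneg _) hu)

/-- Serves to carry identities from the open disc, where Taylor expansions hold, to the unit circle.
-/
lemma L1Bound.continuousOn_psEval {A : PowerSeries ℝ} {a : ℝ} (hA : L1Bound A a) :
    ContinuousOn (psEval A) (Metric.closedBall 0 1) := by
  refine continuousOn_tsum (fun n => by fun_prop) hA.1 fun n u hu => ?_
  rw [norm_mul, norm_pow, Complex.norm_real, Real.norm_eq_abs]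
  exact mul_le_of_le_one_right (abs_nonneg _) (pow_le_one₀ (norm_nonneg _) (by simpa using hu))

lemma L1Bound.sub {A B : PowerSeries ℝ} {a b : ℝ} (hA : L1Bound A a) (hB : L1Bound B b) :
    L1Bound (A - B) (a + b) := by
  have hs : ∀ n, |(A - B).coeff n| ≤ |A.coeff n| + |B.coeff n| := fun n => by
    rw [map_sub]; exact abs_sub _ _
  have h1 := (hA.1.add hB.1).of_nonneg_of_le (fun _ => abs_nonneg _) hs
  refine ⟨h1, (h1.tsum_le_tsum hs (hA.1.add hB.1)).trans ?_⟩
  rw [hA.1.tsum_add hB.1]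
  exact add_le_add hA.2 hB.2

lemma L1Bound.C (c : ℝ) : L1Bound (PowerSeries.C c) |c| := by
  have h : ∀ n, n ∉ ({0} : Finset ℕ) → |(PowerSeries.C c).coeff n| = 0 := fun n hn => by
    simp only [Finset.mem_singleton] at hn
    simp [PowerSeries.coeff_C, hn]
  refine ⟨summable_of_ne_finset_zero h, ?_⟩
  rw [tsum_eq_sum h]
  simp

lemma psEval_C (c : ℝ) (u : ℂ) : psEval (PowerSeries.C c) u = c := by
  rw [psEval, tsum_eq_single 0 fun n hn => by simp [PowerSeries.coeff_C, hn]]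
  simp

lemma L1Bound.psEval_sub {A B : PowerSeries ℝ} {a b : ℝ} (hA : L1Bound A a) (hB : L1Bound B b)
    {u : ℂ} (hu : ‖u‖ ≤ 1) : psEval (A - B) u = psEval A u - psEval B u := by
  rw [psEval, psEval, psEval, ← (hA.hasSum hu).summable.tsum_sub (hB.hasSum hu).summable]
  exact tsum_congr fun n => by rw [map_sub]; push_cast; ring

lemma psEval_X {u : ℂ} : psEval PowerSeries.X u = u := by
  rw [psEval, tsum_eq_single 1 fun n hn => by simp [PowerSeries.coeff_X, hn]]
  simp

lemma L1Bound.X : L1Bound PowerSeries.X 1 := by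
  have h : ∀ n, n ∉ ({1} : Finset ℕ) → |(PowerSeries.X : PowerSeries ℝ).coeff n| = 0 :=
    fun n hn => by
      simp only [Finset.mem_singleton] at hn
      simp [PowerSeries.coeff_X, hn]
  refine ⟨summable_of_ne_finset_zero h, ?_⟩
  rw [tsum_eq_sum h]
  simp

/-! ### The Mittag-Leffler transition matrix -/

/-- The power series of `1 - (1 - u)^α`. -/
noncomputable def sibuyaSeries (α : ℝ) : PowerSeries ℝ := 1 - PowerSeries.mk (powCoeff α)

section

variable {α lam : ℝ}

lemma coeff_sibuyaSeries_zero (α : ℝ) : (sibuyaSeries α).coeff 0 = 0 := by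
  simp [sibuyaSeries, powCoeff_zero]

lemma coeff_sibuyaSeries_nonneg (hα₀ : 0 < α) (hα₁ : α ≤ 1) (n : ℕ) :
    0 ≤ (sibuyaSeries α).coeff n := by
  cases n with
  | zero => rw [coeff_sibuyaSeries_zero]
  | succ n => simpa [sibuyaSeries, PowerSeries.coeff_one] using powCoeff_nonpos hα₀ hα₁ n

lemma hasSum_sibuyaSeries (α : ℝ) {u : ℂ} (hu : ‖u‖ < 1) :
    HasSum (fun n : ℕ => ((sibuyaSeries α).coeff n : ℂ) * u ^ n) (1 - (1 - u) ^ (α : ℂ)) := by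
  have h1 : HasSum (fun n : ℕ => ((1 : PowerSeries ℝ).coeff n : ℂ) * u ^ n) 1 := by
    simpa using hasSum_single (f := fun n : ℕ => ((1 : PowerSeries ℝ).coeff n : ℂ) * u ^ n) 0
      fun n hn => by simp [PowerSeries.coeff_one, hn]
  have e : (fun n : ℕ => ((sibuyaSeries α).coeff n : ℂ) * u ^ n) =
      fun n : ℕ => ((1 : PowerSeries ℝ).coeff n : ℂ) * u ^ n - (powCoeff α n : ℂ) * u ^ n := by
    ext n
    simp [sibuyaSeries, sub_mul]
  rw [e]
  exact h1.sub (hasSum_powCoeff α hu)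

lemma hasSum_sibuyaSeries_real (α : ℝ) {u : ℝ} (hu : |u| < 1) :
    HasSum (fun n : ℕ => (sibuyaSeries α).coeff n * u ^ n) (1 - (1 - u) ^ α) := by
  have h := hasSum_sibuyaSeries α (u := (u : ℂ)) (by simpa using hu)
  rw [← Complex.ofReal_one, ← Complex.ofReal_sub, ← Complex.ofReal_cpow
    (by linarith [(abs_lt.1 hu).2]), ← Complex.ofReal_sub] at h
  rw [← Complex.hasSum_ofReal]
  simpa using h

/-- Nonnegative coefficients make every partial sum at u < 1 at most 1 - (1-u)^α ≤ 1; then let u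
increase to 1. -/
lemma l1Bound_sibuyaSeries (hα₀ : 0 < α) (hα₁ : α ≤ 1) : L1Bound (sibuyaSeries α) 1 := by
  refine L1Bound.of_sum_le fun N => ?_
  rw [Finset.sum_congr rfl fun n _ => abs_of_nonneg (coeff_sibuyaSeries_nonneg hα₀ hα₁ n)]
  have hcont : Tendsto (fun u : ℝ => ∑ n ∈ Finset.range N, (sibuyaSeries α).coeff n * u ^ n)
      (𝓝[<] 1) (𝓝 (∑ n ∈ Finset.range N, (sibuyaSeries α).coeff n)) := by
    have : Continuous fun u : ℝ => ∑ n ∈ Finset.range N, (sibuyaSeries α).coeff n * u ^ n := by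
      fun_prop
    have h := (this.tendsto 1).mono_left (nhdsWithin_le_nhds (s := Iio 1))
    simpa only [one_pow, mul_one] using h
  refine le_of_tendsto hcont ?_
  filter_upwards [Ioo_mem_nhdsLT (zero_lt_one (α := ℝ))] with u hu
  have hs := hasSum_sibuyaSeries_real α (u := u) (abs_lt.2 ⟨by linarith [hu.1], hu.2⟩)
  refine (sum_le_hasSum _ (fun n _ => mul_nonneg (coeff_sibuyaSeries_nonneg hα₀ hα₁ n)
    (pow_nonneg hu.1.le n)) hs).trans ?_
  have : 0 ≤ (1 - u) ^ α := Real.rpow_nonneg (by linarith [hu.2]) _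
  linarith

lemma re_one_sub_nonneg {u : ℂ} (hu : ‖u‖ ≤ 1) : 0 ≤ (1 - u).re := by
  have := (Complex.re_le_norm u).trans hu
  simpa using this

/-- On the closed disc Re(1-u) ≥ 0 keeps the base off the branch cut, and at u = 1, where the base
vanishes, continuity comes from α > 0. -/
lemma continuousOn_one_sub_cpow (hα₀ : 0 < α) :
    ContinuousOn (fun u : ℂ => (1 - u) ^ (α : ℂ)) (Metric.closedBall 0 1) := by
  intro u hu
  have hc : ContinuousAt (fun z : ℂ => z ^ (α : ℂ)) (1 - u) :=
    Complex.continuousAt_cpow_const_of_re_pos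
      (Or.inl (re_one_sub_nonneg (by simpa using hu))) (by simpa using hα₀)
  exact (ContinuousAt.comp (f := fun u : ℂ => 1 - u) hc (by fun_prop)).continuousWithinAt

lemma psEval_sibuyaSeries (hα₀ : 0 < α) (hα₁ : α ≤ 1) {u : ℂ} (hu : ‖u‖ ≤ 1) :
    psEval (sibuyaSeries α) u = 1 - (1 - u) ^ (α : ℂ) := by
  have h : EqOn (psEval (sibuyaSeries α)) (fun u : ℂ => 1 - (1 - u) ^ (α : ℂ))
      (Metric.ball 0 1) := fun v hv => (hasSum_sibuyaSeries α (by simpa using hv)).tsum_eq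
  refine h.of_subset_closure (l1Bound_sibuyaSeries hα₀ hα₁).continuousOn_psEval
    (continuousOn_const.sub (continuousOn_one_sub_cpow hα₀)) Metric.ball_subset_closedBall ?_
    (by simpa using hu)
  rw [closure_ball _ one_ne_zero]

/-- The generating series of the Mittag-Leffler transition matrix. -/
noncomputable def mlSeries (α lam : ℝ) : PowerSeries ℝ :=
  PowerSeries.C lam * sibuyaSeries α * (PowerSeries.C (lam + 1) - sibuyaSeries α)⁻¹

lemma mlSeries_mul (hlam : 0 < lam) :
    mlSeries α lam * (PowerSeries.C (lam + 1) - sibuyaSeries α) =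
      PowerSeries.C lam * sibuyaSeries α := by
  rw [mlSeries, mul_assoc, PowerSeries.inv_mul_cancel, mul_one]
  have : PowerSeries.constantCoeff (sibuyaSeries α) = 0 := by
    simpa using coeff_sibuyaSeries_zero α
  simp only [map_sub, PowerSeries.constantCoeff_C, this]
  linarith

/-- Free of inverses, this is a recursion with nonnegative terms: S has no constant term, so the
order-n coefficient of the product involves only earlier coefficients of A. -/
lemma mlSeries_eq (hlam : 0 < lam) :
    PowerSeries.C (lam + 1) * mlSeries α lam =
      PowerSeries.C lam * sibuyaSeries α + mlSeries α lam * sibuyaSeries α := by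
  rw [← mlSeries_mul hlam]; ring

lemma coeff_mlSeries (hlam : 0 < lam) (n : ℕ) :
    (lam + 1) * (mlSeries α lam).coeff n =
      lam * (sibuyaSeries α).coeff n + (mlSeries α lam * sibuyaSeries α).coeff n := by
  have := congrArg (PowerSeries.coeff n) (mlSeries_eq (α := α) hlam)
  rwa [PowerSeries.coeff_C_mul, map_add, PowerSeries.coeff_C_mul] at this

lemma coeff_mlSeries_zero (α lam : ℝ) : (mlSeries α lam).coeff 0 = 0 := by
  have : PowerSeries.constantCoeff (sibuyaSeries α) = 0 := by
    simpa using coeff_sibuyaSeries_zero α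
  simp [mlSeries, this]

lemma coeff_mlSeries_nonneg (hα₀ : 0 < α) (hα₁ : α ≤ 1) (hlam : 0 < lam) (n : ℕ) :
    0 ≤ (mlSeries α lam).coeff n := by
  induction n using Nat.strong_induction_on with
  | _ n ih =>
    have h := coeff_mlSeries (α := α) hlam n
    have hs : 0 ≤ (mlSeries α lam * sibuyaSeries α).coeff n := by
      rw [PowerSeries.coeff_mul]
      refine Finset.sum_nonneg fun kl hkl => ?_
      have hkl := Finset.HasAntidiagonal.mem_antidiagonal.1 hkl
      rcases Nat.eq_zero_or_pos kl.2 with h0 | h0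
      · rw [h0, coeff_sibuyaSeries_zero, mul_zero]
      · exact mul_nonneg (ih _ (by omega)) (coeff_sibuyaSeries_nonneg hα₀ hα₁ _)
    have h2 := mul_nonneg hlam.le (coeff_sibuyaSeries_nonneg hα₀ hα₁ n)
    exact nonneg_of_mul_nonneg_right (by linarith : 0 ≤ (lam + 1) * _) (by linarith)

lemma l1Bound_mlSeries (hα₀ : 0 < α) (hα₁ : α ≤ 1) (hlam : 0 < lam) :
    L1Bound (mlSeries α lam) 1 := by
  have hw := coeff_mlSeries_nonneg hα₀ hα₁ hlam
  have hh := l1Bound_sibuyaSeries hα₀ hα₁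
  refine L1Bound.of_sum_le fun N => ?_
  rw [Finset.sum_congr rfl fun n _ => abs_of_nonneg (hw n)]
  set S := ∑ n ∈ Finset.range N, (mlSeries α lam).coeff n with hS
  -- The first N coefficients of the product see only the first N coefficients of the left factor.
  -- Replacing it by its truncation, of norm at most S, bounds their sum by S without knowing
  -- summability in advance. Summing the recursion then gives (λ+1)S ≤ λ + S, so S ≤ 1.
  let A : PowerSeries ℝ := PowerSeries.mk fun n => if n < N then (mlSeries α lam).coeff n else 0
  have hA : L1Bound A S := by
    have h : ∀ n, n ∉ Finset.range N → |A.coeff n| = 0 := fun n hn => by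
      simp only [Finset.mem_range] at hn
      simp [A, hn]
    refine ⟨summable_of_ne_finset_zero h, ?_⟩
    rw [tsum_eq_sum h, hS]
    refine Finset.sum_le_sum fun n hn => ?_
    simp [A, Finset.mem_range.1 hn, abs_of_nonneg (hw n)]
  have hAh := hA.mul hh
  have h1 : ∑ n ∈ Finset.range N, (mlSeries α lam * sibuyaSeries α).coeff n ≤ S * 1 := by
    refine (Finset.sum_le_sum fun n hn => ?_).trans
      ((hAh.1.sum_le_tsum (Finset.range N) fun _ _ => abs_nonneg _).trans hAh.2)
    refine le_trans (le_of_eq ?_) (le_abs_self _)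
    rw [PowerSeries.coeff_mul, PowerSeries.coeff_mul]
    refine Finset.sum_congr rfl fun kl hkl => ?_
    have hkl := Finset.HasAntidiagonal.mem_antidiagonal.1 hkl
    have hn := Finset.mem_range.1 hn
    simp [A, show kl.1 < N by omega]
  have h2 : ∑ n ∈ Finset.range N, (sibuyaSeries α).coeff n ≤ 1 :=
    (Finset.sum_le_sum fun n _ => le_abs_self _).trans
      ((hh.1.sum_le_tsum (Finset.range N) fun _ _ => abs_nonneg _).trans hh.2)
  have h3 : (lam + 1) * S = lam * ∑ n ∈ Finset.range N, (sibuyaSeries α).coeff n +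
      ∑ n ∈ Finset.range N, (mlSeries α lam * sibuyaSeries α).coeff n := by
    rw [hS, Finset.mul_sum, Finset.mul_sum, ← Finset.sum_add_distrib]
    exact Finset.sum_congr rfl fun n _ => coeff_mlSeries hlam n
  have h4 := mul_le_mul_of_nonneg_left h2 hlam.le
  by_contra hlt
  have := mul_lt_mul_of_pos_left (not_le.1 hlt) hlam
  linarith

/-- Multiplying an argument in [-π/2, π/2] by α ≤ 1 keeps it there. The bound serves both (1-u)^α
and, with β for α, s^β. -/
lemma re_cpow_nonneg (hα₀ : 0 < α) (hα₁ : α ≤ 1) {z : ℂ} (hz : 0 ≤ z.re) :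
    0 ≤ (z ^ (α : ℂ)).re := by
  rcases eq_or_ne z 0 with rfl | h0
  · simp [Complex.zero_cpow, hα₀.ne']
  rw [Complex.cpow_def_of_ne_zero h0, Complex.exp_re]
  refine mul_nonneg (Real.exp_pos _).le (Real.cos_nonneg_of_mem_Icc ?_)
  have harg := abs_le.1 (Complex.abs_arg_le_pi_div_two_iff.2 hz)
  have him : (Complex.log z * (α : ℂ)).im = Complex.arg z * α := by simp [Complex.log_im]
  rw [him]
  have hpi := Real.pi_pos
  constructor <;> nlinarith [harg.1, harg.2]

lemma add_cpow_ne_zero (hα₀ : 0 < α) (hα₁ : α ≤ 1) (hlam : 0 < lam) {z : ℂ} (hz : 0 ≤ z.re) :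
    (lam : ℂ) + z ^ (α : ℂ) ≠ 0 := fun h => by
  have h1 := congrArg Complex.re h
  have := re_cpow_nonneg hα₀ hα₁ hz
  simp only [Complex.add_re, Complex.ofReal_re, Complex.zero_re] at h1
  linarith

lemma psEval_mlSeries (hα₀ : 0 < α) (hα₁ : α ≤ 1) (hlam : 0 < lam) {u : ℂ} (hu : ‖u‖ ≤ 1) :
    psEval (mlSeries α lam) u = genTransitionML α lam u := by
  have hw := l1Bound_mlSeries hα₀ hα₁ hlam
  have hh := l1Bound_sibuyaSeries hα₀ hα₁
  have h := congrArg (psEval · u) (mlSeries_mul (α := α) hlam)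
  rw [hw.psEval_mul ((L1Bound.C _).sub hh) hu, (L1Bound.C _).psEval_mul hh hu,
    (L1Bound.C _).psEval_sub hh hu, psEval_C, psEval_C, psEval_sibuyaSeries hα₀ hα₁ hu] at h
  have hne := add_cpow_ne_zero hα₀ hα₁ hlam (re_one_sub_nonneg hu)
  rw [genTransitionML, div_mul_eq_mul_div, eq_div_iff hne, ← h]
  push_cast
  ring

lemma hasSum_mlSeries_real (hα₀ : 0 < α) (hα₁ : α ≤ 1) (hlam : 0 < lam) {u : ℝ} (hu : |u| ≤ 1) :
    HasSum (fun n => (mlSeries α lam).coeff n * u ^ n)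
      (lam / (lam + (1 - u) ^ α) * (1 - (1 - u) ^ α)) := by
  have hu' : ‖(u : ℂ)‖ ≤ 1 := by simpa using hu
  have h := (l1Bound_mlSeries hα₀ hα₁ hlam).hasSum hu'
  rw [psEval_mlSeries hα₀ hα₁ hlam hu', genTransitionML, ← Complex.ofReal_one,
    ← Complex.ofReal_sub, ← Complex.ofReal_cpow (by linarith [(abs_le.1 hu).2])] at h
  rw [← Complex.hasSum_ofReal]
  simpa using h

lemma transitionML_eq (hα₀ : 0 < α) (hα₁ : α ≤ 1) (hlam : 0 < lam) (i j : ℤ) :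
    transitionML α lam i j = if i ≤ j then (mlSeries α lam).coeff (j - i).toNat else 0 := by
  rw [transitionML, circulantOf]
  split_ifs with h
  · exact iteratedDeriv_div_factorial_of_hasSum
      (fun u hu => hasSum_mlSeries_real hα₀ hα₁ hlam hu.le) _
  · rfl

lemma transitionML_zero_natCast (hα₀ : 0 < α) (hα₁ : α ≤ 1) (hlam : 0 < lam) (n : ℕ) :
    transitionML α lam 0 n = (mlSeries α lam).coeff n := by
  rw [transitionML_eq hα₀ hα₁ hlam]; simp

lemma hasSum_coeff_mlSeries (hα₀ : 0 < α) (hα₁ : α ≤ 1) (hlam : 0 < lam) :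
    HasSum (fun n => (mlSeries α lam).coeff n) 1 := by
  have := hasSum_mlSeries_real hα₀ hα₁ hlam (u := 1) (by simp)
  simpa [Real.zero_rpow hα₀.ne', hlam.ne'] using this

/-- Both sides come from (λ+1)(1-u)^α/(λ+(1-u)^α) = 1 - W̄(u). This is the link between the operator
in (1) and the jump law of the walk. -/
lemma laplacianML_zero_natCast (hα₀ : 0 < α) (hα₁ : α ≤ 1) (hlam : 0 < lam) (n : ℕ) :
    (lam + 1) * laplacianML α lam 0 n = (1 - mlSeries α lam).coeff n := by
  have hl : lam + 1 ≠ 0 := by linarith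
  rw [laplacianML, circulantOf, if_pos (by positivity),
    iteratedDeriv_div_factorial_of_hasSum (a := fun n => (1 - mlSeries α lam).coeff n / (lam + 1))]
  · simp only [sub_zero, Int.toNat_natCast]
    field_simp
  · intro u hu
    have h1 : HasSum (fun n : ℕ => (1 : PowerSeries ℝ).coeff n * u ^ n) 1 := by
      simpa using hasSum_single (f := fun n : ℕ => (1 : PowerSeries ℝ).coeff n * u ^ n) 0
        fun n hn => by simp [PowerSeries.coeff_one, hn]
    have h2 := (h1.sub (hasSum_mlSeries_real hα₀ hα₁ hlam hu.le)).div_const (lam + 1)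
    have hpos : 0 < lam + (1 - u) ^ α := by
      have := Real.rpow_nonneg (by linarith [(abs_lt.1 hu).2] : 0 ≤ 1 - u) α
      linarith
    have e : (1 - u) ^ α / (lam + (1 - u) ^ α) =
        (1 - lam / (lam + (1 - u) ^ α) * (1 - (1 - u) ^ α)) / (lam + 1) := by
      field_simp
      ring
    rw [e]
    have e2 : (fun n => (1 - mlSeries α lam).coeff n / (lam + 1) * u ^ n) = fun n =>
        ((1 : PowerSeries ℝ).coeff n * u ^ n - (mlSeries α lam).coeff n * u ^ n) / (lam + 1) := by
      ext n
      rw [map_sub]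
      ring
    rw [e2]
    exact h2

lemma hasSum_transitionML (hα₀ : 0 < α) (hα₁ : α ≤ 1) (hlam : 0 < lam) (i : ℤ) :
    HasSum (fun j => transitionML α lam i j) 1 := by
  have hinj : Function.Injective fun n : ℕ => i + (n : ℤ) := fun a b h => by simpa using h
  rw [← hinj.hasSum_iff]
  · convert hasSum_coeff_mlSeries hα₀ hα₁ hlam using 2 with n
    simp [transitionML_eq hα₀ hα₁ hlam]
  · intro j hj
    rw [transitionML_eq hα₀ hα₁ hlam, if_neg]
    intro h
    exact hj ⟨(j - i).toNat, by simp; omega⟩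

/-- Translation invariance and triangularity turn matrix products into Cauchy products; the sum over
ℤ loses r < 0 and r > j, so it is finite. -/
lemma stepMatrix_transitionML (hα₀ : 0 < α) (hα₁ : α ≤ 1) (hlam : 0 < lam) (m : ℕ) (j : ℤ) :
    stepMatrix (transitionML α lam) m 0 j =
      if 0 ≤ j then (mlSeries α lam ^ m).coeff j.toNat else 0 := by
  induction m generalizing j with
  | zero =>
    rw [stepMatrix]
    rcases lt_trichotomy j 0 with h | h | h
    · simp [h.ne', h.not_ge]
    · simp [h]
    · have : j.toNat ≠ 0 := by omega
      simp [h.ne, h.le, PowerSeries.coeff_one, this]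
  | succ m ih =>
    rw [stepMatrix]
    have hinj : Function.Injective fun n : ℕ => (n : ℤ) := Nat.cast_injective
    rw [← hinj.tsum_eq]
    swap
    · intro r hr
      by_contra hne
      refine hr ?_
      simp only [ih]
      rw [if_neg, zero_mul]
      exact fun h => hne ⟨r.toNat, by simpa using h⟩
    simp only [ih, transitionML_eq hα₀ hα₁ hlam]
    split_ifs with hj
    · rw [tsum_eq_sum (s := Finset.range (j.toNat + 1)), pow_succ, PowerSeries.coeff_mul,
        Finset.Nat.sum_antidiagonal_eq_sum_range_succ
          (fun a b => (mlSeries α lam ^ m).coeff a * (mlSeries α lam).coeff b)]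
      · refine Finset.sum_congr rfl fun n hn => ?_
        have hn := Finset.mem_range.1 hn
        rw [if_pos (by positivity), if_pos (by omega)]
        congr 3
        omega
      · intro n hn
        have hn : ¬ n < j.toNat + 1 := fun h => hn (Finset.mem_range.2 h)
        rw [if_neg (c := (n : ℤ) ≤ j) (by omega), mul_zero]
    · convert tsum_zero with n
      rw [if_neg (c := (n : ℤ) ≤ j) (by omega), mul_zero]

end

/-! ### Power series in `t ^ β` -/

/-- On y > A the integrand of Γ(x+1) is at least e^{-y} A^x, and the integral of e^{-y} over that
range is e^{-A}. -/
lemma rpow_le_exp_mul_Gamma {A x : ℝ} (hA : 0 ≤ A) (hx : 0 ≤ x) :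
    A ^ x ≤ Real.exp A * Real.Gamma (x + 1) := by
  have hint := Real.GammaIntegral_convergent (s := x + 1) (by linarith)
  rw [Real.Gamma_eq_integral (by linarith)]
  have h1 : ∫ y in Ioi A, Real.exp (-y) * A ^ x ≤
      ∫ y in Ioi 0, Real.exp (-y) * y ^ (x + 1 - 1) := by
    refine (setIntegral_mono_on ((integrableOn_exp_neg_Ioi A).mul_const _)
      (hint.mono_set (Ioi_subset_Ioi hA)) measurableSet_Ioi fun y hy => ?_).trans
      (setIntegral_mono_set hint ?_ (Ioi_subset_Ioi hA).eventuallyLE)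
    · rw [add_sub_cancel_right]
      exact mul_le_mul_of_nonneg_left (Real.rpow_le_rpow hA (le_of_lt hy) hx) (Real.exp_pos _).le
    · filter_upwards [ae_restrict_mem measurableSet_Ioi] with y hy
      have hy : 0 < y := hy
      simp only [Pi.zero_apply]
      positivity
  rw [integral_mul_const, integral_exp_neg_Ioi] at h1
  calc A ^ x = Real.exp A * (Real.exp (-A) * A ^ x) := by
        rw [← mul_assoc, ← Real.exp_add]; simp
    _ ≤ _ := mul_le_mul_of_nonneg_left h1 (Real.exp_pos _).le

/-- The fractional monomial `t^{βk} / Γ(βk + 1)`. -/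
noncomputable def fracMono (β : ℝ) (k : ℕ) (t : ℝ) : ℝ := t ^ (β * k) / Real.Gamma (β * k + 1)

/-- The power series `∑ₖ aₖ t^{βk} / Γ(βk + 1)`. -/
noncomputable def fracSeries {E : Type*} [NormedAddCommGroup E] [NormedSpace ℝ E] (β : ℝ)
    (a : ℕ → E) (t : ℝ) : E := ∑' k, fracMono β k t • a k

/-- The exponential growth rate of a fractional power series with `‖aₖ‖ ≤ C Rᵏ`. -/
noncomputable def growthRate (β R : ℝ) : ℝ := (2 * R) ^ (1 / β)

lemma growthRate_nonneg (β : ℝ) {R : ℝ} (hR : 0 ≤ R) : 0 ≤ growthRate β R :=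
  Real.rpow_nonneg (by linarith) _

section

variable {β : ℝ}

lemma gamma_pos (hβ : 0 < β) (k : ℕ) : 0 < Real.Gamma (β * k + 1) :=
  Real.Gamma_pos_of_pos (by positivity)

lemma fracMono_nonneg (hβ : 0 < β) (k : ℕ) {t : ℝ} (ht : 0 ≤ t) : 0 ≤ fracMono β k t :=
  div_nonneg (Real.rpow_nonneg ht _) (gamma_pos hβ k).le

/-- Apply the Gamma bound at Mt with M = (2R)^{1/β}: then (Mt)^{βk} = (2R)^k t^{βk}, and the factor
2 in the growth rate pays for the convergent (1/2)^k. -/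
lemma fracMono_mul_pow_le (hβ : 0 < β) {R : ℝ} (hR : 0 ≤ R) (k : ℕ) {t : ℝ} (ht : 0 ≤ t) :
    fracMono β k t * R ^ k ≤ Real.exp (growthRate β R * t) * (1 / 2) ^ k := by
  have hM := growthRate_nonneg β hR
  have h := rpow_le_exp_mul_Gamma (mul_nonneg hM ht) (x := β * k) (by positivity)
  have e : growthRate β R ^ (β * k) = (2 * R) ^ k := by
    rw [growthRate, ← Real.rpow_mul (by positivity), ← Real.rpow_natCast]
    congr 1
    field_simp
  rw [Real.mul_rpow hM ht, e, mul_pow] at h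
  rw [fracMono, div_mul_eq_mul_div, div_le_iff₀ (gamma_pos hβ k), one_div_pow]
  have h2 : (0 : ℝ) < 2 ^ k := by positivity
  calc t ^ (β * k) * R ^ k = (2 ^ k * R ^ k * t ^ (β * k)) * (1 / 2 ^ k) := by field_simp
    _ ≤ _ := mul_le_mul_of_nonneg_right h (by positivity)
    _ = _ := by ring

variable {E : Type*} [NormedAddCommGroup E] [NormedSpace ℝ E] {a : ℕ → E} {C R : ℝ}

lemma norm_fracMono_smul_le (hβ : 0 < β) (hR : 0 ≤ R) (ha : ∀ k, ‖a k‖ ≤ C * R ^ k) (k : ℕ)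
    {t : ℝ} (ht : 0 ≤ t) :
    ‖fracMono β k t • a k‖ ≤ C * Real.exp (growthRate β R * t) * (1 / 2) ^ k := by
  have hC : 0 ≤ C := by simpa using (norm_nonneg _).trans (ha 0)
  rw [norm_smul, Real.norm_of_nonneg (fracMono_nonneg hβ k ht)]
  calc _ ≤ fracMono β k t * (C * R ^ k) :=
        mul_le_mul_of_nonneg_left (ha k) (fracMono_nonneg hβ k ht)
    _ = C * (fracMono β k t * R ^ k) := by ring
    _ ≤ C * (Real.exp (growthRate β R * t) * (1 / 2) ^ k) :=
        mul_le_mul_of_nonneg_left (fracMono_mul_pow_le hβ hR k ht) hC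
    _ = _ := by ring

lemma summable_norm_fracMono_smul (hβ : 0 < β) (hR : 0 ≤ R) (ha : ∀ k, ‖a k‖ ≤ C * R ^ k)
    {t : ℝ} (ht : 0 ≤ t) : Summable fun k => ‖fracMono β k t • a k‖ :=
  (summable_geometric_two.mul_left _).of_nonneg_of_le (fun _ => norm_nonneg _)
    fun k => norm_fracMono_smul_le hβ hR ha k ht

lemma hasSum_fracSeries [CompleteSpace E] (hβ : 0 < β) (hR : 0 ≤ R) (ha : ∀ k, ‖a k‖ ≤ C * R ^ k)
    {t : ℝ} (ht : 0 ≤ t) : HasSum (fun k => fracMono β k t • a k) (fracSeries β a t) :=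
  (summable_norm_fracMono_smul hβ hR ha ht).of_norm.hasSum

lemma continuous_fracMono (hβ : 0 < β) (k : ℕ) : Continuous (fracMono β k) :=
  (Real.continuous_rpow_const (by positivity)).div_const _

lemma fracMono_zero_right (hβ : 0 < β) (k : ℕ) : fracMono β k 0 = if k = 0 then 1 else 0 := by
  rcases eq_or_ne k 0 with rfl | hk
  · simp [fracMono]
  · have : β * k ≠ 0 := by positivity
    simp [fracMono, hk, Real.zero_rpow this]

lemma fracSeries_zero_right (hβ : 0 < β) (a : ℕ → E) : fracSeries β a 0 = a 0 := by
  rw [fracSeries, tsum_eq_single 0 fun k hk => by simp [fracMono_zero_right hβ, hk]]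
  simp [fracMono_zero_right hβ]

lemma continuousOn_fracSeries [CompleteSpace E] (hβ : 0 < β) (hR : 0 ≤ R)
    (ha : ∀ k, ‖a k‖ ≤ C * R ^ k) :
    ContinuousOn (fracSeries β a) (Ici 0) := by
  intro t ht
  have hC : 0 ≤ C := by simpa using (norm_nonneg _).trans (ha 0)
  have h : ContinuousOn (fracSeries β a) (Icc 0 (t + 1)) := by
    refine continuousOn_tsum (fun k => ((continuous_fracMono hβ k).smul
      continuous_const).continuousOn) (summable_geometric_two.mul_left
        (C * Real.exp (growthRate β R * (t + 1)))) fun k s hs => ?_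
    refine (norm_fracMono_smul_le hβ hR ha k hs.1).trans ?_
    have := growthRate_nonneg β hR
    have := hs.2
    gcongr
  refine (h t ⟨ht, by linarith⟩).mono_of_mem_nhdsWithin ?_
  rw [← Ici_inter_Iic]
  exact inter_mem self_mem_nhdsWithin (mem_nhdsWithin_of_mem_nhds (Iic_mem_nhds (by linarith)))

/-- The derivative of the fractional monomial. -/
noncomputable def fracMonoDeriv (β : ℝ) (k : ℕ) (t : ℝ) : ℝ :=
  β * k * t ^ (β * k - 1) / Real.Gamma (β * k + 1)

lemma hasDerivAt_fracMono (k : ℕ) {t : ℝ} (ht : 0 < t) :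
    HasDerivAt (fracMono β k) (fracMonoDeriv β k t) t := by
  have := (Real.hasDerivAt_rpow_const (x := t) (p := β * k) (Or.inl ht.ne')).div_const
    (Real.Gamma (β * k + 1))
  exact this

lemma fracMonoDeriv_nonneg (hβ : 0 < β) (k : ℕ) {t : ℝ} (ht : 0 ≤ t) : 0 ≤ fracMonoDeriv β k t :=
  div_nonneg (mul_nonneg (by positivity) (Real.rpow_nonneg ht _)) (gamma_pos hβ k).le

lemma fracMonoDeriv_eq (k : ℕ) {t : ℝ} (ht : 0 < t) :
    fracMonoDeriv β k t = β * k * t⁻¹ * fracMono β k t := by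
  rw [fracMonoDeriv, fracMono, Real.rpow_sub_one ht.ne']
  ring

/-- Differentiation costs a factor βk/s, harmless on intervals bounded away from 0; at 0 itself the
terms with βk < 1 are singular. -/
lemma norm_fracMonoDeriv_smul_le (hβ : 0 < β) (hR : 0 ≤ R)
    (ha : ∀ k, ‖a k‖ ≤ C * R ^ k) (k : ℕ) {r s T : ℝ} (hr : 0 < r) (hrs : r ≤ s) (hsT : s ≤ T) :
    ‖fracMonoDeriv β k s • a k‖ ≤
      β * r⁻¹ * (C * Real.exp (growthRate β R * T)) * ((k : ℝ) ^ 1 * (1 / 2) ^ k) := by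
  have hC : 0 ≤ C := by simpa using (norm_nonneg _).trans (ha 0)
  have hM := growthRate_nonneg β hR
  have hs0 : 0 < s := hr.trans_le hrs
  have h1 := norm_fracMono_smul_le hβ hR ha k hs0.le
  have h2 : C * Real.exp (growthRate β R * s) * (1 / 2) ^ k ≤
      C * Real.exp (growthRate β R * T) * (1 / 2) ^ k := by gcongr
  have h3 : β * k * s⁻¹ ≤ β * k * r⁻¹ := by gcongr
  rw [fracMonoDeriv_eq k hs0, mul_smul, norm_smul, Real.norm_of_nonneg (by positivity)]
  calc β * k * s⁻¹ * ‖fracMono β k s • a k‖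
      ≤ β * k * r⁻¹ * (C * Real.exp (growthRate β R * T) * (1 / 2) ^ k) :=
        mul_le_mul h3 (h1.trans h2) (norm_nonneg _) (by positivity)
    _ = _ := by ring

lemma hasDerivAt_fracSeries [CompleteSpace E] (hβ : 0 < β) (hR : 0 ≤ R)
    (ha : ∀ k, ‖a k‖ ≤ C * R ^ k) {t : ℝ} (ht : 0 < t) :
    HasDerivAt (fracSeries β a) (∑' k, fracMonoDeriv β k t • a k) t := by
  have hsum : Summable fun k : ℕ => β * (t / 2)⁻¹ *
      (C * Real.exp (growthRate β R * (2 * t))) * ((k : ℝ) ^ 1 * (1 / 2) ^ k) :=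
    (summable_pow_mul_geometric_of_norm_lt_one 1
      (by norm_num : ‖(1 / 2 : ℝ)‖ < 1)).mul_left _
  have hmem : t ∈ Ioo (t / 2) (2 * t) := ⟨by linarith, by linarith⟩
  have hd : ∀ (k : ℕ) (s : ℝ), s ∈ Ioo (t / 2) (2 * t) →
      HasDerivAt (fun s => fracMono β k s • a k) (fracMonoDeriv β k s • a k) s := fun k s hs =>
    (hasDerivAt_fracMono k (by linarith [hs.1])).smul_const _
  have hb : ∀ (k : ℕ) (s : ℝ), s ∈ Ioo (t / 2) (2 * t) → ‖fracMonoDeriv β k s • a k‖ ≤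
      β * (t / 2)⁻¹ * (C * Real.exp (growthRate β R * (2 * t))) * ((k : ℝ) ^ 1 * (1 / 2) ^ k) :=
    fun k s hs => norm_fracMonoDeriv_smul_le hβ hR ha k (by linarith) hs.1.le hs.2.le
  exact hasDerivAt_tsum_of_isPreconnected hsum isOpen_Ioo isPreconnected_Ioo hd hb hmem
    (hasSum_fracSeries hβ hR ha ht.le).summable hmem

lemma deriv_fracSeries [CompleteSpace E] (hβ : 0 < β) (hR : 0 ≤ R)
    (ha : ∀ k, ‖a k‖ ≤ C * R ^ k) {t : ℝ} (ht : 0 < t) :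
    deriv (fracSeries β a) t = ∑' k, fracMonoDeriv β k t • a k :=
  (hasDerivAt_fracSeries hβ hR ha ht).deriv

end

/-! ### Termwise integration -/

/-- Tonelli: the sum of the norms has finite integral, hence is finite almost everywhere, where the
series converges absolutely. -/
lemma integrable_tsum_of_summable_integral_norm {X E : Type*} [MeasurableSpace X] {μ : Measure X}
    [NormedAddCommGroup E] [CompleteSpace E] {F : ℕ → X → E} (hF : ∀ k, Integrable (F k) μ)
    (hs : Summable fun k => ∫ x, ‖F k x‖ ∂μ) : Integrable (fun x => ∑' k, F k x) μ := by
  have hfin : ∑' k, ∫⁻ x, ‖F k x‖ₑ ∂μ ≠ ⊤ := by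
    have : ∀ k, ∫⁻ x, ‖F k x‖ₑ ∂μ = ENNReal.ofReal (∫ x, ‖F k x‖ ∂μ) := fun k =>
      (ofReal_integral_norm_eq_lintegral_enorm (hF k)).symm
    simp only [this]
    exact hs.tsum_ofReal_ne_top
  have hle : ∫⁻ x, ∑' k, ‖F k x‖ₑ ∂μ ≠ ⊤ := by
    rwa [lintegral_tsum fun k => (hF k).aestronglyMeasurable.enorm]
  have hae : ∀ᵐ x ∂μ, Summable fun k => F k x := by
    filter_upwards [ae_lt_top' (.tsum fun k => (hF k).aestronglyMeasurable.enorm) hle]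
      with x hx
    refine Summable.of_norm ?_
    have := ENNReal.summable_toReal hx.ne
    simpa using this
  refine ⟨?_, ?_⟩
  · refine aestronglyMeasurable_of_tendsto_ae atTop
      (f := fun n x => ∑ k ∈ Finset.range n, F k x)
      (fun n => Finset.aestronglyMeasurable_fun_sum _ fun k _ => (hF k).aestronglyMeasurable) ?_
    filter_upwards [hae] with x hx using hx.hasSum.tendsto_sum_nat
  · refine lt_of_le_of_lt (lintegral_mono fun x => enorm_tsum_le_tsum_enorm) hle.lt_top

/-! ### Beta integrals -/

lemma integral_sub_rpow_mul_rpow {p q t : ℝ} (hp : 0 < p) (hq : 0 < q) (ht : 0 < t) :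
    ∫ τ in (0 : ℝ)..t, (t - τ) ^ (p - 1) * τ ^ (q - 1) =
      Real.Gamma p * (t ^ (p + q - 1) * (Real.Gamma q / Real.Gamma (p + q))) := by
  have h := Complex.betaIntegral_scaled (q : ℂ) (p : ℂ) ht
  rw [Complex.betaIntegral_eq_Gamma_mul_div _ _ (by simpa using hq) (by simpa using hp)] at h
  rw [← Complex.ofReal_inj, ← intervalIntegral.integral_ofReal]
  rw [intervalIntegral.integral_congr (g := fun x : ℝ => (x : ℂ) ^ ((q : ℂ) - 1) *
    ((t : ℂ) - x) ^ ((p : ℂ) - 1)), h]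
  · rw [← Complex.ofReal_add, Complex.Gamma_ofReal, Complex.Gamma_ofReal, Complex.Gamma_ofReal,
      ← Complex.ofReal_one, ← Complex.ofReal_sub, ← Complex.ofReal_cpow ht.le]
    push_cast
    rw [add_comm q p]
    ring
  · intro x hx
    rw [uIcc_of_le ht.le] at hx
    simp only
    rw [← Complex.ofReal_one, ← Complex.ofReal_sub, ← Complex.ofReal_sub, ← Complex.ofReal_sub,
      ← Complex.ofReal_cpow hx.1, ← Complex.ofReal_cpow (by linarith [hx.2])]
    push_cast
    ring

/-- A non-integrable function would have integral 0 by convention, whereas the Beta value is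
strictly positive. -/
lemma intervalIntegrable_sub_rpow_mul_rpow {p q t : ℝ} (hp : 0 < p) (hq : 0 < q) (ht : 0 < t) :
    IntervalIntegrable (fun τ => (t - τ) ^ (p - 1) * τ ^ (q - 1)) volume 0 t := by
  by_contra h
  have h1 := integral_sub_rpow_mul_rpow hp hq ht
  rw [intervalIntegral.integral_undef h] at h1
  have h2 := Real.Gamma_pos_of_pos hp
  have h3 := Real.Gamma_pos_of_pos hq
  have h4 := Real.Gamma_pos_of_pos (add_pos hp hq)
  have : 0 < Real.Gamma p * (t ^ (p + q - 1) * (Real.Gamma q / Real.Gamma (p + q))) := by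
    positivity
  linarith

section

variable {β : ℝ}

lemma fracMonoDeriv_zero (β t : ℝ) : fracMonoDeriv β 0 t = 0 := by simp [fracMonoDeriv]

lemma fracMonoDeriv_succ (hβ : 0 < β) (k : ℕ) (t : ℝ) :
    fracMonoDeriv β (k + 1) t = t ^ (β * (k + 1) - 1) / Real.Gamma (β * (k + 1)) := by
  have h : β * ((k : ℝ) + 1) ≠ 0 := by positivity
  have h2 := (Real.Gamma_pos_of_pos (by positivity : 0 < β * ((k : ℝ) + 1))).ne'
  rw [fracMonoDeriv]
  push_cast
  rw [Real.Gamma_add_one h]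
  field_simp

lemma integral_kernel_fracMonoDeriv_succ (hβ : 0 < β) {p : ℝ} (hp : 0 < p) (k : ℕ) {t : ℝ}
    (ht : 0 < t) :
    ∫ τ in (0 : ℝ)..t, (t - τ) ^ (p - 1) * fracMonoDeriv β (k + 1) τ =
      Real.Gamma p * (t ^ (p + β * (k + 1) - 1) / Real.Gamma (p + β * (k + 1))) := by
  have h2 := (Real.Gamma_pos_of_pos (by positivity : 0 < β * ((k : ℝ) + 1))).ne'
  simp only [fracMonoDeriv_succ hβ, ← mul_div_assoc]
  rw [intervalIntegral.integral_div, integral_sub_rpow_mul_rpow hp (by positivity) ht]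
  field_simp

lemma intervalIntegrable_kernel_fracMonoDeriv (hβ : 0 < β) {p : ℝ} (hp : 0 < p) (k : ℕ) {t : ℝ}
    (ht : 0 < t) :
    IntervalIntegrable (fun τ => (t - τ) ^ (p - 1) * fracMonoDeriv β k τ) volume 0 t := by
  cases k with
  | zero => simp [fracMonoDeriv_zero]
  | succ k =>
    simp only [fracMonoDeriv_succ hβ, ← mul_div_assoc]
    exact (intervalIntegrable_sub_rpow_mul_rpow hp (by positivity) ht).div_const _

variable {E : Type*} [NormedAddCommGroup E] [NormedSpace ℝ E] {a : ℕ → E} {C R : ℝ}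

/-- The kernel integral of the derivative of a fractional power series, termwise. -/
lemma kernel_deriv_fracSeries [CompleteSpace E] (hβ : 0 < β) (hR : 0 ≤ R)
    (ha : ∀ k, ‖a k‖ ≤ C * R ^ k) {p t : ℝ} (hp : 0 < p) (ht : 0 < t)
    (hs : Summable fun k : ℕ => t ^ (p + β * (k + 1) - 1) / Real.Gamma (p + β * (k + 1)) *
      ‖a (k + 1)‖) :
    IntervalIntegrable (fun τ => (t - τ) ^ (p - 1) • deriv (fracSeries β a) τ) volume 0 t ∧
    ∫ τ in (0 : ℝ)..t, (t - τ) ^ (p - 1) • deriv (fracSeries β a) τ =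
      Real.Gamma p • ∑' k : ℕ, (t ^ (p + β * (k + 1) - 1) / Real.Gamma (p + β * (k + 1))) •
        a (k + 1) := by
  have hGp := Real.Gamma_pos_of_pos hp
  let F : ℕ → ℝ → E := fun k τ => ((t - τ) ^ (p - 1) * fracMonoDeriv β k τ) • a k
  have hFint : ∀ k, IntegrableOn (F k) (Ioc 0 t) := fun k => by
    have := intervalIntegrable_kernel_fracMonoDeriv hβ hp k ht
    rw [intervalIntegrable_iff_integrableOn_Ioc_of_le ht.le] at this
    exact this.smul_const _
  have hI : ∀ k, ∫ τ in Ioc 0 t, (t - τ) ^ (p - 1) * fracMonoDeriv β (k + 1) τ =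
      Real.Gamma p * (t ^ (p + β * (k + 1) - 1) / Real.Gamma (p + β * (k + 1))) := fun k => by
    rw [← integral_kernel_fracMonoDeriv_succ hβ hp k ht, intervalIntegral.integral_of_le ht.le]
  have hnorm : ∀ k, ∫ τ in Ioc 0 t, ‖F k τ‖ =
      (∫ τ in Ioc 0 t, (t - τ) ^ (p - 1) * fracMonoDeriv β k τ) * ‖a k‖ := fun k => by
    rw [← integral_mul_const]
    refine setIntegral_congr_fun measurableSet_Ioc fun τ hτ => ?_
    simp only [F]
    rw [norm_smul, Real.norm_of_nonneg (mul_nonneg (Real.rpow_nonneg (by linarith [hτ.2]) _)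
      (fracMonoDeriv_nonneg hβ k hτ.1.le))]
  have hsum : Summable fun k => ∫ τ in Ioc 0 t, ‖F k τ‖ := by
    rw [← summable_nat_add_iff 1]
    simp only [hnorm, hI, mul_assoc]
    exact hs.mul_left _
  have heq : EqOn (fun τ => (t - τ) ^ (p - 1) • deriv (fracSeries β a) τ)
      (fun τ => ∑' k, F k τ) (Ioc 0 t) := fun τ hτ => by
    simp only [F, mul_smul]
    rw [deriv_fracSeries hβ hR ha hτ.1, tsum_const_smul'']
  rw [intervalIntegrable_iff_integrableOn_Ioc_of_le ht.le, intervalIntegral.integral_of_le ht.le,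
    integrableOn_congr_fun heq measurableSet_Ioc, setIntegral_congr_fun measurableSet_Ioc heq]
  refine ⟨integrable_tsum_of_summable_integral_norm hFint hsum, ?_⟩
  rw [← integral_tsum_of_summable_integral_norm hFint hsum]
  simp only [F, integral_smul_const]
  -- The constant monomial k = 0 has zero derivative, so the index starts at 1; this is the origin
  -- of the shift.
  rw [tsum_eq_zero_add']
  · simp only [hI, mul_smul, fracMonoDeriv_zero, mul_zero, integral_zero, zero_smul, zero_add]
    rw [tsum_const_smul'']
  · simp only [hI]
    refine Summable.of_norm ?_
    refine (hs.mul_left (Real.Gamma p)).congr fun k => ?_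
    have : 0 < Real.Gamma (p + β * (k + 1)) := Real.Gamma_pos_of_pos (by positivity)
    rw [norm_smul, Real.norm_of_nonneg (by positivity), mul_assoc]

omit [NormedSpace ℝ E] in
lemma bound_shift (ha : ∀ k, ‖a k‖ ≤ C * R ^ k) (k : ℕ) : ‖a (k + 1)‖ ≤ (C * R) * R ^ k :=
  (ha (k + 1)).trans_eq (by ring)

lemma caputoRegular_fracSeries [CompleteSpace E] (hβ : 0 < β) (hR : 0 ≤ R)
    (ha : ∀ k, ‖a k‖ ≤ C * R ^ k) : CaputoRegular (fracSeries β a) where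
  continuousOn := continuousOn_fracSeries hβ hR ha
  differentiableAt t ht := (hasDerivAt_fracSeries hβ hR ha ht).differentiableAt
  integrable t ht := by
    -- With p = 1 the kernel is identically 1, and the statement reduces to integrability of the
    -- derivative.
    have h := (kernel_deriv_fracSeries hβ hR ha one_pos ht ?_).1
    · simpa using h
    · have := (summable_nat_add_iff 1).2 (summable_norm_fracMono_smul hβ hR ha ht.le)
      refine this.congr fun k => ?_
      rw [norm_smul, Real.norm_of_nonneg (fracMono_nonneg hβ _ ht.le), fracMono]
      push_cast
      ring_nf

/-- The monomials are normalised so that the Caputo derivative takes the k-th to the (k-1)-th and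
kills the constant. For β < 1 this is the kernel integral with p = 1-β, whose factor Γ(1-β) cancels;
for β = 1 it is termwise differentiation. -/
lemma hasCaputoDerivAt_fracSeries [CompleteSpace E] (hβ : 0 < β) (hβ₁ : β ≤ 1) (hR : 0 ≤ R)
    (ha : ∀ k, ‖a k‖ ≤ C * R ^ k) {t : ℝ} (ht : 0 < t) :
    HasCaputoDerivAt β (fracSeries β a) (fracSeries β (fun k => a (k + 1)) t) t := by
  have hsh := summable_norm_fracMono_smul hβ hR (bound_shift ha) ht.le
  refine ⟨fun h1 => ?_, fun h1 => ?_⟩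
  · have h := hasDerivAt_fracSeries hβ hR ha ht
    convert h using 1
    have e : ∀ k : ℕ, fracMonoDeriv β (k + 1) t = fracMono β k t := fun k => by
      rw [fracMonoDeriv_succ hβ, fracMono, h1]
      simp
    rw [tsum_eq_zero_add']
    · simp only [e, fracMonoDeriv_zero, zero_smul, zero_add]
      rfl
    · simp only [e]
      exact hsh.of_norm
  · have hp : 0 < 1 - β := by
      have := lt_of_le_of_ne hβ₁ h1
      linarith
    have e2 : ∀ k : ℕ, 1 - β + β * ((k : ℝ) + 1) = β * k + 1 := fun k => by ring
    have h := kernel_deriv_fracSeries hβ hR ha hp ht ?_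
    · simp only [e2, add_sub_cancel_right, show 1 - β - 1 = -β by ring] at h
      refine ⟨h.1, ?_⟩
      rw [h.2, smul_smul, one_div, inv_mul_cancel₀ (Real.Gamma_pos_of_pos hp).ne', one_smul]
      rfl
    · simp only [e2, add_sub_cancel_right]
      refine hsh.congr fun k => ?_
      rw [norm_smul, Real.norm_of_nonneg (fracMono_nonneg hβ _ ht.le), fracMono]

end

/-! ### The Volterra equation and uniqueness -/

section

variable {β : ℝ} {E : Type*} [NormedAddCommGroup E] [NormedSpace ℝ E]

lemma CaputoRegular.integral_deriv [CompleteSpace E] {f : ℝ → E} (hf : CaputoRegular f) {t : ℝ}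
    (ht : 0 < t) : ∫ τ in (0 : ℝ)..t, deriv f τ = f t - f 0 :=
  intervalIntegral.integral_eq_sub_of_hasDerivAt_of_le ht.le
    (hf.continuousOn.mono Icc_subset_Ici_self)
    (fun τ hτ => (hf.differentiableAt τ hτ.1).hasDerivAt) (hf.integrable t ht)

/-- The composition of the Abel kernels of orders `β` and `1 - β`. -/
noncomputable def abelKernel (β t r τ : ℝ) : ℝ :=
  if τ < r then (t - r) ^ (β - 1) * (r - τ) ^ (-β) else 0

lemma measurable_abelKernel (β t : ℝ) :
    Measurable fun z : ℝ × ℝ => abelKernel β t z.1 z.2 :=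
  Measurable.ite (measurableSet_lt measurable_snd measurable_fst)
    (by fun_prop) measurable_const

/-- After shifting by τ this is a Beta integral over (0, t-τ). The power of t-τ is β + (1-β) - 1 =
0, so the value depends on neither endpoint. -/
lemma setIntegral_abelKernel (hβ : 0 < β) (hβ₁ : β < 1) {t τ : ℝ} (hτ : 0 < τ) (hτt : τ < t) :
    IntegrableOn (fun r => abelKernel β t r τ) (Ioc 0 t) ∧
    ∫ r in Ioc 0 t, abelKernel β t r τ = Real.Gamma β * Real.Gamma (1 - β) := by
  have h0 : 0 < t - τ := by linarith
  have e1 : 1 - β - 1 = -β := by ring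
  have hint := intervalIntegrable_sub_rpow_mul_rpow hβ (by linarith : 0 < 1 - β) h0
  have hval := integral_sub_rpow_mul_rpow hβ (by linarith : 0 < 1 - β) h0
  rw [e1] at hint hval
  have e2 : ∀ r, t - τ - (r - τ) = t - r := fun r => by ring
  have hint' := hint.comp_sub_right τ
  simp only [e2, zero_add, sub_add_cancel] at hint'
  have hval' := intervalIntegral.integral_comp_sub_right (a := τ) (b := t)
    (fun s => (t - τ - s) ^ (β - 1) * s ^ (-β)) τ
  simp only [e2, sub_self] at hval'
  rw [hval, add_sub_cancel, sub_self, Real.rpow_zero, Real.Gamma_one, div_one, one_mul] at hval'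
  rw [intervalIntegrable_iff_integrableOn_Ioc_of_le hτt.le] at hint'
  rw [intervalIntegral.integral_of_le hτt.le] at hval'
  have heq : (fun r => abelKernel β t r τ) =
      (Ioi τ).indicator fun r => (t - r) ^ (β - 1) * (r - τ) ^ (-β) := by
    ext r
    simp [abelKernel, indicator]
  have hset : Ioc 0 t ∩ Ioi τ = Ioc τ t := by
    ext r
    simp only [mem_inter_iff, mem_Ioc, mem_Ioi]
    constructor
    · rintro ⟨⟨-, h⟩, h'⟩; exact ⟨h', h⟩
    · rintro ⟨h, h'⟩; exact ⟨⟨by linarith, h'⟩, h⟩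
  rw [heq, setIntegral_indicator measurableSet_Ioi, hset, IntegrableOn,
    integrable_indicator_iff measurableSet_Ioi, IntegrableOn,
    Measure.restrict_restrict measurableSet_Ioi, inter_comm, hset]
  exact ⟨hint', hval'⟩

lemma abelKernel_nonneg {t r τ : ℝ} (hr : r ≤ t) : 0 ≤ abelKernel β t r τ := by
  rw [abelKernel]
  split_ifs with h
  · exact mul_nonneg (Real.rpow_nonneg (by linarith) _) (Real.rpow_nonneg (by linarith) _)
  · exact le_rfl

/-- Fubini on the triangle τ < r < t: fractional integrals of orders β and 1-β compose to the
ordinary integral. -/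
lemma integral_abel_abel [CompleteSpace E] (hβ : 0 < β) (hβ₁ : β < 1) {g : ℝ → E} {t : ℝ}
    (ht : 0 < t) (hg : IntervalIntegrable g volume 0 t) :
    ∫ r in (0 : ℝ)..t, (t - r) ^ (β - 1) • ∫ τ in (0 : ℝ)..r, (r - τ) ^ (-β) • g τ =
      (Real.Gamma β * Real.Gamma (1 - β)) • ∫ τ in (0 : ℝ)..t, g τ := by
  rw [intervalIntegrable_iff_integrableOn_Ioc_of_le ht.le] at hg
  have hmem : ∀ᵐ τ ∂(volume.restrict (Ioc 0 t)), τ ∈ Ioo 0 t := by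
    rw [← restrict_Ioo_eq_restrict_Ioc]
    exact ae_restrict_mem measurableSet_Ioo
  have hprod : Integrable (Function.uncurry fun r τ => abelKernel β t r τ • g τ)
      ((volume.restrict (Ioc 0 t)).prod (volume.restrict (Ioc 0 t))) := by
    have hm : AEStronglyMeasurable (Function.uncurry fun r τ => abelKernel β t r τ • g τ)
        ((volume.restrict (Ioc 0 t)).prod (volume.restrict (Ioc 0 t))) :=
      (measurable_abelKernel β t).aestronglyMeasurable.smul hg.aestronglyMeasurable.comp_snd
    refine (integrable_prod_iff' hm).2 ⟨?_, ?_⟩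
    · filter_upwards [hmem] with τ hτ
      exact (setIntegral_abelKernel hβ hβ₁ hτ.1 hτ.2).1.smul_const (g τ)
    · refine (hg.norm.const_mul (Real.Gamma β * Real.Gamma (1 - β))).congr ?_
      filter_upwards [hmem] with τ hτ
      rw [← (setIntegral_abelKernel hβ hβ₁ hτ.1 hτ.2).2, ← integral_mul_const]
      refine setIntegral_congr_fun measurableSet_Ioc fun r hr => ?_
      simp only [Function.uncurry]
      rw [norm_smul, Real.norm_of_nonneg (abelKernel_nonneg hr.2)]
  have hswap := integral_integral_swap hprod
  rw [intervalIntegral.integral_of_le ht.le, intervalIntegral.integral_of_le ht.le]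
  rw [← integral_smul]
  calc _ = ∫ r in Ioc 0 t, ∫ τ in Ioc 0 t, abelKernel β t r τ • g τ := by
        refine setIntegral_congr_fun measurableSet_Ioc fun r hr => ?_
        rw [intervalIntegral.integral_of_le hr.1.le, ← integral_smul]
        have heq : (fun τ => abelKernel β t r τ • g τ) =
            (Iio r).indicator fun τ => (t - r) ^ (β - 1) • (r - τ) ^ (-β) • g τ := by
          ext τ
          by_cases h : τ < r <;> simp [abelKernel, indicator, h, mul_smul]
        have hset : Ioc 0 t ∩ Iio r = Ioo 0 r := by
          ext τ
          simp only [mem_inter_iff, mem_Ioc, mem_Iio, mem_Ioo]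
          exact ⟨fun h => ⟨h.1.1, h.2⟩, fun h => ⟨⟨h.1, h.2.le.trans hr.2⟩, h.2⟩⟩
        rw [heq, setIntegral_indicator measurableSet_Iio, hset, restrict_Ioo_eq_restrict_Ioc]
    _ = ∫ τ in Ioc 0 t, ∫ r in Ioc 0 t, abelKernel β t r τ • g τ := hswap
    _ = _ := by
        refine integral_congr_ae ?_
        filter_upwards [hmem] with τ hτ
        rw [integral_smul_const, (setIntegral_abelKernel hβ hβ₁ hτ.1 hτ.2).2]

/-- Fractional integration of order β undoes the Caputo derivative up to the initial value, leaving
an equation without derivatives of f. -/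
lemma volterra_of_caputo [CompleteSpace E] (hβ : 0 < β) (hβ₁ : β ≤ 1) {f v : ℝ → E}
    (hf : CaputoRegular f) (hv : ∀ t, 0 < t → HasCaputoDerivAt β f (v t) t) {t : ℝ} (ht : 0 < t) :
    ∫ r in (0 : ℝ)..t, (t - r) ^ (β - 1) • v r = Real.Gamma β • (f t - f 0) := by
  rw [← hf.integral_deriv ht]
  rcases hβ₁.eq_or_lt with rfl | h1
  · simp only [sub_self, Real.rpow_zero, one_smul, Real.Gamma_one]
    rw [intervalIntegral.integral_of_le ht.le, intervalIntegral.integral_of_le ht.le]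
    exact setIntegral_congr_fun measurableSet_Ioc fun r hr => ((hv r hr.1).1 rfl).deriv.symm
  · have hG : Real.Gamma (1 - β) ≠ 0 := (Real.Gamma_pos_of_pos (by linarith)).ne'
    have h := integral_abel_abel hβ h1 ht (hf.integrable t ht)
    have e : ∫ r in (0 : ℝ)..t, (t - r) ^ (β - 1) • v r = (1 / Real.Gamma (1 - β)) •
        ∫ r in (0 : ℝ)..t, (t - r) ^ (β - 1) • ∫ τ in (0 : ℝ)..r, (r - τ) ^ (-β) • deriv f τ := by
      rw [← intervalIntegral.integral_smul, intervalIntegral.integral_of_le ht.le,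
        intervalIntegral.integral_of_le ht.le]
      refine setIntegral_congr_fun measurableSet_Ioc fun r hr => ?_
      rw [← ((hv r hr.1).2 h1.ne).2, smul_comm]
    rw [e, h, smul_smul]
    congr 1
    field_simp

/-- Substituting t-r and extending to the half-line gives a Gamma integral. The gain is the factor
σ^{-β}, arbitrarily small for large σ. -/
lemma integral_kernel_exp_le (hβ : 0 < β) {σ t : ℝ} (hσ : 0 < σ) (ht : 0 < t) :
    IntervalIntegrable (fun r => (t - r) ^ (β - 1) * Real.exp (σ * r)) volume 0 t ∧
    ∫ r in (0 : ℝ)..t, (t - r) ^ (β - 1) * Real.exp (σ * r) ≤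
      Real.exp (σ * t) * ((1 / σ) ^ β * Real.Gamma β) := by
  have hmain : IntegrableOn (fun s : ℝ => s ^ (β - 1) * Real.exp (-(σ * s))) (Ioi 0) := by
    have := integrableOn_rpow_mul_exp_neg_mul_rpow (s := β - 1) (p := 1) (b := σ)
      (by linarith) one_pos hσ
    simpa [neg_mul] using this
  have hI : IntervalIntegrable (fun s : ℝ => s ^ (β - 1) * Real.exp (-(σ * s))) volume 0 t := by
    rw [intervalIntegrable_iff_integrableOn_Ioc_of_le ht.le]
    exact hmain.mono_set Ioc_subset_Ioi_self
  have e : ∀ r, Real.exp (σ * t) * ((t - r) ^ (β - 1) * Real.exp (-(σ * (t - r)))) =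
      (t - r) ^ (β - 1) * Real.exp (σ * r) := fun r => by
    rw [mul_left_comm, ← Real.exp_add]
    congr 2
    ring
  constructor
  · have := ((hI.comp_sub_left t).const_mul (Real.exp (σ * t))).symm
    simpa [e] using this
  · simp only [← e]
    rw [intervalIntegral.integral_const_mul, intervalIntegral.integral_comp_sub_left
      (fun s => s ^ (β - 1) * Real.exp (-(σ * s))), sub_self, sub_zero,
      intervalIntegral.integral_of_le ht.le, ← Real.integral_rpow_mul_exp_neg_mul_Ioi hβ hσ]
    refine mul_le_mul_of_nonneg_left (setIntegral_mono_set hmain ?_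
      Ioc_subset_Ioi_self.eventuallyLE) (Real.exp_pos _).le
    filter_upwards [ae_restrict_mem measurableSet_Ioi] with s hs
    have hs : 0 < s := hs
    simp only [Pi.zero_apply]
    positivity

/-- Take the maximum B of e^{-σs}‖d(s)‖ on the whole interval [0, t]. The Volterra equation at a
maximiser gives B ≤ |K|σ^{-β} B, and σ is chosen to make the factor less than 1. -/
lemma eq_zero_of_caputo [CompleteSpace E] (hβ : 0 < β) (hβ₁ : β ≤ 1) {d v : ℝ → E} {K : ℝ}
    (hd : CaputoRegular d) (h0 : d 0 = 0) (hv : ∀ t, 0 < t → HasCaputoDerivAt β d (v t) t)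
    (hK : ∀ t, 0 < t → ‖v t‖ ≤ K * ‖d t‖) {t : ℝ} (ht : 0 ≤ t) : d t = 0 := by
  rcases ht.eq_or_lt with rfl | ht
  · exact h0
  have hG := Real.Gamma_pos_of_pos hβ
  obtain ⟨σ, hσ, hσK⟩ : ∃ σ : ℝ, 0 < σ ∧ |K| * (1 / σ) ^ β < 1 := by
    -- With this σ the contraction factor is |K|/(|K|+1).
    refine ⟨(|K| + 1) ^ (1 / β), by positivity, ?_⟩
    rw [Real.div_rpow zero_le_one (by positivity), ← Real.rpow_mul (by positivity),
      one_div_mul_cancel hβ.ne', Real.rpow_one, Real.one_rpow, mul_one_div,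
      div_lt_one (by positivity)]
    linarith
  have hcont : ContinuousOn (fun s => Real.exp (-(σ * s)) * ‖d s‖) (Icc 0 t) :=
    (by fun_prop : Continuous fun s => Real.exp (-(σ * s))).continuousOn.mul
      (hd.continuousOn.mono Icc_subset_Ici_self).norm
  obtain ⟨m, hm, hmax⟩ := isCompact_Icc.exists_isMaxOn (nonempty_Icc.2 ht.le) hcont
  set B := Real.exp (-(σ * m)) * ‖d m‖ with hB
  have hB_nonneg : 0 ≤ B := by positivity
  have hbound : ∀ s ∈ Icc 0 t, ‖d s‖ ≤ B * Real.exp (σ * s) := fun s hs => by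
    have h : Real.exp (-(σ * s)) * ‖d s‖ ≤ B := hmax hs
    calc ‖d s‖ = Real.exp (-(σ * s)) * ‖d s‖ * Real.exp (σ * s) := by
          rw [mul_right_comm, ← Real.exp_add]; simp
      _ ≤ _ := mul_le_mul_of_nonneg_right h (Real.exp_pos _).le
  have hBz : B = 0 := by
    rcases hm.1.eq_or_lt with h | hm0
    · rw [hB, ← h, h0]; simp
    have hvol := volterra_of_caputo hβ hβ₁ hd hv hm0
    rw [h0, sub_zero] at hvol
    obtain ⟨hi, hle⟩ := integral_kernel_exp_le hβ hσ hm0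
    have h1 : ‖∫ r in (0 : ℝ)..m, (m - r) ^ (β - 1) • v r‖ ≤
        ∫ r in (0 : ℝ)..m, (|K| * B) * ((m - r) ^ (β - 1) * Real.exp (σ * r)) := by
      refine intervalIntegral.norm_integral_le_of_norm_le hm0.le ?_ (hi.const_mul _)
      filter_upwards with r hr
      have hr0 : 0 ≤ (m - r) ^ (β - 1) := Real.rpow_nonneg (by linarith [hr.2]) _
      rw [norm_smul, Real.norm_of_nonneg hr0]
      have h2 : ‖v r‖ ≤ |K| * (B * Real.exp (σ * r)) :=
        (hK r hr.1).trans (mul_le_mul (le_abs_self _) (hbound r ⟨hr.1.le, hr.2.trans hm.2⟩)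
          (norm_nonneg _) (abs_nonneg _))
      calc _ ≤ (m - r) ^ (β - 1) * (|K| * (B * Real.exp (σ * r))) :=
            mul_le_mul_of_nonneg_left h2 hr0
        _ = _ := by ring
    rw [hvol, norm_smul, Real.norm_of_nonneg hG.le, intervalIntegral.integral_const_mul] at h1
    have h2 : Real.Gamma β * ‖d m‖ ≤ Real.Gamma β *
        (|K| * B * (Real.exp (σ * m) * (1 / σ) ^ β)) := by
      refine h1.trans ((mul_le_mul_of_nonneg_left hle (by positivity)).trans_eq ?_)
      ring
    have h3 := le_of_mul_le_mul_left h2 hG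
    have h4 : B ≤ (|K| * (1 / σ) ^ β) * B := by
      calc B ≤ Real.exp (-(σ * m)) * (|K| * B * (Real.exp (σ * m) * (1 / σ) ^ β)) :=
            mul_le_mul_of_nonneg_left h3 (Real.exp_pos _).le
        _ = (Real.exp (-(σ * m)) * Real.exp (σ * m)) * (|K| * (1 / σ) ^ β) * B := by ring
        _ = _ := by rw [← Real.exp_add]; simp
    by_contra hne
    have : 0 < B := lt_of_le_of_ne hB_nonneg (Ne.symm hne)
    nlinarith
  have := hbound t ⟨ht.le, le_rfl⟩
  rw [hBz, zero_mul] at this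
  exact norm_le_zero_iff.1 this

lemma CaputoRegular.sub {f g : ℝ → E} (hf : CaputoRegular f) (hg : CaputoRegular g) :
    CaputoRegular fun t => f t - g t where
  continuousOn := hf.continuousOn.sub hg.continuousOn
  differentiableAt t ht := (hf.differentiableAt t ht).sub (hg.differentiableAt t ht)
  integrable t ht := by
    refine ((hf.integrable t ht).sub (hg.integrable t ht)).congr fun τ hτ => ?_
    rw [uIoc_of_le ht.le] at hτ
    exact (deriv_fun_sub (hf.differentiableAt τ hτ.1) (hg.differentiableAt τ hτ.1)).symm

lemma HasCaputoDerivAt.sub {f g : ℝ → E} {v w : E} {t : ℝ} (hf : CaputoRegular f)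
    (hg : CaputoRegular g) (ht : 0 < t) (hfv : HasCaputoDerivAt β f v t)
    (hgw : HasCaputoDerivAt β g w t) : HasCaputoDerivAt β (fun t => f t - g t) (v - w) t := by
  refine ⟨fun h => (hfv.1 h).sub (hgw.1 h), fun h => ?_⟩
  have e : EqOn (fun τ => (t - τ) ^ (-β) • deriv f τ - (t - τ) ^ (-β) • deriv g τ)
      (fun τ => (t - τ) ^ (-β) • deriv (fun t => f t - g t) τ) (uIoc 0 t) := fun τ hτ => by
    rw [uIoc_of_le ht.le] at hτ
    simp only
    rw [deriv_fun_sub (hf.differentiableAt τ hτ.1) (hg.differentiableAt τ hτ.1), smul_sub]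
  refine ⟨((hfv.2 h).1.sub (hgw.2 h).1).congr e, ?_⟩
  rw [← (hfv.2 h).2, ← (hgw.2 h).2, ← smul_sub, ← intervalIntegral.integral_sub (hfv.2 h).1
    (hgw.2 h).1]
  congr 1
  exact (intervalIntegral.integral_congr_ae (Eventually.of_forall fun _ h => e h)).symm

lemma CaputoRegular.congr {f g : ℝ → E} (hf : CaputoRegular f) (h : EqOn g f (Ici 0)) :
    CaputoRegular g := by
  have he : ∀ t, 0 < t → g =ᶠ[𝓝 t] f := fun t ht => by
    filter_upwards [Ioi_mem_nhds ht] with s hs using h (mem_Ici.2 (le_of_lt hs))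
  refine ⟨hf.continuousOn.congr h, fun t ht =>
    (hf.differentiableAt t ht).congr_of_eventuallyEq (he t ht), fun t ht => ?_⟩
  refine (hf.integrable t ht).congr fun τ hτ => ?_
  rw [uIoc_of_le ht.le] at hτ
  exact (he τ hτ.1).deriv_eq.symm

lemma HasCaputoDerivAt.congr {f g : ℝ → E} {v : E} {t : ℝ} (ht : 0 < t)
    (hf : HasCaputoDerivAt β f v t) (h : EqOn g f (Ici 0)) : HasCaputoDerivAt β g v t := by
  have he : ∀ t, 0 < t → g =ᶠ[𝓝 t] f := fun t ht => by
    filter_upwards [Ioi_mem_nhds ht] with s hs using h (mem_Ici.2 (le_of_lt hs))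
  have e : EqOn (fun τ => (t - τ) ^ (-β) • deriv f τ) (fun τ => (t - τ) ^ (-β) • deriv g τ)
      (uIoc 0 t) := fun τ hτ => by
    rw [uIoc_of_le ht.le] at hτ
    simp only
    rw [(he τ hτ.1).deriv_eq]
  exact ⟨fun h1 => (hf.1 h1).congr_of_eventuallyEq (he t ht), fun h1 =>
    ⟨(hf.2 h1).1.congr e, by rw [← (hf.2 h1).2,
      intervalIntegral.integral_congr_ae (Eventually.of_forall fun _ h => e h)]⟩⟩

end

/-! ### Laplace transforms -/

section

variable {β : ℝ}

lemma norm_exp_neg_mul (s : ℂ) (t : ℝ) : ‖Complex.exp (-s * t)‖ = Real.exp (-s.re * t) := by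
  rw [Complex.norm_exp]; simp

open scoped FourierTransform in
/-- Uniqueness of the Laplace transform on a vertical line, at points of continuity. -/
lemma eq_zero_of_laplace_eq_zero {h : ℝ → ℂ} {σ : ℝ}
    (hi : IntegrableOn (fun t : ℝ => Complex.exp (-(σ : ℂ) * t) * h t) (Ioi 0))
    (hz : ∀ s : ℂ, s.re = σ → ∫ t in Ioi (0 : ℝ), Complex.exp (-s * t) * h t = 0)
    {t : ℝ} (ht : 0 < t) (hc : ContinuousAt h t) : h t = 0 := by
  let F : ℝ → ℂ := (Ioi 0).indicator fun t : ℝ => Complex.exp (-(σ : ℂ) * t) * h t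
  have hF : Integrable F := (integrable_indicator_iff measurableSet_Ioi).2 hi
  -- The Fourier transform of e^{-σt}h at frequency w is the Laplace transform at σ + 2πiw.
  have hfourier : 𝓕 F = 0 := by
    ext w
    rw [Real.fourier_real_eq_integral_exp_smul]
    have e : (fun v : ℝ => Complex.exp (((-2 * Real.pi * v * w : ℝ) : ℂ) * Complex.I) • F v) =
        (Ioi 0).indicator fun v : ℝ =>
          Complex.exp (-((σ : ℂ) + (2 * Real.pi * w : ℝ) * Complex.I) * v) * h v := by
      ext v
      by_cases hv : v ∈ Ioi 0
      · simp only [F, indicator_of_mem hv, smul_eq_mul]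
        rw [← mul_assoc, ← Complex.exp_add]
        congr 2
        push_cast
        ring
      · simp [F, indicator_of_notMem hv]
    rw [e, integral_indicator measurableSet_Ioi, hz _ (by simp)]
    rfl
  have hinv := hF.fourierInv_fourier_eq (by rw [hfourier]; exact integrable_zero _ _ _) (v := t) ?_
  · rw [hfourier] at hinv
    have h0 : F t = 0 := by
      rw [← hinv]
      simp [Real.fourierInv_eq]
    simp only [F, indicator_of_mem (mem_Ioi.2 ht)] at h0
    exact (mul_eq_zero.1 h0).resolve_left (Complex.exp_ne_zero _)
  · have h1 : ContinuousAt (fun t : ℝ => Complex.exp (-(σ : ℂ) * t) * h t) t :=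
      ContinuousAt.mul (by fun_prop) hc
    refine h1.congr ?_
    filter_upwards [Ioi_mem_nhds ht] with s hs
    simp only [F, indicator_of_mem hs]

/-- Identity theorem: the positive reals accumulate at 1, inside the connected half-plane. -/
lemma eqOn_right_half_plane {f g : ℂ → ℂ} (hf : DifferentiableOn ℂ f {s | 0 < s.re})
    (hg : DifferentiableOn ℂ g {s | 0 < s.re}) (h : ∀ x : ℝ, 0 < x → f x = g x) {s : ℂ}
    (hs : 0 < s.re) : f s = g s := by
  have ho : IsOpen {s : ℂ | 0 < s.re} := isOpen_lt continuous_const Complex.continuous_re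
  have hconv : Convex ℝ {s : ℂ | 0 < s.re} := convex_halfSpace_re_gt 0
  refine (hf.analyticOnNhd ho).eqOn_of_preconnected_of_frequently_eq (hg.analyticOnNhd ho)
    hconv.isPreconnected (z₀ := 1) (by simp) ?_ hs
  have ht : Tendsto (fun x : ℝ => (x : ℂ)) (𝓝[>] 1) (𝓝[≠] 1) := by
    refine tendsto_nhdsWithin_iff.2 ⟨?_, ?_⟩
    · have : Tendsto (fun x : ℝ => (x : ℂ)) (𝓝 1) (𝓝 ((1 : ℝ) : ℂ)) :=
        Complex.continuous_ofReal.tendsto 1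
      simpa using this.mono_left nhdsWithin_le_nhds
    · filter_upwards [self_mem_nhdsWithin] with x hx
      have hx : (1 : ℝ) < x := hx
      simp only [mem_compl_iff, mem_singleton_iff]
      exact_mod_cast hx.ne'
  refine ht.frequently (Eventually.frequently ?_)
  filter_upwards [self_mem_nhdsWithin] with x hx
  exact h x (zero_lt_one.trans hx)

lemma differentiableOn_laplace {Ω : Type*} [MeasurableSpace Ω] {μ : Measure Ω} {X : Ω → ℝ}
    (hX : ∀ x : ℝ, 0 < x → Integrable (fun ω => Real.exp (-x * X ω)) μ) :
    DifferentiableOn ℂ (fun s : ℂ => ∫ ω, Complex.exp (-s * X ω) ∂μ) {s | 0 < s.re} := by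
  have hsub : Iio 0 ⊆ interior (integrableExpSet X μ) := by
    refine interior_maximal (fun x hx => ?_) isOpen_Iio
    have := hX (-x) (by simpa using hx)
    rwa [neg_neg] at this
  intro s hs
  have h1 : DifferentiableAt ℂ (complexMGF X μ) (-s) :=
    (analyticAt_complexMGF (hsub (by simpa using hs))).differentiableAt
  exact (h1.comp s differentiableAt_id.neg).differentiableWithinAt

lemma cpow_re_pos {s : ℂ} (hs : 0 < s.re) : s ≠ 0 := fun h => by simp [h] at hs

lemma differentiableAt_cpow_const {s : ℂ} (hs : 0 < s.re) (c : ℂ) :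
    DifferentiableAt ℂ (fun s : ℂ => s ^ c) s :=
  differentiableAt_id.cpow_const (Or.inl hs)

lemma integrableOn_exp_mul_fracMono (hβ : 0 < β) (k : ℕ) {x : ℝ} (hx : 0 < x) :
    IntegrableOn (fun t => Real.exp (-x * t) * fracMono β k t) (Ioi 0) := by
  have h : IntegrableOn (fun t : ℝ => t ^ (β * k) * Real.exp (-x * t ^ (1 : ℝ)) /
      Real.Gamma (β * k + 1)) (Ioi 0) :=
    (integrableOn_rpow_mul_exp_neg_mul_rpow (s := β * k) (p := 1) (b := x)
      (by linarith [show 0 ≤ β * k by positivity]) one_pos hx).div_const (Real.Gamma (β * k + 1))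
  refine h.congr_fun (fun t _ => ?_) measurableSet_Ioi
  simp only [Real.rpow_one, fracMono]
  ring

lemma integral_exp_mul_fracMono (hβ : 0 < β) (k : ℕ) {x : ℝ} (hx : 0 < x) :
    ∫ t in Ioi (0 : ℝ), Real.exp (-x * t) * fracMono β k t = x⁻¹ * ((x ^ β)⁻¹) ^ k := by
  have hG := gamma_pos hβ k
  have h := Real.integral_rpow_mul_exp_neg_mul_Ioi (a := β * k + 1) (by positivity) hx
  rw [add_sub_cancel_right] at h
  calc _ = ∫ t in Ioi (0 : ℝ), (t ^ (β * k) * Real.exp (-(x * t))) / Real.Gamma (β * k + 1) := by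
        congr 1; ext t; rw [fracMono, neg_mul]; ring
    _ = (1 / x) ^ (β * k + 1) := by rw [integral_div, h, mul_div_cancel_right₀ _ hG.ne']
    _ = _ := by
        rw [one_div, Real.inv_rpow hx.le, Real.rpow_add_one hx.ne', Real.rpow_mul hx.le,
          Real.rpow_natCast, mul_inv, inv_pow, mul_comm]

/-- The monomial is taken as a density, so the transform is a complex moment generating function and
hence analytic; it is then continued from the real Gamma integral. -/
lemma integral_cexp_mul_fracMono (hβ : 0 < β) (k : ℕ) {s : ℂ} (hs : 0 < s.re) :
    ∫ t in Ioi (0 : ℝ), Complex.exp (-s * t) * (fracMono β k t : ℂ) =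
      s⁻¹ * ((s ^ (β : ℂ))⁻¹) ^ k := by
  let μ : Measure ℝ := (volume.restrict (Ioi 0)).withDensity fun t =>
    ENNReal.ofReal (fracMono β k t)
  have hmeas : Measurable fun t => ENNReal.ofReal (fracMono β k t) :=
    (continuous_fracMono hβ k).measurable.ennreal_ofReal
  have htop : ∀ᵐ t ∂(volume.restrict (Ioi (0 : ℝ))), ENNReal.ofReal (fracMono β k t) < ⊤ :=
    Eventually.of_forall fun _ => ENNReal.ofReal_lt_top
  have hmem : ∀ᵐ t ∂(volume.restrict (Ioi (0 : ℝ))), t ∈ Ioi (0 : ℝ) :=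
    ae_restrict_mem measurableSet_Ioi
  have hμ : ∀ s : ℂ, ∫ t, Complex.exp (-s * (id t : ℝ)) ∂μ =
      ∫ t in Ioi (0 : ℝ), Complex.exp (-s * t) * (fracMono β k t : ℂ) := fun s => by
    rw [integral_withDensity_eq_integral_toReal_smul hmeas htop]
    refine integral_congr_ae ?_
    filter_upwards [hmem] with t ht
    rw [ENNReal.toReal_ofReal (fracMono_nonneg hβ k (le_of_lt ht)), Complex.real_smul, mul_comm]
    rfl
  have hd := differentiableOn_laplace (μ := μ) (X := id) fun x hx => by
    refine (integrable_withDensity_iff_integrable_smul' hmeas htop).2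
      ((integrableOn_exp_mul_fracMono hβ k hx).congr ?_)
    filter_upwards [hmem] with t ht
    rw [ENNReal.toReal_ofReal (fracMono_nonneg hβ k (le_of_lt ht)), smul_eq_mul, mul_comm]
    rfl
  simp only [hμ] at hd
  refine eqOn_right_half_plane (g := fun s => s⁻¹ * ((s ^ (β : ℂ))⁻¹) ^ k) hd (fun s hs => ?_)
    (fun x hx => ?_) hs
  · have h0 := cpow_re_pos hs
    have h1 : s ^ (β : ℂ) ≠ 0 := by simp [Complex.cpow_eq_zero_iff, h0]
    exact (differentiableAt_id.inv h0 |>.mul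
      (((differentiableAt_cpow_const hs _).inv h1).pow k)).differentiableWithinAt
  · have := congrArg Complex.ofReal (integral_exp_mul_fracMono hβ k hx)
    rw [← integral_complex_ofReal] at this
    push_cast [Complex.ofReal_cpow hx.le] at this
    exact this

lemma two_mul_le_of_growthRate_lt (hβ : 0 < β) {R x : ℝ} (hR : 0 ≤ R) (hx : growthRate β R < x) :
    2 * R ≤ x ^ β := by
  have h := Real.rpow_le_rpow (growthRate_nonneg β hR) hx.le hβ.le
  rwa [growthRate, ← Real.rpow_mul (by positivity), one_div_mul_cancel hβ.ne', Real.rpow_one] at h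

/-- The Laplace transform of a fractional power series, to the right of its growth rate. -/
lemma hasLaplaceAt_fracSeries (hβ : 0 < β) {a : ℕ → ℂ} {C R : ℝ} (hR : 0 ≤ R)
    (ha : ∀ k, ‖a k‖ ≤ C * R ^ k) {s : ℂ} (hs : growthRate β R < s.re) :
    Summable (fun k => ((s ^ (β : ℂ))⁻¹) ^ k * a k) ∧
    HasLaplaceAt (fracSeries β a) s (s⁻¹ * ∑' k, ((s ^ (β : ℂ))⁻¹) ^ k * a k) := by
  have hC : 0 ≤ C := by simpa using (norm_nonneg _).trans (ha 0)
  have hs0 : 0 < s.re := (growthRate_nonneg β hR).trans_lt hs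
  have hx := two_mul_le_of_growthRate_lt hβ hR hs
  have hpos : 0 < s.re ^ β := by positivity
  -- To the right of the growth rate 2R ≤ (Re s)^β, so each term loses at least a factor 1/2.
  have hb : ∀ k, ((s.re ^ β)⁻¹) ^ k * ‖a k‖ ≤ C * (1 / 2) ^ k := fun k => by
    calc _ ≤ ((s.re ^ β)⁻¹) ^ k * (C * R ^ k) :=
          mul_le_mul_of_nonneg_left (ha k) (by positivity)
      _ = C * ((s.re ^ β)⁻¹ * R) ^ k := by ring
      _ ≤ _ := by
        refine mul_le_mul_of_nonneg_left (pow_le_pow_left₀ (by positivity) ?_ k) hC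
        rw [inv_mul_le_iff₀ hpos]
        linarith
  let F : ℕ → ℝ → ℂ := fun k t => Complex.exp (-s * t) * ((fracMono β k t : ℂ) * a k)
  have hnorm : ∀ k, ∀ t ∈ Ioi (0 : ℝ), ‖F k t‖ = Real.exp (-s.re * t) * fracMono β k t * ‖a k‖ :=
    fun k t ht => by
      simp only [F]
      rw [norm_mul, norm_mul, norm_exp_neg_mul, Complex.norm_real,
        Real.norm_of_nonneg (fracMono_nonneg hβ k (le_of_lt ht)), mul_assoc]
  have hFi : ∀ k, Integrable (F k) (volume.restrict (Ioi 0)) := fun k => by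
    refine (integrable_norm_iff ?_).1 ?_
    · have := continuous_fracMono hβ k
      exact Continuous.aestronglyMeasurable (by fun_prop)
    · exact IntegrableOn.congr_fun ((integrableOn_exp_mul_fracMono hβ k hs0).mul_const ‖a k‖)
        (fun t ht => (hnorm k t ht).symm) measurableSet_Ioi
  have hFn : ∀ k, ∫ t in Ioi (0 : ℝ), ‖F k t‖ = s.re⁻¹ * (((s.re ^ β)⁻¹) ^ k * ‖a k‖) := fun k => by
    rw [setIntegral_congr_fun measurableSet_Ioi (hnorm k), integral_mul_const,
      integral_exp_mul_fracMono hβ k hs0, mul_assoc]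
  have hsum : Summable fun k => ∫ t in Ioi (0 : ℝ), ‖F k t‖ := by
    simp only [hFn]
    exact ((summable_geometric_two.mul_left C).of_nonneg_of_le
      (fun k => by positivity) hb).mul_left _
  have hFv : ∀ k, ∫ t in Ioi (0 : ℝ), F k t = s⁻¹ * (((s ^ (β : ℂ))⁻¹) ^ k * a k) := fun k => by
    simp only [F, ← mul_assoc]
    rw [integral_mul_const, integral_cexp_mul_fracMono hβ k hs0]
  have hsumF := (hasSum_integral_of_summable_integral_norm hFi hsum)
  have heq : EqOn (fun t => ∑' k, F k t) (fun t : ℝ => Complex.exp (-s * t) * fracSeries β a t)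
      (Ioi 0) := fun t _ => by
    simp only [F, fracSeries, Complex.real_smul]
    rw [tsum_mul_left]
  have hsne := inv_ne_zero (cpow_re_pos hs0)
  have hS : Summable (fun k => ((s ^ (β : ℂ))⁻¹) ^ k * a k) := by
    have := hsumF.summable
    simp only [hFv] at this
    rwa [summable_mul_left_iff hsne] at this
  refine ⟨hS, ?_, ?_⟩
  · exact IntegrableOn.congr_fun (integrable_tsum_of_summable_integral_norm hFi hsum) heq
      measurableSet_Ioi
  · rw [← setIntegral_congr_fun measurableSet_Ioi heq, ← hsumF.tsum_eq]
    simp only [hFv]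
    rw [tsum_mul_left]

lemma HasLaplaceAt.congr {f g : ℝ → ℂ} {s v : ℂ} (h : HasLaplaceAt f s v) (hfg : EqOn g f (Ici 0)) :
    HasLaplaceAt g s v := by
  have e : EqOn (fun t : ℝ => Complex.exp (-s * t) * f t)
      (fun t : ℝ => Complex.exp (-s * t) * g t) (Ioi 0) := fun t ht => by
    simp only
    rw [hfg (Ioi_subset_Ici_self ht)]
  exact ⟨h.1.congr_fun e measurableSet_Ioi, by
    rw [← h.2, setIntegral_congr_fun measurableSet_Ioi e]⟩

lemma HasLaplaceAt.sub {f g : ℝ → ℂ} {s v w : ℂ} (hf : HasLaplaceAt f s v)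
    (hg : HasLaplaceAt g s w) : HasLaplaceAt (fun t => f t - g t) s (v - w) := by
  have e : (fun t : ℝ => Complex.exp (-s * t) * (f t - g t)) = fun t : ℝ =>
      Complex.exp (-s * t) * f t - Complex.exp (-s * t) * g t := by ext t; ring
  rw [HasLaplaceAt, e]
  exact ⟨hf.1.sub hg.1, by rw [integral_sub hf.1 hg.1, hf.2, hg.2]⟩

/-- Uniqueness of Laplace transforms at points of continuity. -/
lemma eq_of_hasLaplaceAt {f g : ℝ → ℂ} {M : ℝ} {v : ℂ → ℂ}
    (hf : ∀ s : ℂ, M < s.re → HasLaplaceAt f s (v s))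
    (hg : ∀ s : ℂ, M < s.re → HasLaplaceAt g s (v s)) {t : ℝ} (ht : 0 < t)
    (hc : ContinuousAt (fun t => f t - g t) t) : f t = g t := by
  have h : ∀ s : ℂ, M < s.re → HasLaplaceAt (fun t => f t - g t) s 0 := fun s hs => by
    simpa using (hf s hs).sub (hg s hs)
  refine sub_eq_zero.1 (eq_zero_of_laplace_eq_zero (h := fun t => f t - g t) (σ := M + 1)
    (h _ (by simp)).1 (fun s hs => (h s (by linarith)).2) ht hc)

end

/-! ### Fractional exponentials of power series -/

/-- The `n`-th coefficient of `E_β(B t^β)` for a power series `B`. -/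
noncomputable def pSeries (β : ℝ) (B : PowerSeries ℝ) (n : ℕ) : ℝ → ℝ :=
  fracSeries β fun k => (B ^ k).coeff n

lemma fracSeries_pow (β : ℝ) (c : ℂ) {t : ℝ} (ht : 0 ≤ t) :
    fracSeries β (fun k => c ^ k) t = mittagLeffler β (c * (t ^ β : ℝ)) := by
  refine tsum_congr fun k => ?_
  rw [fracMono, Complex.real_smul, Real.rpow_mul ht, Real.rpow_natCast, mul_pow]
  push_cast
  ring

lemma ofReal_fracSeries (β : ℝ) (a : ℕ → ℝ) (t : ℝ) :
    ((fracSeries β a t : ℝ) : ℂ) = fracSeries β (fun k => (a k : ℂ)) t := by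
  rw [fracSeries, fracSeries, Complex.ofReal_tsum]
  exact tsum_congr fun k => by rw [Complex.real_smul, smul_eq_mul, Complex.ofReal_mul]

section

variable {β : ℝ} {B : PowerSeries ℝ} {r : ℝ}

lemma L1Bound.coeff_pow_le (hB : L1Bound B r) (n k : ℕ) : ‖(B ^ k).coeff n‖ ≤ 1 * r ^ k := by
  simpa using (hB.pow k).coeff_le n

lemma pSeries_zero_right (hβ : 0 < β) (B : PowerSeries ℝ) (n : ℕ) :
    pSeries β B n 0 = if n = 0 then 1 else 0 := by
  rw [pSeries, fracSeries_zero_right hβ, pow_zero, PowerSeries.coeff_one]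

lemma caputoRegular_pSeries (hβ : 0 < β) (hB : L1Bound B r) (n : ℕ) :
    CaputoRegular (pSeries β B n) :=
  caputoRegular_fracSeries hβ hB.nonneg (hB.coeff_pow_le n)

lemma hasSum_pSeries (hβ : 0 < β) (hB : L1Bound B r) (n : ℕ) {t : ℝ} (ht : 0 ≤ t) :
    HasSum (fun k => fracMono β k t * (B ^ k).coeff n) (pSeries β B n t) :=
  hasSum_fracSeries hβ hB.nonneg (hB.coeff_pow_le n) ht

/-- Since B^{k+1} = B^k B, the shifted coefficient sequence is the convolution with B: the
coefficientwise form of the equation satisfied by E_β(B t^β). -/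
lemma hasCaputoDerivAt_pSeries (hβ : 0 < β) (hβ₁ : β ≤ 1) (hB : L1Bound B r) (n : ℕ) {t : ℝ}
    (ht : 0 < t) :
    HasCaputoDerivAt β (pSeries β B n)
      (∑ m ∈ Finset.range (n + 1), pSeries β B m t * B.coeff (n - m)) t := by
  suffices h : ∑ m ∈ Finset.range (n + 1), pSeries β B m t * B.coeff (n - m) =
      fracSeries β (fun k => (B ^ (k + 1)).coeff n) t by
    rw [h]
    exact hasCaputoDerivAt_fracSeries hβ hβ₁ hB.nonneg (hB.coeff_pow_le n) ht
  refine HasSum.unique ?_ (hasSum_fracSeries hβ hB.nonneg (bound_shift (hB.coeff_pow_le n)) ht.le)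
  have h := hasSum_sum fun (m : ℕ) (_ : m ∈ Finset.range (n + 1)) =>
    (hasSum_pSeries hβ hB m ht.le).mul_right (B.coeff (n - m))
  refine h.congr_fun fun k => ?_
  rw [pow_succ, PowerSeries.coeff_mul, Finset.Nat.sum_antidiagonal_eq_sum_range_succ
    (fun a b => (B ^ k).coeff a * B.coeff b), smul_eq_mul, Finset.mul_sum]
  exact Finset.sum_congr rfl fun m _ => by ring

/-- Interchange of the sums over k and n. The double series is absolutely summable because for |u| ≤
1 the k-th row has total modulus at most r^k times the monomial. -/
lemma hasSum_pSeries_mul_pow (hβ : 0 < β) (hB : L1Bound B r) {t : ℝ} (ht : 0 ≤ t) {u : ℂ}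
    (hu : ‖u‖ ≤ 1) :
    HasSum (fun n : ℕ => (pSeries β B n t : ℂ) * u ^ n)
      (mittagLeffler β (psEval B u * (t ^ β : ℝ))) := by
  rw [← fracSeries_pow β _ ht]
  let F : ℕ × ℕ → ℂ := fun z => (fracMono β z.1 t : ℂ) * (((B ^ z.1).coeff z.2 : ℝ) * u ^ z.2)
  have hrow : ∀ k, HasSum (fun n => F (k, n)) (fracMono β k t • psEval B u ^ k) := fun k => by
    rw [← hB.psEval_pow hu, Complex.real_smul]
    exact ((hB.pow k).hasSum hu).mul_left _
  have hcol : ∀ n, HasSum (fun k => F (k, n)) ((pSeries β B n t : ℂ) * u ^ n) := fun n => by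
    have h := (Complex.hasSum_ofReal.2 (hasSum_pSeries hβ hB n ht)).mul_right (u ^ n)
    refine h.congr_fun fun k => ?_
    simp only [F]
    push_cast
    ring
  have hF : Summable F := by
    refine Summable.of_norm ((summable_prod_of_nonneg fun _ => norm_nonneg _).2 ⟨fun k => ?_, ?_⟩)
    · simp only [F, norm_mul _ (_ * _)]
      exact ((hB.pow k).summable_norm hu).mul_left _
    · have hg := summable_norm_fracMono_smul hβ (a := fun k => r ^ k) hB.nonneg (C := 1)
        (fun k => by rw [one_mul, norm_pow, Real.norm_of_nonneg hB.nonneg]) ht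
      refine hg.of_nonneg_of_le (fun k => tsum_nonneg fun _ => norm_nonneg _) fun k => ?_
      simp only [F, norm_mul _ (_ * _)]
      rw [tsum_mul_left, norm_smul, Complex.norm_real, norm_pow, Real.norm_of_nonneg hB.nonneg]
      refine mul_le_mul_of_nonneg_left ?_ (norm_nonneg _)
      refine (((hB.pow k).summable_norm hu).tsum_le_tsum (fun n => ?_) (hB.pow k).1).trans
        (hB.pow k).2
      rw [norm_mul, norm_pow, Complex.norm_real, Real.norm_eq_abs]
      exact mul_le_of_le_one_right (abs_nonneg _) (pow_le_one₀ (norm_nonneg _) hu)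
  have h1 : HasSum (fun k => fracMono β k t • psEval B u ^ k) (∑' z, F z) :=
    hF.hasSum.prod_fiberwise hrow
  have h2 := ((Equiv.prodComm ℕ ℕ).hasSum_iff.2 hF.hasSum).prod_fiberwise hcol
  rw [fracSeries, h1.tsum_eq]
  exact h2

end

/-! ### The fractional Poisson exponents -/

section

variable {β ξ : ℝ}

/-- The power series `-ξ(1 - A)`. -/
noncomputable def rateSeries (ξ : ℝ) (A : PowerSeries ℝ) : PowerSeries ℝ :=
  PowerSeries.C (-ξ) * (1 - A)

lemma L1Bound.rateSeries {A : PowerSeries ℝ} (hA : L1Bound A 1) (hξ : 0 < ξ) :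
    L1Bound (rateSeries ξ A) (2 * ξ) := by
  have h := (L1Bound.C (-ξ)).mul (L1Bound.one.sub hA)
  rw [abs_neg, abs_of_pos hξ] at h
  rwa [mul_comm 2 ξ, ← one_add_one_eq_two]

lemma L1Bound.psEval_rateSeries {A : PowerSeries ℝ} (hA : L1Bound A 1) (ξ : ℝ) {u : ℂ}
    (hu : ‖u‖ ≤ 1) : psEval (SpaceTimeML.rateSeries ξ A) u = -ξ * (1 - psEval A u) := by
  rw [SpaceTimeML.rateSeries, (L1Bound.C (-ξ)).psEval_mul (L1Bound.one.sub hA) hu,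
    L1Bound.one.psEval_sub hA hu, psEval_C, psEval_one]
  push_cast
  rfl

lemma coeff_pow_eq_zero_of_lt {A : PowerSeries ℝ} (hA : A.coeff 0 = 0) {m n : ℕ} (h : n < m) :
    (A ^ m).coeff n = 0 := by
  have : PowerSeries.X ∣ A := PowerSeries.X_dvd_iff.2 (by simpa using hA)
  exact PowerSeries.X_pow_dvd_iff.1 (pow_dvd_pow_of_dvd this m) n h

/-- (-ξ(1-A))^k is a polynomial in A whose coefficients are found by putting A = X, and A^m begins
at order m, so only m ≤ n contribute. -/
lemma coeff_rateSeries_pow {A : PowerSeries ℝ} (hA : A.coeff 0 = 0) (ξ : ℝ) (k n : ℕ) :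
    (rateSeries ξ A ^ k).coeff n =
      ∑ m ∈ Finset.range (n + 1), (rateSeries ξ PowerSeries.X ^ k).coeff m * (A ^ m).coeff n := by
  let p : Polynomial ℝ := (Polynomial.C (-ξ) * (1 - Polynomial.X)) ^ k
  have hp : ((p : Polynomial ℝ) : PowerSeries ℝ) = rateSeries ξ PowerSeries.X ^ k := by
    simp [p, rateSeries]
  have hq : Polynomial.aeval A p = rateSeries ξ A ^ k := by
    simp [p, rateSeries]
  rw [← hq, ← hp, Polynomial.aeval_eq_sum_range' (n := p.natDegree + n + 1) (by omega), map_sum]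
  simp only [Polynomial.coeff_coe, PowerSeries.coeff_smul]
  symm
  refine Finset.sum_subset (Finset.range_mono (by omega)) fun m _ hm => ?_
  rw [coeff_pow_eq_zero_of_lt hA (by simpa using hm), mul_zero]

/-- The Cox series as a finite sum. -/
lemma pSeries_rateSeries_eq_sum (hβ : 0 < β) (hξ : 0 < ξ) {A : PowerSeries ℝ} (hA : L1Bound A 1)
    (hA0 : A.coeff 0 = 0) (n : ℕ) {t : ℝ} (ht : 0 ≤ t) :
    pSeries β (rateSeries ξ A) n t =
      ∑ m ∈ Finset.range (n + 1), pSeries β (rateSeries ξ PowerSeries.X) m t * (A ^ m).coeff n := by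
  refine (hasSum_pSeries hβ (hA.rateSeries hξ) n ht).unique ?_
  have h := hasSum_sum fun (m : ℕ) (_ : m ∈ Finset.range (n + 1)) =>
    (hasSum_pSeries hβ (L1Bound.X.rateSeries hξ) m ht).mul_right ((A ^ m).coeff n)
  refine h.congr_fun fun k => ?_
  rw [coeff_rateSeries_pow hA0, Finset.mul_sum]
  exact Finset.sum_congr rfl fun m _ => by ring

lemma hasSum_pSeries_cox (hβ : 0 < β) (hξ : 0 < ξ) {A : PowerSeries ℝ} (hA : L1Bound A 1)
    (hA0 : A.coeff 0 = 0) (n : ℕ) {t : ℝ} (ht : 0 ≤ t) :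
    HasSum (fun m => pSeries β (rateSeries ξ PowerSeries.X) m t * (A ^ m).coeff n)
      (pSeries β (rateSeries ξ A) n t) := by
  rw [pSeries_rateSeries_eq_sum hβ hξ hA hA0 n ht]
  refine hasSum_sum_of_ne_finset_zero fun m hm => ?_
  rw [coeff_pow_eq_zero_of_lt hA0 (by simpa using hm), mul_zero]

lemma coeff_rateSeries_X_pow_succ (ξ : ℝ) (k j : ℕ) :
    (rateSeries ξ PowerSeries.X ^ (k + 1)).coeff j =
      -ξ * (rateSeries ξ PowerSeries.X ^ k).coeff j +
        ξ * if j = 0 then 0 else (rateSeries ξ PowerSeries.X ^ k).coeff (j - 1) := by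
  have e : rateSeries ξ PowerSeries.X ^ (k + 1) =
      PowerSeries.C (-ξ) * rateSeries ξ PowerSeries.X ^ k +
        PowerSeries.C ξ * (rateSeries ξ PowerSeries.X ^ k * PowerSeries.X) := by
    rw [pow_succ]
    nth_rewrite 2 [rateSeries]
    rw [map_neg]
    ring
  rw [e, map_add, PowerSeries.coeff_C_mul, PowerSeries.coeff_C_mul]
  cases j with
  | zero => simp
  | succ j => rw [PowerSeries.coeff_succ_mul_X]; simp

/-- The Laplace transform of the counting probabilities. -/
lemma hasLaplaceAt_pSeries_X (hβ : 0 < β) (hβ₁ : β ≤ 1) (hξ : 0 < ξ) (j : ℕ) {s χ : ℂ}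
    (hs : growthRate β (2 * ξ) < s.re) (hχ : χ = ξ / (ξ + s ^ (β : ℂ))) :
    HasLaplaceAt (fun t => (pSeries β (rateSeries ξ PowerSeries.X) j t : ℂ)) s
      (s⁻¹ * ((1 - χ) * χ ^ j)) := by
  have hb := L1Bound.X.rateSeries hξ
  have hs0 : 0 < s.re := (growthRate_nonneg β hb.nonneg).trans_lt hs
  have hsβ : s ^ (β : ℂ) ≠ 0 := by simp [Complex.cpow_eq_zero_iff, cpow_re_pos hs0]
  have hne := add_cpow_ne_zero hβ hβ₁ hξ hs0.le
  have hL := fun j => hasLaplaceAt_fracSeries hβ hb.nonneg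
    (a := fun k => ((rateSeries ξ PowerSeries.X ^ k).coeff j : ℂ)) (C := 1)
    (fun k => by simpa using hb.coeff_pow_le j k) hs
  set x := (s ^ (β : ℂ))⁻¹ with hx
  set S : ℕ → ℂ := fun j => ∑' k, x ^ k * ((rateSeries ξ PowerSeries.X ^ k).coeff j : ℂ) with hS
  -- The Pascal-type rule for the coefficients of (-ξ(1-X))^{k+1}, summed against x^{k+1}, gives a
  -- first-order recursion in j. Its solution is geometric with ratio ξx/(1+ξx) = χ.
  have hrec : ∀ j, S j * (1 + ξ * x) =
      (if j = 0 then 1 else 0) + ξ * x * if j = 0 then 0 else S (j - 1) := fun j => by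
    have h0 : S j = _ := (hL j).1.tsum_eq_zero_add
    have e : ∀ k : ℕ, x ^ (k + 1) * ((rateSeries ξ PowerSeries.X ^ (k + 1)).coeff j : ℂ) =
        -ξ * x * (x ^ k * ((rateSeries ξ PowerSeries.X ^ k).coeff j : ℂ)) + ξ * x *
          (if j = 0 then 0 else x ^ k * ((rateSeries ξ PowerSeries.X ^ k).coeff (j - 1) : ℂ)) :=
      fun k => by
        rw [coeff_rateSeries_X_pow_succ]
        split_ifs <;> push_cast <;> ring
    have hsum2 : Summable fun k : ℕ => if j = 0 then (0 : ℂ) else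
        x ^ k * ((rateSeries ξ PowerSeries.X ^ k).coeff (j - 1) : ℂ) := by
      split_ifs
      · exact summable_zero
      · exact (hL (j - 1)).1
    have hsum2' : ∑' k : ℕ, (if j = 0 then (0 : ℂ) else
        x ^ k * ((rateSeries ξ PowerSeries.X ^ k).coeff (j - 1) : ℂ)) =
          if j = 0 then 0 else S (j - 1) := by
      split_ifs <;> simp [hS]
    simp only [e] at h0
    rw [((hL j).1.mul_left _).tsum_add (hsum2.mul_left _), tsum_mul_left, tsum_mul_left, hsum2',
      pow_zero, pow_zero, PowerSeries.coeff_one] at h0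
    change S j = _ + (-ξ * x * S j + _) at h0
    have e1 : (((if j = 0 then 1 else 0 : ℝ)) : ℂ) = if j = 0 then 1 else 0 := by
      split_ifs <;> simp
    rw [e1, one_mul] at h0
    linear_combination h0
  have h1x : 1 + ξ * x ≠ 0 := by
    rw [hx]
    intro h
    apply hne
    field_simp at h
    linear_combination h
  have hd : 1 + ξ * x = (ξ + s ^ (β : ℂ)) * x := by
    rw [add_mul, hx, mul_inv_cancel₀ hsβ, add_comm]
  have hχ1 : 1 - χ = (1 + ξ * x)⁻¹ := by
    rw [hχ, hd, hx, mul_inv, inv_inv]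
    field_simp
    ring
  have hχ2 : χ = ξ * x * (1 + ξ * x)⁻¹ := by
    rw [hχ, hd, hx, mul_inv, inv_inv]
    field_simp
  have hSj : S j = (1 - χ) * χ ^ j := by
    induction j with
    | zero =>
      have := hrec 0
      simp only [if_true, mul_zero, add_zero] at this
      rw [pow_zero, mul_one, hχ1, eq_inv_of_mul_eq_one_left this]
    | succ j ih =>
      have := hrec (j + 1)
      simp only [Nat.succ_ne_zero, if_false, zero_add, Nat.add_sub_cancel, ih] at this
      rw [pow_succ, ← mul_assoc]
      nth_rewrite 3 [hχ2]
      rw [← mul_assoc, eq_mul_inv_iff_mul_eq₀ h1x, this]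
      ring
  rw [← hSj]
  have e : (fun t => (pSeries β (rateSeries ξ PowerSeries.X) j t : ℂ)) =
      fracSeries β fun k => ((rateSeries ξ PowerSeries.X ^ k).coeff j : ℂ) :=
    funext fun t => ofReal_fracSeries _ _ _
  rw [e]
  exact (hL j).2

end

/-! ### Survival functions and Laplace transforms -/

section

variable {Ω : Type*} [MeasurableSpace Ω] {P : Measure Ω} [IsProbabilityMeasure P] {Y : Ω → ℝ}

lemma norm_exp_neg_mul_le_one {s : ℂ} (hs : 0 ≤ s.re) {y : ℝ} (hy : 0 ≤ y) :
    ‖Complex.exp (-s * y)‖ ≤ 1 := by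
  rw [norm_exp_neg_mul]
  exact Real.exp_le_one_iff.2 (by nlinarith [mul_nonneg hs hy])

lemma integrable_exp_neg_mul (hY : Measurable Y) (hY0 : ∀ᵐ ω ∂P, 0 ≤ Y ω) {x : ℝ} (hx : 0 ≤ x) :
    Integrable (fun ω => Real.exp (-x * Y ω)) P := by
  refine Integrable.of_bound (by fun_prop) 1 ?_
  filter_upwards [hY0] with ω hω
  rw [Real.norm_of_nonneg (Real.exp_pos _).le]
  exact Real.exp_le_one_iff.2 (by nlinarith [mul_nonneg hx hω])

lemma integrable_cexp_neg_mul (hY : Measurable Y) (hY0 : ∀ᵐ ω ∂P, 0 ≤ Y ω) {s : ℂ}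
    (hs : 0 ≤ s.re) : Integrable (fun ω => Complex.exp (-s * Y ω)) P := by
  refine Integrable.of_bound (Measurable.aestronglyMeasurable (by fun_prop)) 1 ?_
  filter_upwards [hY0] with ω hω using norm_exp_neg_mul_le_one hs hω

lemma integral_cexp_eq_of_real {β ξ : ℝ} (hβ : 0 < β) (hβ₁ : β ≤ 1) (hξ : 0 < ξ)
    (hY : Measurable Y) (hY0 : ∀ᵐ ω ∂P, 0 ≤ Y ω)
    (h : ∀ s : ℝ, 0 < s → ∫ ω, Real.exp (-s * Y ω) ∂P = ξ / (ξ + s ^ β)) {s : ℂ}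
    (hs : 0 < s.re) : ∫ ω, Complex.exp (-s * Y ω) ∂P = ξ / (ξ + s ^ (β : ℂ)) := by
  refine eqOn_right_half_plane (g := fun s : ℂ => ξ / (ξ + s ^ (β : ℂ)))
    (differentiableOn_laplace fun x hx => integrable_exp_neg_mul hY hY0 hx.le)
    (fun s hs => ?_) (fun x hx => ?_) hs
  · exact ((differentiableAt_const _).div ((differentiableAt_const _).add
      (differentiableAt_cpow_const hs _))
      (add_cpow_ne_zero hβ hβ₁ hξ (le_of_lt hs))).differentiableWithinAt
  · have := congrArg Complex.ofReal (h x hx)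
    rw [← integral_complex_ofReal] at this
    push_cast [Complex.ofReal_cpow hx.le] at this
    exact this

/-- The Laplace transform of a survival function. -/
lemma hasLaplaceAt_survival (hY : Measurable Y) (hY0 : ∀ᵐ ω ∂P, 0 ≤ Y ω) {s : ℂ}
    (hs : 0 < s.re) : HasLaplaceAt (fun t => (P.real {ω | t < Y ω} : ℂ)) s
      (s⁻¹ * (1 - ∫ ω, Complex.exp (-s * Y ω) ∂P)) := by
  -- Integrated over ω this gives the Laplace integrand of the survival function, and over t it
  -- gives (1-e^{-sY})/s; Fubini equates the two.
  let G : ℝ → Ω → ℂ := fun t ω => if t < Y ω then Complex.exp (-s * t) else 0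
  have hset : MeasurableSet {z : ℝ × Ω | z.1 < Y z.2} :=
    measurableSet_lt measurable_fst (hY.comp measurable_snd)
  have hm : Measurable (Function.uncurry G) := Measurable.ite hset (by fun_prop) measurable_const
  have hexp : IntegrableOn (fun t : ℝ => Real.exp (-s.re * t)) (Ioi 0) :=
    integrableOn_exp_mul_Ioi (by linarith) 0
  have hGi : Integrable (Function.uncurry G) ((volume.restrict (Ioi (0 : ℝ))).prod P) := by
    refine (hexp.comp_fst P).mono' hm.aestronglyMeasurable (Eventually.of_forall fun z => ?_)
    simp only [Function.uncurry, G]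
    split_ifs
    · rw [norm_exp_neg_mul]
    · rw [norm_zero]; positivity
  have hinner : ∀ t, ∫ ω, G t ω ∂P = Complex.exp (-s * t) * (P.real {ω | t < Y ω} : ℂ) :=
    fun t => by
    have hS : MeasurableSet {ω | t < Y ω} := measurableSet_lt measurable_const hY
    have e : G t = {ω | t < Y ω}.indicator fun _ => Complex.exp (-s * t) := by
      ext ω; simp [G, indicator]
    rw [e, integral_indicator_const _ hS, Complex.real_smul, mul_comm]
  have houter : ∀ᵐ ω ∂P, ∫ t in Ioi (0 : ℝ), G t ω = s⁻¹ * (1 - Complex.exp (-s * Y ω)) := by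
    filter_upwards [hY0] with ω hω
    have e : (fun t => G t ω) = (Iio (Y ω)).indicator fun t : ℝ => Complex.exp (-s * t) := by
      ext t; simp [G, indicator]
    rw [e, setIntegral_indicator measurableSet_Iio, Ioi_inter_Iio, restrict_Ioo_eq_restrict_Ioc,
      ← intervalIntegral.integral_of_le hω,
      integral_exp_mul_complex (neg_ne_zero.2 (cpow_re_pos hs))]
    have := cpow_re_pos hs
    simp only [Complex.ofReal_zero, mul_zero, Complex.exp_zero]
    field_simp
    ring
  have h1 := hGi.integral_prod_left
  simp only [Function.uncurry, hinner] at h1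
  refine ⟨h1, ?_⟩
  have h2 := integral_integral_swap hGi
  simp only [hinner] at h2
  rw [h2, integral_congr_ae houter, integral_const_mul, integral_sub (integrable_const _)
    (integrable_cexp_neg_mul hY hY0 hs.le)]
  simp

lemma survival_eq (hY : Measurable Y) (t : ℝ) :
    P.real {ω | t < Y ω} = 1 - cdf (P.map Y) t := by
  have : IsProbabilityMeasure (P.map Y) := Measure.isProbabilityMeasure_map hY.aemeasurable
  rw [cdf_eq_real, map_measureReal_apply hY measurableSet_Iic,
    ← probReal_compl_eq_one_sub (hY measurableSet_Iic)]
  congr 1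
  ext ω
  simp

/-- A survival function is determined by its Laplace transform on a half plane. -/
lemma survival_eq_of_hasLaplaceAt (hY : Measurable Y) (hY0 : ∀ᵐ ω ∂P, 0 ≤ Y ω) {R : ℝ → ℝ}
    (hR : ContinuousOn R (Ici 0)) {M : ℝ} (hM : 0 ≤ M)
    (hL : ∀ s : ℂ, M < s.re → HasLaplaceAt (fun t => (R t : ℂ)) s
      (s⁻¹ * (1 - ∫ ω, Complex.exp (-s * Y ω) ∂P))) {t : ℝ} (ht : 0 ≤ t) :
    P.real {ω | t < Y ω} = R t := by
  have hmono : Monotone (cdf (P.map Y)) := monotone_cdf _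
  have hpt : ∀ r, 0 < r → ContinuousAt (cdf (P.map Y)) r → P.real {ω | r < Y ω} = R r := by
    intro r hr hc
    have hc' : ContinuousAt (fun t => (P.real {ω | t < Y ω} : ℂ) - (R t : ℂ)) r := by
      simp only [survival_eq hY]
      have hRr : ContinuousAt R r := (hR.continuousAt (Ici_mem_nhds hr))
      exact (Complex.continuous_ofReal.continuousAt.comp (continuousAt_const.sub hc)).sub
        (Complex.continuous_ofReal.continuousAt.comp hRr)
    have := eq_of_hasLaplaceAt (M := M) (fun s hs => hasLaplaceAt_survival hY hY0 (hM.trans_lt hs))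
      hL hr hc'
    exact_mod_cast this
  -- A monotone function has only countably many discontinuities, so points of equality accumulate
  -- at t from the right, and right continuity of the distribution function concludes, at t = 0 too.
  have hfreq : ∃ᶠ r in 𝓝[>] t, P.real {ω | r < Y ω} - R r = 0 := by
    have hd := hmono.countable_not_continuousAt.dense_compl ℝ
    rw [frequently_iff]
    intro U hU
    obtain ⟨b, hb, hbU⟩ := (mem_nhdsGT_iff_exists_Ioo_subset).1 hU
    obtain ⟨r, hr, hr1⟩ := hd.exists_between (mem_Ioi.1 hb)
    refine ⟨r, hbU hr1, sub_eq_zero.2 (hpt r (ht.trans_lt hr1.1) ?_)⟩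
    simpa using hr
  have htend : Tendsto (fun r => P.real {ω | r < Y ω} - R r) (𝓝[>] t)
      (𝓝 (P.real {ω | t < Y ω} - R t)) := by
    simp only [survival_eq hY]
    refine Tendsto.sub (Tendsto.sub tendsto_const_nhds ?_) ?_
    · exact ((cdf (P.map Y)).right_continuous t).mono_left (nhdsWithin_mono _ Ioi_subset_Ici_self)
    · exact (hR t ht).mono_left (nhdsWithin_mono _ (Ioi_subset_Ici_self.trans
        (Ici_subset_Ici.2 ht)))
  have hclosed : IsClosed ({0} : Set ℝ) := isClosed_singleton
  have := hclosed.mem_of_frequently_of_tendsto (hfreq.mono fun r hr => by simpa using hr) htend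
  exact sub_eq_zero.1 (by simpa using this)

end

/-! ### Waiting times and arrivals -/

section

variable {Ω : Type*} [MeasurableSpace Ω] {P : Measure Ω} [IsProbabilityMeasure P]
  {α β ξ lam : ℝ} {T : ℕ → Ω → ℝ} {Z : ℕ → Ω → ℕ}

/-- The counting probabilities of the fractional Poisson process. -/
noncomputable def poissonProb (β ξ : ℝ) (m : ℕ) : ℝ → ℝ :=
  pSeries β (rateSeries ξ PowerSeries.X) m

lemma sum_geom_laplace (χ : ℂ) (m : ℕ) :
    ∑ j ∈ Finset.range m, (1 - χ) * χ ^ j = 1 - χ ^ m := by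
  rw [← Finset.mul_sum, mul_comm, geom_sum_mul_neg]

/-- The transform (1-χ^m)/s is a finite geometric sum of the transforms (1-χ)χ^j/s of the counting
probabilities. Agreement for large Re s suffices for uniqueness. -/
lemma survival_eq_sum_poissonProb {Y : Ω → ℝ} (hβ : 0 < β) (hβ₁ : β ≤ 1) (hξ : 0 < ξ)
    (hY : Measurable Y) (hY0 : ∀ᵐ ω ∂P, 0 ≤ Y ω) (m : ℕ)
    (h : ∀ s : ℂ, 0 < s.re → ∫ ω, Complex.exp (-s * Y ω) ∂P = (ξ / (ξ + s ^ (β : ℂ))) ^ m)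
    {t : ℝ} (ht : 0 ≤ t) :
    P.real {ω | t < Y ω} = ∑ j ∈ Finset.range m, poissonProb β ξ j t := by
  have hb := L1Bound.X.rateSeries hξ
  have hM := growthRate_nonneg β hb.nonneg
  refine survival_eq_of_hasLaplaceAt hY hY0 (R := fun t => ∑ j ∈ Finset.range m,
    poissonProb β ξ j t) (continuousOn_finsetSum _ fun j _ =>
      (caputoRegular_pSeries hβ hb j).continuousOn) hM (fun s hs => ?_) ht
  rw [h s (hM.trans_lt hs), ← sum_geom_laplace, Finset.mul_sum]
  have hj : ∀ j, HasLaplaceAt (fun t => (poissonProb β ξ j t : ℂ)) s _ := fun j =>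
    hasLaplaceAt_pSeries_X hβ hβ₁ hξ j hs rfl
  have e : (fun t : ℝ => Complex.exp (-s * t) *
      ((∑ j ∈ Finset.range m, poissonProb β ξ j t : ℝ) : ℂ)) = fun t : ℝ =>
      ∑ j ∈ Finset.range m, Complex.exp (-s * t) * (poissonProb β ξ j t : ℂ) := by
    ext t
    push_cast
    rw [Finset.mul_sum]
  rw [HasLaplaceAt, e]
  refine ⟨integrable_finsetSum _ fun j _ => (hj j).1, ?_⟩
  rw [integral_finsetSum _ fun j _ => (hj j).1]
  exact Finset.sum_congr rfl fun j _ => (hj j).2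

lemma measurable_arrival (hT : ∀ k, Measurable (T k)) (m : ℕ) : Measurable (arrival T m) :=
  Finset.measurable_sum _ fun k _ => hT k

namespace IsMontrollWeiss

variable (h : IsMontrollWeiss P α β ξ lam T Z)
include h

lemma wait_claplace (hβ : 0 < β) (hβ₁ : β ≤ 1) (hξ : 0 < ξ) (k : ℕ) {s : ℂ} (hs : 0 < s.re) :
    ∫ ω, Complex.exp (-s * T k ω) ∂P = ξ / (ξ + s ^ (β : ℂ)) :=
  integral_cexp_eq_of_real hβ hβ₁ hξ (h.measurable_wait k) (h.wait_nonneg k) (h.wait_laplace k) hs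

omit [IsProbabilityMeasure P] in
lemma ae_wait_nonneg : ∀ᵐ ω ∂P, ∀ k, 0 ≤ T k ω := ae_all_iff.2 h.wait_nonneg

omit [IsProbabilityMeasure P] in
lemma ae_arrival_mono : ∀ᵐ ω ∂P, Monotone fun m => arrival T m ω := by
  filter_upwards [h.ae_wait_nonneg] with ω hω
  refine monotone_nat_of_le_succ fun m => ?_
  rw [arrival, arrival, Finset.sum_range_succ]
  linarith [hω m]

omit [IsProbabilityMeasure P] in
lemma ae_arrival_nonneg (m : ℕ) : ∀ᵐ ω ∂P, 0 ≤ arrival T m ω := by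
  filter_upwards [h.ae_wait_nonneg] with ω hω
  exact Finset.sum_nonneg fun k _ => hω k

lemma arrival_claplace (hβ : 0 < β) (hβ₁ : β ≤ 1) (hξ : 0 < ξ) (m : ℕ) {s : ℂ} (hs : 0 < s.re) :
    ∫ ω, Complex.exp (-s * arrival T m ω) ∂P = (ξ / (ξ + s ^ (β : ℂ))) ^ m := by
  induction m with
  | zero => simp [arrival]
  | succ m ih =>
    have hind : IndepFun (arrival T m) (T m) P := by
      have := h.indep_wait.indepFun_sum_range_succ h.measurable_wait m
      convert this using 1
      ext ω
      simp [arrival]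
    have hexp : Measurable fun x : ℝ => Complex.exp (-s * x) := by fun_prop
    have hind2 := hind.comp hexp hexp
    have hmul := hind2.integral_fun_mul_eq_mul_integral
      (hexp.comp (measurable_arrival h.measurable_wait m)).aestronglyMeasurable
      (hexp.comp (h.measurable_wait m)).aestronglyMeasurable
    simp only [Function.comp] at hmul
    rw [pow_succ, ← ih, ← h.wait_claplace hβ hβ₁ hξ m hs, ← hmul]
    refine integral_congr_ae (Eventually.of_forall fun ω => ?_)
    simp only [arrival, Finset.sum_range_succ]
    rw [← Complex.exp_add]
    push_cast
    ring_nf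

lemma survival_arrival (hβ : 0 < β) (hβ₁ : β ≤ 1) (hξ : 0 < ξ) (m : ℕ) {t : ℝ} (ht : 0 ≤ t) :
    P.real {ω | t < arrival T m ω} = ∑ j ∈ Finset.range m, poissonProb β ξ j t :=
  survival_eq_sum_poissonProb hβ hβ₁ hξ (measurable_arrival h.measurable_wait m)
    (h.ae_arrival_nonneg m) m (fun _ hs => h.arrival_claplace hβ hβ₁ hξ m hs) ht

lemma survival_wait (hβ : 0 < β) (hβ₁ : β ≤ 1) (hξ : 0 < ξ) (k : ℕ) {t : ℝ} (ht : 0 ≤ t) :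
    P.real {ω | t < T k ω} = poissonProb β ξ 0 t := by
  rw [survival_eq_sum_poissonProb hβ hβ₁ hξ (h.measurable_wait k) (h.wait_nonneg k) 1
    (fun s hs => by rw [pow_one]; exact h.wait_claplace hβ hβ₁ hξ k hs) ht]
  simp

omit h [IsProbabilityMeasure P] in
lemma hasSum_poissonProb (hβ : 0 < β) (hξ : 0 < ξ) {t : ℝ} (ht : 0 ≤ t) :
    HasSum (fun m => poissonProb β ξ m t) 1 := by
  have hX := L1Bound.X
  have h := hasSum_pSeries_mul_pow hβ (hX.rateSeries hξ) ht (u := 1) (by simp)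
  rw [hX.psEval_rateSeries ξ (by simp), psEval_X, sub_self, mul_zero, zero_mul] at h
  have e : mittagLeffler β 0 = 1 := by
    rw [mittagLeffler, tsum_eq_single 0 fun k hk => by simp [hk]]
    simp
  rw [e] at h
  simp only [one_pow, mul_one] at h
  rw [← Complex.hasSum_ofReal, Complex.ofReal_one]
  exact h

/-- Non-explosion: the event that no arrival exceeds t has probability at most 1 - Σ_{j<m} π_j(t)
for every m, and the π_j(t) sum to 1. -/
lemma ae_exists_arrival_gt (hβ : 0 < β) (hβ₁ : β ≤ 1) (hξ : 0 < ξ) {t : ℝ} (ht : 0 ≤ t) :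
    ∀ᵐ ω ∂P, ∃ m, t < arrival T m ω := by
  have hle : ∀ m, P.real {ω | ∀ m, arrival T m ω ≤ t} ≤
      1 - ∑ j ∈ Finset.range m, poissonProb β ξ j t := fun m => by
    rw [← h.survival_arrival hβ hβ₁ hξ m ht, ← probReal_compl_eq_one_sub
      (measurableSet_lt measurable_const (measurable_arrival h.measurable_wait m))]
    refine measureReal_mono fun ω hω => ?_
    simpa using hω m
  have h0 : P.real {ω | ∀ m, arrival T m ω ≤ t} = 0 := by
    refine le_antisymm ?_ measureReal_nonneg
    have := (hasSum_poissonProb hβ hξ ht).tendsto_sum_nat.const_sub 1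
    rw [sub_self] at this
    exact ge_of_tendsto' this hle
  rw [measureReal_eq_zero_iff] at h0
  rw [ae_iff]
  simpa using h0

/-- `ncard` is 0 on infinite sets, so counting is meaningful only once non-explosion and monotone
arrivals make the set of arrival indices an initial segment of ℕ. -/
lemma ae_counting_eq_iff (hβ : 0 < β) (hβ₁ : β ≤ 1) (hξ : 0 < ξ) {t : ℝ} (ht : 0 ≤ t) :
    ∀ᵐ ω ∂P, ∀ m, counting T t ω = m ↔ arrival T m ω ≤ t ∧ t < arrival T (m + 1) ω := by
  filter_upwards [h.ae_exists_arrival_gt hβ hβ₁ hξ ht, h.ae_arrival_mono] with ω hex hmono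
  have key : ∀ m, arrival T m ω ≤ t ∧ t < arrival T (m + 1) ω → counting T t ω = m := by
    rintro m ⟨h1, h2⟩
    have e : {k : ℕ | arrival T (k + 1) ω ≤ t} = (Finset.range m : Set ℕ) := by
      ext k
      simp only [mem_ofPred_eq, Finset.coe_range, mem_Iio]
      constructor
      · intro hk
        by_contra hlt
        have : arrival T (m + 1) ω ≤ arrival T (k + 1) ω := hmono (by omega)
        linarith
      · intro hk
        exact (hmono (by omega : k + 1 ≤ m)).trans h1
    rw [counting, e, ncard_coe_finset, Finset.card_range]
  refine fun m => ⟨?_, key m⟩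
  rintro rfl
  classical
  -- The first arrival index beyond t is not 0, since the empty sum is 0 ≤ t; its predecessor is the
  -- count.
  obtain ⟨N, hN⟩ : ∃ N, Nat.find hex = N + 1 := Nat.exists_eq_succ_of_ne_zero fun h0 => by
    have := Nat.find_spec hex
    rw [h0] at this
    simp only [arrival, Finset.range_zero, Finset.sum_empty] at this
    linarith
  have hprop : arrival T N ω ≤ t ∧ t < arrival T (N + 1) ω :=
    ⟨not_lt.1 (Nat.find_min hex (by omega)), by rw [← hN]; exact Nat.find_spec hex⟩
  rw [key N hprop]
  exact hprop

lemma counting_ae_eq (hβ : 0 < β) (hβ₁ : β ≤ 1) (hξ : 0 < ξ) {t : ℝ} (ht : 0 ≤ t) (m : ℕ) :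
    ({ω | counting T t ω = m} : Set Ω) =ᵐ[P]
      {ω | arrival T m ω ≤ t ∧ t < arrival T (m + 1) ω} := by
  filter_upwards [h.ae_counting_eq_iff hβ hβ₁ hξ ht] with ω hω
  exact propext (hω m)

omit h [IsProbabilityMeasure P] in
lemma measurableSet_arrival_interval (hT : ∀ k, Measurable (T k)) (t : ℝ) (m : ℕ) :
    MeasurableSet {ω | arrival T m ω ≤ t ∧ t < arrival T (m + 1) ω} :=
  (measurableSet_le (measurable_arrival hT m) measurable_const).inter
    (measurableSet_lt measurable_const (measurable_arrival hT (m + 1)))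

lemma prob_arrival_interval (hβ : 0 < β) (hβ₁ : β ≤ 1) (hξ : 0 < ξ) {t : ℝ} (ht : 0 ≤ t) (m : ℕ) :
    P.real {ω | arrival T m ω ≤ t ∧ t < arrival T (m + 1) ω} = poissonProb β ξ m t := by
  have h1 := h.survival_arrival hβ hβ₁ hξ m ht
  have h2 := h.survival_arrival hβ hβ₁ hξ (m + 1) ht
  rw [Finset.sum_range_succ, ← h1] at h2
  have h3 := measureReal_inter_add_sdiff (μ := P) (s := {ω | t < arrival T (m + 1) ω})
    (measurableSet_lt measurable_const (measurable_arrival h.measurable_wait m) :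
      MeasurableSet {ω | t < arrival T m ω})
  have h4 : P.real ({ω | t < arrival T (m + 1) ω} ∩ {ω | t < arrival T m ω}) =
      P.real {ω | t < arrival T m ω} := by
    refine measureReal_congr ?_
    filter_upwards [h.ae_arrival_mono] with ω hω
    refine propext ⟨fun hh => hh.2, fun hh => ⟨?_, hh⟩⟩
    exact lt_of_lt_of_le hh (hω (Nat.le_succ m))
  have h5 : {ω | t < arrival T (m + 1) ω} \ {ω | t < arrival T m ω} =
      {ω | arrival T m ω ≤ t ∧ t < arrival T (m + 1) ω} := by
    ext ω
    simp [and_comm]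
  rw [h4, h5] at h3
  linarith

lemma prob_counting (hβ : 0 < β) (hβ₁ : β ≤ 1) (hξ : 0 < ξ) {t : ℝ} (ht : 0 ≤ t) (m : ℕ) :
    P.real {ω | counting T t ω = m} = poissonProb β ξ m t := by
  rw [measureReal_congr (h.counting_ae_eq hβ hβ₁ hξ ht m), h.prob_arrival_interval hβ hβ₁ hξ ht]

lemma poissonProb_nonneg (hβ : 0 < β) (hβ₁ : β ≤ 1) (hξ : 0 < ξ) {t : ℝ} (ht : 0 ≤ t) (m : ℕ) :
    0 ≤ poissonProb β ξ m t := by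
  rw [← h.prob_counting hβ hβ₁ hξ ht]
  exact measureReal_nonneg

/-- As the difference of two survival functions, the counting probability has its transform on all
of Re s > 0, not only beyond the growth rate of its defining series. -/
lemma hasLaplaceAt_poissonProb (hβ : 0 < β) (hβ₁ : β ≤ 1) (hξ : 0 < ξ) (m : ℕ) {s χ : ℂ}
    (hs : 0 < s.re) (hχ : χ = ξ / (ξ + s ^ (β : ℂ))) :
    HasLaplaceAt (fun t => (poissonProb β ξ m t : ℂ)) s (s⁻¹ * ((1 - χ) * χ ^ m)) := by
  have hL := fun m => hasLaplaceAt_survival (measurable_arrival h.measurable_wait m)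
    (h.ae_arrival_nonneg m) hs
  have h1 := (hL (m + 1)).sub (hL m)
  rw [h.arrival_claplace hβ hβ₁ hξ m hs, h.arrival_claplace hβ hβ₁ hξ (m + 1) hs, ← hχ] at h1
  have e : s⁻¹ * ((1 - χ) * χ ^ m) = s⁻¹ * (1 - χ ^ (m + 1)) - s⁻¹ * (1 - χ ^ m) := by ring
  rw [e]
  refine h1.congr fun t ht => ?_
  simp only
  rw [h.survival_arrival hβ hβ₁ hξ (m + 1) ht, h.survival_arrival hβ hβ₁ hξ m ht,
    Finset.sum_range_succ]
  push_cast
  ring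

/-! ### Jumps and positions -/

lemma prob_jump_sum (hα₀ : 0 < α) (hα₁ : α ≤ 1) (hlam : 0 < lam) (m n : ℕ) :
    P.real {ω | ∑ j ∈ Finset.range m, Z j ω = n} = (mlSeries α lam ^ m).coeff n := by
  induction m generalizing n with
  | zero =>
    rcases eq_or_ne n 0 with rfl | hn
    · simp
    · simp [PowerSeries.coeff_one, hn, hn.symm]
  | succ m ih =>
    have hS : Measurable fun ω => ∑ j ∈ Finset.range m, Z j ω :=
      Finset.measurable_sum _ fun k _ => h.measurable_jump k
    have hind : IndepFun (fun ω => ∑ j ∈ Finset.range m, Z j ω) (Z m) P := by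
      have := h.indep_jump.indepFun_sum_range_succ h.measurable_jump m
      convert this using 1
      ext ω
      simp
    have e : {ω | ∑ j ∈ Finset.range (m + 1), Z j ω = n} =
        ⋃ kl ∈ Finset.HasAntidiagonal.antidiagonal n,
          ({ω | ∑ j ∈ Finset.range m, Z j ω = kl.1} ∩ {ω | Z m ω = kl.2}) := by
      ext ω
      simp only [Finset.sum_range_succ, mem_ofPred_eq, mem_iUnion, mem_inter_iff, exists_prop,
        Finset.HasAntidiagonal.mem_antidiagonal]
      constructor
      · intro hω
        exact ⟨(_, _), hω, rfl, rfl⟩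
      · rintro ⟨kl, hkl, h1, h2⟩
        rw [h1, h2, hkl]
    rw [e, measureReal_biUnion_finset, pow_succ, PowerSeries.coeff_mul]
    · refine Finset.sum_congr rfl fun kl _ => ?_
      have hi := hind.measure_inter_preimage_eq_mul {kl.1} {kl.2} (measurableSet_singleton _)
        (measurableSet_singleton _)
      have hj := h.jump_law m kl.2
      rw [transitionML_zero_natCast hα₀ hα₁ hlam] at hj
      rw [← ih, ← hj, measureReal_def, measureReal_def, measureReal_def, ← ENNReal.toReal_mul]
      exact congrArg ENNReal.toReal hi
    · intro a _ b _ hab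
      refine disjoint_left.2 fun ω h1 h2 => hab ?_
      exact Prod.ext (h1.1.symm.trans h2.1) (h1.2.symm.trans h2.2)
    · exact fun kl _ => (hS (measurableSet_singleton kl.1)).inter
        (h.measurable_jump m (measurableSet_singleton kl.2))

/-- Conditioning on the number of arrivals. That event agrees almost surely with one measurable in
the waiting times, hence independent of the jumps. -/
lemma hasSum_prob_position (hα₀ : 0 < α) (hα₁ : α ≤ 1) (hβ : 0 < β) (hβ₁ : β ≤ 1) (hξ : 0 < ξ)
    (hlam : 0 < lam) {t : ℝ} (ht : 0 ≤ t) (n : ℕ) :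
    HasSum (fun m => poissonProb β ξ m t * (mlSeries α lam ^ m).coeff n)
      (P.real {ω | position T Z t ω = n}) := by
  let S : ℕ → Set Ω := fun m => {ω | ∑ j ∈ Finset.range m, Z j ω = n}
  let E : ℕ → Set Ω := fun m => {ω | arrival T m ω ≤ t ∧ t < arrival T (m + 1) ω}
  let C : ℕ → Set Ω := fun m => {ω | counting T t ω = m}
  have hS : ∀ m, MeasurableSet (S m) := fun m =>
    (Finset.measurable_sum _ fun k _ => h.measurable_jump k) (measurableSet_singleton n)
  have hCE : ∀ m, (C m ∩ S m : Set Ω) =ᵐ[P] (E m ∩ S m : Set Ω) := fun m =>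
    (h.counting_ae_eq hβ hβ₁ hξ ht m).inter (ae_eq_refl _)
  have hunion : {ω | position T Z t ω = n} = ⋃ m, C m ∩ S m := by
    ext ω
    simp [C, S, position]
  have hmeas : ∀ m, NullMeasurableSet (C m ∩ S m) P := fun m =>
    ((measurableSet_arrival_interval h.measurable_wait t m).inter (hS m)).nullMeasurableSet.congr
      (hCE m).symm
  have hdisj : Pairwise (Function.onFun (AEDisjoint P) fun m => C m ∩ S m) := fun a b hab =>
    Disjoint.aedisjoint (disjoint_left.2 fun ω h1 h2 => hab (h1.1.symm.trans h2.1))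
  have hterm : ∀ m, P.real (C m ∩ S m) = poissonProb β ξ m t * (mlSeries α lam ^ m).coeff n := by
    intro m
    rw [measureReal_congr (hCE m), ← h.prob_arrival_interval hβ hβ₁ hξ ht m,
      ← h.prob_jump_sum hα₀ hα₁ hlam m n]
    have hm : ∀ m, Measurable fun x : ℕ → ℝ => ∑ k ∈ Finset.range m, x k := fun m => by fun_prop
    have hint : MeasurableSet {x : ℕ → ℝ | ∑ k ∈ Finset.range m, x k ≤ t ∧
        t < ∑ k ∈ Finset.range (m + 1), x k} :=
      (measurableSet_le (hm m) measurable_const).inter (measurableSet_lt measurable_const (hm _))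
    have hi := h.indep.measure_inter_preimage_eq_mul
      {x : ℕ → ℝ | ∑ k ∈ Finset.range m, x k ≤ t ∧ t < ∑ k ∈ Finset.range (m + 1), x k}
      {x : ℕ → ℕ | ∑ k ∈ Finset.range m, x k = n}
      hint ((by fun_prop : Measurable fun x : ℕ → ℕ => ∑ k ∈ Finset.range m, x k)
        (measurableSet_singleton n))
    rw [measureReal_def, measureReal_def, measureReal_def, ← ENNReal.toReal_mul]
    exact congrArg ENNReal.toReal hi
  have hsum := measure_iUnion₀ hdisj hmeas
  rw [← hunion] at hsum
  have hfin : ∑' m, P (C m ∩ S m) ≠ ⊤ := by rw [← hsum]; exact measure_ne_top _ _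
  have := ENNReal.hasSum_toReal hfin
  rw [← ENNReal.tsum_toReal_eq fun m => measure_ne_top _ _, ENNReal.tsum_toReal_eq
    fun m => measure_ne_top _ _] at this
  rw [measureReal_def, hsum, ENNReal.tsum_toReal_eq fun m => measure_ne_top _ _]
  simp only [← measureReal_def] at this ⊢
  simpa only [hterm] using this

end IsMontrollWeiss

end

/-! ### Existence of the walk -/

/-- Markov's inequality for 1 - e^{-sx}, which exceeds 1 - e^{-1} as soon as x > 1/s. It turns
control of the transform near 0 into tightness. -/
lemma measure_compl_Icc_le {μ : Measure ℝ} [IsProbabilityMeasure μ] (h0 : ∀ᵐ x ∂μ, 0 ≤ x)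
    {s : ℝ} (hs : 0 < s) :
    μ.real (Icc 0 s⁻¹)ᶜ ≤ (1 - Real.exp (-1))⁻¹ * (1 - ∫ x, Real.exp (-s * x) ∂μ) := by
  have he : Real.exp (-1) < 1 := Real.exp_lt_one_iff.2 (by norm_num)
  have hint := integrable_exp_neg_mul (P := μ) (Y := fun x => x) measurable_id h0 hs.le
  rw [inv_mul_eq_div, le_div_iff₀' (by linarith)]
  have hint' : Integrable (fun x => 1 - Real.exp (-s * x)) μ := (integrable_const 1).sub hint
  have h1 := mul_meas_ge_le_integral_of_nonneg (μ := μ) (f := fun x => 1 - Real.exp (-s * x))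
    (by
      filter_upwards [h0] with x hx
      exact sub_nonneg.2 (Real.exp_le_one_iff.2 (by nlinarith [mul_nonneg hs.le hx])))
    hint' (1 - Real.exp (-1))
  rw [integral_sub (integrable_const 1) hint] at h1
  simp only [integral_const, probReal_univ, smul_eq_mul, mul_one] at h1
  refine le_trans (mul_le_mul_of_nonneg_left ?_ (by linarith)) h1
  refine ENNReal.toReal_mono (measure_ne_top _ _) (measure_mono_ae ?_)
  filter_upwards [h0] with x hx hxc
  have hx1 : s⁻¹ < x := by
    by_contra hle
    exact hxc ⟨hx, not_lt.1 hle⟩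
  change 1 - Real.exp (-1) ≤ 1 - Real.exp (-s * x)
  have : 1 < s * x := by
    have := mul_lt_mul_of_pos_left hx1 hs
    rwa [mul_inv_cancel₀ hs.ne'] at this
  have := Real.exp_le_exp.2 (by linarith : -s * x ≤ -1)
  linarith

/-- A sequence of laws on `[0, ∞)` whose Laplace transforms converge, equicontinuously at `0`,
has a limit law. -/
lemma exists_probability_of_laplace_tendsto (μ : ℕ → ProbabilityMeasure ℝ)
    (h0 : ∀ n, ∀ᵐ x ∂(μ n : Measure ℝ), 0 ≤ x) {L g : ℝ → ℝ}
    (hL : ∀ s, 0 < s → Tendsto (fun n => ∫ x, Real.exp (-s * x) ∂(μ n : Measure ℝ)) atTop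
      (𝓝 (L s)))
    (hg : ∀ n s, 0 < s → 1 - ∫ x, Real.exp (-s * x) ∂(μ n : Measure ℝ) ≤ g s)
    (hg0 : Tendsto g (𝓝[>] 0) (𝓝 0)) :
    ∃ ν : ProbabilityMeasure ℝ, (∀ᵐ x ∂(ν : Measure ℝ), 0 ≤ x) ∧
      ∀ s, 0 < s → ∫ x, Real.exp (-s * x) ∂(ν : Measure ℝ) = L s := by
  have he : Real.exp (-1) < 1 := Real.exp_lt_one_iff.2 (by norm_num)
  have htight : IsTightMeasureSet {((m : ProbabilityMeasure ℝ) : Measure ℝ) | m ∈ range μ} := by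
    rw [isTightMeasureSet_iff_exists_isCompact_measure_compl_le]
    intro ε hε
    obtain ⟨δ, hδ, hδε⟩ : ∃ δ : ℝ, 0 < δ ∧ ENNReal.ofReal δ ≤ ε := by
      rcases eq_or_ne ε ⊤ with rfl | htop
      · exact ⟨1, one_pos, le_top⟩
      · exact ⟨ε.toReal, ENNReal.toReal_pos hε.ne' htop, ENNReal.ofReal_toReal_le⟩
    have hlim : Tendsto (fun s => (1 - Real.exp (-1))⁻¹ * g s) (𝓝[>] 0) (𝓝 0) := by
      simpa using hg0.const_mul (1 - Real.exp (-1))⁻¹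
    obtain ⟨s, hs, hs0⟩ := ((hlim.eventually (gt_mem_nhds hδ)).and self_mem_nhdsWithin).exists
    refine ⟨Icc 0 s⁻¹, isCompact_Icc, ?_⟩
    rintro _ ⟨_, ⟨n, rfl⟩, rfl⟩
    refine le_trans ?_ hδε
    rw [← ofReal_measureReal]
    refine ENNReal.ofReal_le_ofReal ?_
    refine (measure_compl_Icc_le (h0 n) hs0).trans (le_trans ?_ hs.le)
    have : 0 ≤ (1 - Real.exp (-1))⁻¹ := inv_nonneg.2 (by linarith)
    exact mul_le_mul_of_nonneg_left (hg n s hs0) this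
  -- By Prokhorov the closure of the sequence is compact, so it converges along a free ultrafilter;
  -- no subsequence has to be extracted.
  let U : Ultrafilter ℕ := Filter.hyperfilter ℕ
  have hU : (U : Filter ℕ) ≤ atTop := Nat.hyperfilter_le_atTop
  obtain ⟨ν, -, hν⟩ := (isCompact_closure_of_isTightMeasureSet htight).ultrafilter_le_nhds (U.map μ)
    (le_trans (by simp) (monotone_principal subset_closure))
  have hν' : Tendsto μ U (𝓝 ν) := hν
  rw [ProbabilityMeasure.tendsto_iff_forall_integral_tendsto] at hν'
  have hpos : ∀ᵐ x ∂(ν : Measure ℝ), 0 ≤ x := by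
    -- A bounded continuous function vanishing exactly on [0, ∞) detects any mass on the negative
    -- axis.
    let f : BoundedContinuousFunction ℝ ℝ := BoundedContinuousFunction.ofNormedAddCommGroup
      (fun x : ℝ => min (max (-x) 0) 1) (by fun_prop) 1 fun x => by
        rw [Real.norm_of_nonneg (le_min (le_max_right _ _) zero_le_one)]
        exact min_le_right _ _
    have hf : ∀ n, ∫ x, f x ∂(μ n : Measure ℝ) = 0 := fun n => by
      refine integral_eq_zero_of_ae ?_
      filter_upwards [h0 n] with x hx
      simp [f, hx]
    have hlim := hν' f
    simp only [hf] at hlim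
    have hz := tendsto_nhds_unique hlim tendsto_const_nhds
    have hf0 : 0 ≤ (f : ℝ → ℝ) := fun x => le_min (le_max_right _ _) zero_le_one
    rw [integral_eq_zero_iff_of_nonneg hf0 (f.integrable _)] at hz
    filter_upwards [hz] with x hx
    by_contra hneg
    have : 0 < f x := lt_min (lt_max_of_lt_left (by linarith)) one_pos
    exact this.ne' hx
  refine ⟨ν, hpos, fun s hs => ?_⟩
  -- The exponential is unbounded on the negative axis; replacing x by max x 0 makes it an
  -- admissible test function without changing the integrals.
  let f : BoundedContinuousFunction ℝ ℝ := BoundedContinuousFunction.ofNormedAddCommGroup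
    (fun x : ℝ => Real.exp (-s * max x 0)) (by fun_prop) 1 fun x => by
      rw [Real.norm_of_nonneg (Real.exp_pos _).le]
      exact Real.exp_le_one_iff.2 (by nlinarith [mul_nonneg hs.le (le_max_right x 0)])
  have hf : ∀ m : Measure ℝ, (∀ᵐ x ∂m, 0 ≤ x) → ∫ x, f x ∂m = ∫ x, Real.exp (-s * x) ∂m := by
    intro m hm
    refine integral_congr_ae ?_
    filter_upwards [hm] with x hx
    simp [f, hx]
  have hlim := hν' f
  simp only [hf _ (h0 _), hf _ hpos] at hlim
  exact tendsto_nhds_unique hlim ((hL s hs).mono_left hU)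

/-- The law on `ℕ` with probability generating function `mlSeries α lam`. -/
noncomputable def mlPMF {α lam : ℝ} (hα₀ : 0 < α) (hα₁ : α ≤ 1) (hlam : 0 < lam) : PMF ℕ :=
  ⟨fun n => ENNReal.ofReal ((mlSeries α lam).coeff n), by
    have h := hasSum_coeff_mlSeries hα₀ hα₁ hlam
    have h0 := coeff_mlSeries_nonneg hα₀ hα₁ hlam
    rw [← ENNReal.ofReal_one, ← h.tsum_eq, ENNReal.ofReal_tsum_of_nonneg h0 h.summable]
    exact ENNReal.summable.hasSum⟩

lemma toReal_mlPMF {α lam : ℝ} (hα₀ : 0 < α) (hα₁ : α ≤ 1) (hlam : 0 < lam) (n : ℕ) :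
    (mlPMF hα₀ hα₁ hlam n).toReal = (mlSeries α lam).coeff n :=
  ENNReal.toReal_ofReal (coeff_mlSeries_nonneg hα₀ hα₁ hlam n)

lemma integral_exp_mlPMF {α lam : ℝ} (hα₀ : 0 < α) (hα₁ : α ≤ 1) (hlam : 0 < lam) {x : ℝ}
    (hx : 0 ≤ x) : ∫ n : ℕ, Real.exp (-x * n) ∂(mlPMF hα₀ hα₁ hlam).toMeasure =
      lam / (lam + (1 - Real.exp (-x)) ^ α) * (1 - (1 - Real.exp (-x)) ^ α) := by
  have hint : Integrable (fun n : ℕ => Real.exp (-x * n)) (mlPMF hα₀ hα₁ hlam).toMeasure :=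
    integrable_exp_neg_mul (Y := fun n : ℕ => (n : ℝ)) (by fun_prop)
      (Eventually.of_forall fun n => Nat.cast_nonneg n) hx
  rw [PMF.integral_eq_tsum _ _ hint]
  have h := hasSum_mlSeries_real hα₀ hα₁ hlam (u := Real.exp (-x)) (by
    rw [abs_of_pos (Real.exp_pos _)]
    exact Real.exp_le_one_iff.2 (by linarith))
  rw [← h.tsum_eq]
  refine tsum_congr fun n => ?_
  rw [toReal_mlPMF, smul_eq_mul, ← Real.exp_nat_mul]
  ring_nf

/-- The Mittag-Leffler law exists: it is a limit of scaled discrete Mittag-Leffler laws. -/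
lemma exists_mittagLeffler_law {β ξ : ℝ} (hβ : 0 < β) (hβ₁ : β ≤ 1) (hξ : 0 < ξ) :
    ∃ ν : ProbabilityMeasure ℝ, (∀ᵐ x ∂(ν : Measure ℝ), 0 ≤ x) ∧
      ∀ s, 0 < s → ∫ x, Real.exp (-s * x) ∂(ν : Measure ℝ) = ξ / (ξ + s ^ β) := by
  -- The n-th law is h times a discrete Mittag-Leffler variable of exponent β and parameter ξh^β.
  -- With v = (1-e^{-sh})^β ~ (sh)^β its transform ξh^β(1-v)/(ξh^β+v) tends to ξ/(ξ+s^β).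
  let h : ℕ → ℝ := fun n => ((n : ℝ) + 1)⁻¹
  have hh : ∀ n, 0 < h n := fun n => by positivity
  have hh1 : ∀ n, h n ≤ 1 := fun n => inv_le_one_of_one_le₀ (by linarith [n.cast_nonneg (α := ℝ)])
  have hl : ∀ n, 0 < ξ * h n ^ β := fun n => mul_pos hξ (Real.rpow_pos_of_pos (hh n) _)
  let m : ℕ → Measure ℕ := fun n => (mlPMF hβ hβ₁ (hl n)).toMeasure
  have hm : ∀ n, Measurable fun k : ℕ => h n * k := fun n => by fun_prop
  let μ : ℕ → ProbabilityMeasure ℝ := fun n =>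
    ⟨(m n).map fun k : ℕ => h n * k, Measure.isProbabilityMeasure_map (hm n).aemeasurable⟩
  let v : ℕ → ℝ → ℝ := fun n s => (1 - Real.exp (-(s * h n))) ^ β
  have hint : ∀ n s, 0 < s → ∫ x, Real.exp (-s * x) ∂(μ n : Measure ℝ) =
      ξ * h n ^ β / (ξ * h n ^ β + v n s) * (1 - v n s) := fun n s hs => by
    change ∫ x, Real.exp (-s * x) ∂((m n).map fun k : ℕ => h n * k) = _
    rw [integral_map (hm n).aemeasurable (Measurable.aestronglyMeasurable (by fun_prop))]
    rw [← integral_exp_mlPMF hβ hβ₁ (hl n) (mul_pos hs (hh n)).le]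
    refine integral_congr_ae (Eventually.of_forall fun k => ?_)
    simp only
    ring_nf
  have hb0 : ∀ n s, 0 < s → 0 ≤ 1 - Real.exp (-(s * h n)) := fun n s hs =>
    sub_nonneg.2 (Real.exp_le_one_iff.2 (by linarith [mul_pos hs (hh n)]))
  have hv0 : ∀ n s, 0 < s → 0 ≤ v n s := fun n s hs => Real.rpow_nonneg (hb0 n s hs) _
  have hvle : ∀ n s, 0 < s → v n s ≤ s ^ β * h n ^ β := fun n s hs => by
    rw [← Real.mul_rpow hs.le (hh n).le]
    refine Real.rpow_le_rpow (hb0 n s hs) ?_ hβ.le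
    linarith [Real.add_one_le_exp (-(s * h n))]
  have hhβ : ∀ n, 0 < h n ^ β := fun n => Real.rpow_pos_of_pos (hh n) _
  have hh0 : Tendsto h atTop (𝓝 0) := by
    simpa only [h, one_div] using tendsto_one_div_add_atTop_nhds_zero_nat (𝕜 := ℝ)
  -- The bound g comes from 1 - transform = (1+ξh^β)v/(ξh^β+v), using v ≤ s^β h^β, h ≤ 1, and
  -- discarding v in the denominator.
  refine exists_probability_of_laplace_tendsto μ (fun n => ?_) (g := fun s => (1 + ξ) * s ^ β / ξ)
    (fun s hs => ?_) (fun n s hs => ?_) ?_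
  · change ∀ᵐ x ∂((m n).map fun k : ℕ => h n * k), 0 ≤ x
    rw [ae_map_iff (hm n).aemeasurable measurableSet_Ici]
    exact Eventually.of_forall fun k => by positivity
  · have hq : Tendsto (fun n => v n s / h n ^ β) atTop (𝓝 (s ^ β)) := by
      -- The limit of (1-e^{-sh})/h is a derivative at 0; raising it to the power β gives s^β.
      have hd : HasDerivAt (fun x : ℝ => 1 - Real.exp (-(s * x))) s 0 := by
        have := (((hasDerivAt_id (0 : ℝ)).const_mul s).neg.exp).const_sub 1
        simpa using this
      have hslope := (hasDerivAt_iff_tendsto_slope.1 hd).comp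
        (tendsto_nhdsWithin_iff.2 ⟨hh0, Eventually.of_forall fun n => (hh n).ne'⟩)
      have := (Real.continuousAt_rpow_const s β (Or.inl hs.ne')).tendsto.comp hslope
      refine this.congr fun n => ?_
      simp only [Function.comp, slope_def_field, v]
      rw [← Real.div_rpow (hb0 n s hs) (hh n).le]
      simp
    have hv : Tendsto (fun n => v n s) atTop (𝓝 0) := by
      refine squeeze_zero (fun n => hv0 n s hs) (fun n => hvle n s hs) ?_
      have := ((Real.continuousAt_rpow_const 0 β (Or.inr hβ.le)).tendsto.comp hh0).const_mul (s ^ β)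
      simpa [Real.zero_rpow hβ.ne'] using this
    have hsβ : 0 < ξ + s ^ β := add_pos hξ (Real.rpow_pos_of_pos hs _)
    have := ((tendsto_const_nhds (x := ξ)).div (hq.const_add ξ) hsβ.ne').mul (hv.const_sub 1)
    rw [sub_zero, mul_one] at this
    refine this.congr fun n => ?_
    rw [hint n s hs]
    have := hhβ n
    have h2 : 0 < ξ * h n ^ β + v n s := add_pos_of_pos_of_nonneg (hl n) (hv0 n s hs)
    congr 1
    simp only [Pi.div_apply]
    field_simp
  · rw [hint n s hs]
    have h2 : 0 < ξ * h n ^ β + v n s := add_pos_of_pos_of_nonneg (hl n) (hv0 n s hs)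
    have e : 1 - ξ * h n ^ β / (ξ * h n ^ β + v n s) * (1 - v n s) =
        (1 + ξ * h n ^ β) * v n s / (ξ * h n ^ β + v n s) := by
      field_simp
      ring
    have h3 : h n ^ β ≤ 1 := Real.rpow_le_one (hh n).le (hh1 n) hβ.le
    have hsβ : 0 ≤ s ^ β := Real.rpow_nonneg hs.le _
    rw [e, div_le_div_iff₀ h2 hξ]
    have h4 : (1 + ξ * h n ^ β) * v n s ≤ (1 + ξ) * (s ^ β * h n ^ β) :=
      mul_le_mul (by nlinarith) (hvle n s hs) (hv0 n s hs) (by linarith)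
    nlinarith [mul_nonneg (mul_nonneg (by linarith : 0 ≤ 1 + ξ) hsβ) (hv0 n s hs)]
  · have h1 : Tendsto (fun s : ℝ => (1 + ξ) * s ^ β / ξ) (𝓝 0) (𝓝 ((1 + ξ) * 0 ^ β / ξ)) :=
      ((Real.continuousAt_rpow_const 0 β (Or.inr hβ.le)).tendsto.const_mul _).div_const _
    rw [Real.zero_rpow hβ.ne', mul_zero, zero_div] at h1
    exact h1.mono_left nhdsWithin_le_nhds

lemma iIndepFun_comp_measurePreserving {Ω Ω' E : Type*} [MeasurableSpace Ω] [MeasurableSpace Ω']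
    [MeasurableSpace E] {P : Measure Ω} {P' : Measure Ω'} [IsProbabilityMeasure P]
    [IsProbabilityMeasure P'] {X : ℕ → Ω' → E} (hX : ∀ k, Measurable (X k)) (h : iIndepFun X P')
    {g : Ω → Ω'} (hg : MeasurePreserving g P P') : iIndepFun (fun k ω => X k (g ω)) P := by
  rw [iIndepFun_iff_map_fun_eq_infinitePi_map hX] at h
  rw [iIndepFun_iff_map_fun_eq_infinitePi_map (X := fun k ω => X k (g ω))
    fun k => (hX k).comp hg.measurable]
  have e1 : P.map (fun ω k => X k (g ω)) = P'.map (fun ω k => X k ω) := by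
    rw [← hg.map_eq, Measure.map_map (measurable_pi_lambda _ hX) hg.measurable]
    rfl
  have e2 : ∀ k, P.map (fun ω => X k (g ω)) = P'.map (X k) := fun k => by
    rw [← hg.map_eq, Measure.map_map (hX k) hg.measurable]
    rfl
  simp only [e1, e2, h]

lemma exists_isMontrollWeiss {α β ξ lam : ℝ} (hα₀ : 0 < α) (hα₁ : α ≤ 1) (hβ : 0 < β)
    (hβ₁ : β ≤ 1) (hξ : 0 < ξ) (hlam : 0 < lam) :
    ∃ (Ω : Type) (_ : MeasurableSpace Ω) (P : Measure Ω) (_ : IsProbabilityMeasure P)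
      (T : ℕ → Ω → ℝ) (Z : ℕ → Ω → ℕ), IsMontrollWeiss P α β ξ lam T Z := by
  obtain ⟨ν, hν0, hνL⟩ := exists_mittagLeffler_law hβ hβ₁ hξ
  obtain ⟨Ω₁, _, P₁, T, hTm, hTl, hTi, _⟩ := exists_iid ℕ (ν : Measure ℝ)
  obtain ⟨Ω₂, _, P₂, Z, hZm, hZl, hZi, _⟩ := exists_iid ℕ (mlPMF hα₀ hα₁ hlam).toMeasure
  have hfst : MeasurePreserving (Prod.fst : Ω₁ × Ω₂ → Ω₁) (P₁.prod P₂) P₁ := measurePreserving_fst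
  have hsnd : MeasurePreserving (Prod.snd : Ω₁ × Ω₂ → Ω₂) (P₁.prod P₂) P₂ := measurePreserving_snd
  have hTmap : ∀ k, MeasurePreserving (fun ω : Ω₁ × Ω₂ => T k ω.1) (P₁.prod P₂) ν := fun k =>
    MeasurePreserving.comp ⟨hTm k, (hTl k).map_eq⟩ hfst
  have hZmap : ∀ k, MeasurePreserving (fun ω : Ω₁ × Ω₂ => Z k ω.2) (P₁.prod P₂)
      (mlPMF hα₀ hα₁ hlam).toMeasure := fun k =>
    MeasurePreserving.comp ⟨hZm k, (hZl k).map_eq⟩ hsnd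
  refine ⟨Ω₁ × Ω₂, inferInstance, P₁.prod P₂, inferInstance, fun k ω => T k ω.1,
    fun k ω => Z k ω.2, ?_⟩
  constructor
  · exact fun k => (hTmap k).measurable
  · exact fun k => (hZmap k).measurable
  · exact iIndepFun_comp_measurePreserving hTm hTi hfst
  · exact iIndepFun_comp_measurePreserving hZm hZi hsnd
  · exact indepFun_prod (X := fun ω k => T k ω) (Y := fun ω k => Z k ω)
      (measurable_pi_lambda _ hTm) (measurable_pi_lambda _ hZm)
  · exact fun k => (hTmap k).quasiMeasurePreserving.ae hν0
  · intro k s hs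
    rw [← hνL s hs, ← (hTmap k).map_eq, integral_map (hTmap k).measurable.aemeasurable
      (Measurable.aestronglyMeasurable (by fun_prop))]
  · intro k n
    have := (hZmap k).measureReal_preimage (measurableSet_singleton n).nullMeasurableSet
    rw [measureReal_def (mlPMF hα₀ hα₁ hlam).toMeasure, PMF.toMeasure_apply_singleton _ _
      (measurableSet_singleton n), toReal_mlPMF] at this
    rw [transitionML_zero_natCast hα₀ hα₁ hlam, ← this]
    rfl

/-! ### The Cauchy problems and the Montroll-Weiss equation -/

section

variable {α β ξ lam : ℝ}

lemma genRate_eq (hα₀ : 0 < α) (hα₁ : α ≤ 1) (hlam : 0 < lam) (ξ : ℝ) {u : ℂ} (hu : ‖u‖ ≤ 1) :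
    genRate α ξ lam u = ξ * (1 - genTransitionML α lam u) := by
  have := add_cpow_ne_zero hα₀ hα₁ hlam (re_one_sub_nonneg hu)
  rw [genRate, genTransitionML]
  field_simp
  ring

lemma psEval_rateSeries_mlSeries (hα₀ : 0 < α) (hα₁ : α ≤ 1) (hlam : 0 < lam) (ξ : ℝ) {u : ℂ}
    (hu : ‖u‖ ≤ 1) : psEval (rateSeries ξ (mlSeries α lam)) u = -genRate α ξ lam u := by
  rw [(l1Bound_mlSeries hα₀ hα₁ hlam).psEval_rateSeries ξ hu, psEval_mlSeries hα₀ hα₁ hlam hu,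
    genRate_eq hα₀ hα₁ hlam ξ hu]
  ring

lemma norm_genTransitionML_le (hα₀ : 0 < α) (hα₁ : α ≤ 1) (hlam : 0 < lam) {u : ℂ}
    (hu : ‖u‖ ≤ 1) : ‖genTransitionML α lam u‖ ≤ 1 := by
  rw [← psEval_mlSeries hα₀ hα₁ hlam hu]
  exact (l1Bound_mlSeries hα₀ hα₁ hlam).norm_psEval_le hu

/-- The state probabilities of the space-time Mittag-Leffler process. -/
noncomputable def stateProb (α β ξ lam : ℝ) (n : ℕ) : ℝ → ℝ :=
  pSeries β (rateSeries ξ (mlSeries α lam)) n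

lemma hasSum_stateProb_mul_pow (hα₀ : 0 < α) (hα₁ : α ≤ 1) (hβ : 0 < β) (hξ : 0 < ξ)
    (hlam : 0 < lam) {u : ℂ} (hu : ‖u‖ ≤ 1) {t : ℝ} (ht : 0 ≤ t) :
    HasSum (fun n => (stateProb α β ξ lam n t : ℂ) * u ^ n)
      (mittagLeffler β (-genRate α ξ lam u * (t ^ β : ℝ))) := by
  rw [← psEval_rateSeries_mlSeries hα₀ hα₁ hlam ξ hu]
  exact hasSum_pSeries_mul_pow hβ ((l1Bound_mlSeries hα₀ hα₁ hlam).rateSeries hξ) ht hu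

lemma cauchy_rate_eq (hα₀ : 0 < α) (hα₁ : α ≤ 1) (hlam : 0 < lam) (ξ : ℝ) (p : ℕ → ℝ) (n : ℕ) :
    -(ξ * (lam + 1)) * ∑ m ∈ Finset.range (n + 1), p m * laplacianML α lam 0 ((n : ℤ) - (m : ℤ)) =
      ∑ m ∈ Finset.range (n + 1), p m * (rateSeries ξ (mlSeries α lam)).coeff (n - m) := by
  rw [Finset.mul_sum]
  refine Finset.sum_congr rfl fun m hm => ?_
  have hmn : m ≤ n := by simpa [Nat.lt_succ_iff] using hm
  rw [← Nat.cast_sub hmn, rateSeries, PowerSeries.coeff_C_mul,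
    ← laplacianML_zero_natCast hα₀ hα₁ hlam]
  ring

lemma solvesCauchy_stateProb (hα₀ : 0 < α) (hα₁ : α ≤ 1) (hβ : 0 < β) (hβ₁ : β ≤ 1) (hξ : 0 < ξ)
    (hlam : 0 < lam) : SolvesCauchy α β ξ lam (stateProb α β ξ lam) where
  regular n := caputoRegular_pSeries hβ ((l1Bound_mlSeries hα₀ hα₁ hlam).rateSeries hξ) n
  init n := pSeries_zero_right hβ _ n
  eqn n t ht := by
    rw [cauchy_rate_eq hα₀ hα₁ hlam ξ fun m => stateProb α β ξ lam m t]
    exact hasCaputoDerivAt_pSeries hβ hβ₁ ((l1Bound_mlSeries hα₀ hα₁ hlam).rateSeries hξ) n ht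

/-- The system is triangular: once all lower components agree, their contributions cancel and the
difference of the n-th components satisfies a scalar homogeneous equation. -/
lemma SolvesCauchy.eq (hα₀ : 0 < α) (hα₁ : α ≤ 1) (hβ : 0 < β) (hβ₁ : β ≤ 1)
    (hlam : 0 < lam) {p q : ℕ → ℝ → ℝ} (hp : SolvesCauchy α β ξ lam p)
    (hq : SolvesCauchy α β ξ lam q) (n : ℕ) {t : ℝ} (ht : 0 ≤ t) : q n t = p n t := by
  induction n using Nat.strong_induction_on generalizing t with
  | _ n ih =>
    refine sub_eq_zero.1 (eq_zero_of_caputo hβ hβ₁ (K := |(rateSeries ξ (mlSeries α lam)).coeff 0|)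
      (d := fun t => q n t - p n t) ((hq.regular n).sub (hp.regular n))
      (by rw [hq.init, hp.init, sub_self])
      (fun t ht => (hq.eqn n t ht).sub (hq.regular n) (hp.regular n) ht (hp.eqn n t ht))
      (fun t ht => ?_) ht)
    rw [cauchy_rate_eq hα₀ hα₁ hlam ξ fun m => q m t, cauchy_rate_eq hα₀ hα₁ hlam ξ fun m => p m t,
      Finset.sum_range_succ, Finset.sum_range_succ,
      Finset.sum_congr rfl fun m hm => by rw [ih m (Finset.mem_range.1 hm) ht.le],
      Nat.sub_self, add_sub_add_left_eq_sub, ← sub_mul, norm_mul, mul_comm]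
    rfl

lemma solvesGenCauchy_fracSeries (hβ : 0 < β) (hβ₁ : β ≤ 1) (α ξ lam : ℝ) (u : ℂ) :
    SolvesGenCauchy α β ξ lam u (fracSeries β fun k => (-genRate α ξ lam u) ^ k) := by
  have hb : ∀ k, ‖(-genRate α ξ lam u) ^ k‖ ≤ 1 * ‖-genRate α ξ lam u‖ ^ k := fun k => by
    rw [norm_pow, one_mul]
  refine ⟨caputoRegular_fracSeries hβ (norm_nonneg _) hb, ?_, fun t ht => ?_⟩
  · rw [fracSeries_zero_right hβ, pow_zero]
  · have h := hasCaputoDerivAt_fracSeries hβ hβ₁ (norm_nonneg _) hb ht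
    convert h using 1
    rw [fracSeries, fracSeries, ← tsum_mul_left]
    refine tsum_congr fun k => ?_
    rw [pow_succ, mul_smul_comm, mul_comm]

lemma SolvesGenCauchy.congr {u : ℂ} {f g : ℝ → ℂ} (hf : SolvesGenCauchy α β ξ lam u f)
    (h : EqOn g f (Ici 0)) : SolvesGenCauchy α β ξ lam u g where
  regular := hf.regular.congr h
  init := by rw [h (mem_Ici.2 le_rfl), hf.init]
  eqn t ht := by
    rw [h (mem_Ici.2 ht.le)]
    exact (hf.eqn t ht).congr ht h

lemma SolvesGenCauchy.eqOn (hβ : 0 < β) (hβ₁ : β ≤ 1) {u : ℂ} {f g : ℝ → ℂ}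
    (hf : SolvesGenCauchy α β ξ lam u f) (hg : SolvesGenCauchy α β ξ lam u g) :
    EqOn f g (Ici 0) := fun t ht => by
  refine sub_eq_zero.1 (eq_zero_of_caputo hβ hβ₁ (K := ‖-genRate α ξ lam u‖)
    (d := fun t => f t - g t) (hf.regular.sub hg.regular) (by rw [hf.init, hg.init, sub_self])
    (fun t ht => (hf.eqn t ht).sub hf.regular hg.regular ht (hg.eqn t ht))
    (fun t ht => ?_) (mem_Ici.1 ht))
  rw [← mul_sub, norm_mul]

/-- For z = s^β, |ξ+z|² = ξ² + |z|² + 2ξ Re z, where Re z ≥ 0 and z ≠ 0. -/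
lemma norm_wait_laplace_lt_one (hβ : 0 < β) (hβ₁ : β ≤ 1) (hξ : 0 < ξ) {s : ℂ} (hs : 0 < s.re) :
    ‖(ξ : ℂ) / (ξ + s ^ (β : ℂ))‖ < 1 := by
  have hz := re_cpow_nonneg hβ hβ₁ hs.le
  have hz0 : s ^ (β : ℂ) ≠ 0 := by simp [Complex.cpow_eq_zero_iff, cpow_re_pos hs]
  have hne := add_cpow_ne_zero hβ hβ₁ hξ hs.le
  rw [norm_div, div_lt_one (norm_pos_iff.2 hne)]
  refine lt_of_pow_lt_pow_left₀ 2 (norm_nonneg _) ?_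
  rw [← Complex.normSq_eq_norm_sq, ← Complex.normSq_eq_norm_sq, Complex.normSq_add]
  have h1 := Complex.normSq_pos.2 hz0
  have h2 : ((ξ : ℂ) * (starRingEnd ℂ) (s ^ (β : ℂ))).re = ξ * (s ^ (β : ℂ)).re := by simp
  rw [h2]
  nlinarith [mul_nonneg hξ.le hz]

/-- The geometric series of the Montroll-Weiss equation. -/
lemma hasSum_montrollWeiss (hα₀ : 0 < α) (hα₁ : α ≤ 1) (hβ : 0 < β) (hβ₁ : β ≤ 1) (hξ : 0 < ξ)
    (hlam : 0 < lam) {u s χ W : ℂ} (hu : ‖u‖ ≤ 1) (hs : 0 < s.re)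
    (hχ : χ = ξ / (ξ + s ^ (β : ℂ))) (hW : W = genTransitionML α lam u) :
    HasSum (fun n : ℕ => 1 / s * (1 - χ) * (χ * W) ^ n) (1 / s * (1 - χ) * (1 / (1 - W * χ))) ∧
      1 / s * (1 - χ) * (1 / (1 - W * χ)) =
        s ^ ((β : ℂ) - 1) / (s ^ (β : ℂ) + genRate α ξ lam u) := by
  have hχ1 : ‖χ‖ < 1 := hχ ▸ norm_wait_laplace_lt_one hβ hβ₁ hξ hs
  have hW1 : ‖W‖ ≤ 1 := hW ▸ norm_genTransitionML_le hα₀ hα₁ hlam hu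
  have hχW : ‖χ * W‖ < 1 := by
    rw [norm_mul]
    exact (mul_le_of_le_one_right (norm_nonneg _) hW1).trans_lt hχ1
  have hne := add_cpow_ne_zero hβ hβ₁ hξ hs.le
  have hs0 := cpow_re_pos hs
  have hne1 : 1 - W * χ ≠ 0 := by
    intro h
    rw [mul_comm, ← sub_eq_zero.1 h, norm_one] at hχW
    exact lt_irrefl _ hχW
  refine ⟨?_, ?_⟩
  · rw [one_div (1 - W * χ), mul_comm W]
    exact (hasSum_geometric_of_norm_lt_one hχW).mul_left _
  · rw [genRate_eq hα₀ hα₁ hlam ξ hu, ← hW, Complex.cpow_sub _ _ hs0, Complex.cpow_one]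
    have e1 : 1 - χ = s ^ (β : ℂ) / (ξ + s ^ (β : ℂ)) := by
      rw [hχ]; field_simp; ring
    have e2 : 1 - W * χ = (s ^ (β : ℂ) + ξ * (1 - W)) / (ξ + s ^ (β : ℂ)) := by
      rw [hχ]; field_simp; ring
    have hne2 : s ^ (β : ℂ) + ξ * (1 - W) ≠ 0 := fun h => hne1 (by rw [e2, h, zero_div])
    rw [e1, e2]
    field_simp

variable {Ω : Type*} [MeasurableSpace Ω] {P : Measure Ω} [IsProbabilityMeasure P]
  {T : ℕ → Ω → ℝ} {Z : ℕ → Ω → ℕ}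

/-- Write E_β(-c t^β) = Σ_m π_m(t) W̄(u)^m and integrate term by term. The walk supplies π_m ≥ 0 and
its transform for every Re s > 0, so no growth bound on the Mittag-Leffler function is needed. -/
lemma IsMontrollWeiss.hasLaplaceAt_fracSeries (h : IsMontrollWeiss P α β ξ lam T Z)
    (hα₀ : 0 < α) (hα₁ : α ≤ 1) (hβ : 0 < β) (hβ₁ : β ≤ 1) (hξ : 0 < ξ) (hlam : 0 < lam)
    {u s : ℂ} (hu : ‖u‖ ≤ 1) (hs : 0 < s.re) :
    HasLaplaceAt (fracSeries β fun k => (-genRate α ξ lam u) ^ k) s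
      (s ^ ((β : ℂ) - 1) / (s ^ (β : ℂ) + genRate α ξ lam u)) := by
  obtain ⟨W, hW⟩ : ∃ W, W = genTransitionML α lam u := ⟨_, rfl⟩
  obtain ⟨χ, hχ⟩ : ∃ χ : ℂ, χ = ξ / (ξ + s ^ (β : ℂ)) := ⟨_, rfl⟩
  have hMW := hasSum_montrollWeiss hα₀ hα₁ hβ hβ₁ hξ hlam hu hs hχ hW
  rw [← hMW.2]
  have hW1 : ‖W‖ ≤ 1 := hW ▸ norm_genTransitionML_le hα₀ hα₁ hlam hu
  let F : ℕ → ℝ → ℂ := fun m t => Complex.exp (-s * t) * ((poissonProb β ξ m t : ℂ) * W ^ m)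
  have hL := fun m => h.hasLaplaceAt_poissonProb hβ hβ₁ hξ m hs hχ
  have hF : ∀ m, IntegrableOn (F m) (Ioi 0) := fun m => by
    simpa only [F, mul_assoc, IntegrableOn] using (hL m).1.mul_const (W ^ m)
  have hFint : ∀ m, ∫ t in Ioi (0 : ℝ), F m t = 1 / s * (1 - χ) * (χ * W) ^ m := fun m => by
    have : ∫ t in Ioi (0 : ℝ), F m t =
        (∫ t in Ioi (0 : ℝ), Complex.exp (-s * t) * (poissonProb β ξ m t : ℂ)) * W ^ m := by
      rw [← integral_mul_const]
      simp only [F, mul_assoc]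
    rw [this, (hL m).2]
    ring
  have hσ : 0 < ((s.re : ℝ) : ℂ).re := by simpa using hs
  -- The absolute values of the terms are controlled by the transforms at the real point Re s, which
  -- are geometric with ratio ρ, |ρ| < 1.
  obtain ⟨ρ, hρ⟩ : ∃ ρ : ℂ, ρ = ξ / (ξ + (s.re : ℂ) ^ (β : ℂ)) := ⟨_, rfl⟩
  have hρ1 : ‖ρ‖ < 1 := hρ ▸ norm_wait_laplace_lt_one hβ hβ₁ hξ hσ
  have hM := fun m => h.hasLaplaceAt_poissonProb hβ hβ₁ hξ m hσ hρ
  have hnorm : ∀ m, EqOn (fun t : ℝ => ‖Complex.exp (-(s.re : ℂ) * t) * (poissonProb β ξ m t : ℂ)‖)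
      (fun t : ℝ => Real.exp (-s.re * t) * poissonProb β ξ m t) (Ioi 0) := fun m t ht => by
    simp only
    rw [norm_mul, norm_exp_neg_mul, Complex.ofReal_re, Complex.norm_real,
      Real.norm_of_nonneg (h.poissonProb_nonneg hβ hβ₁ hξ (le_of_lt ht) m)]
  have hI : ∀ m, ∫ t in Ioi (0 : ℝ), Real.exp (-s.re * t) * poissonProb β ξ m t ≤
      ‖((s.re : ℝ) : ℂ)⁻¹ * (1 - ρ)‖ * ‖ρ‖ ^ m := fun m => by
    have e := (hM m).2
    rw [show (fun t : ℝ => Complex.exp (-(s.re : ℂ) * t) * (poissonProb β ξ m t : ℂ)) =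
      fun t : ℝ => ((Real.exp (-s.re * t) * poissonProb β ξ m t : ℝ) : ℂ) from
        funext fun t => by push_cast; ring_nf, integral_complex_ofReal] at e
    rw [← norm_pow, ← norm_mul, mul_assoc, ← e, Complex.norm_real]
    exact Real.le_norm_self _
  have hsum : Summable fun m => ∫ t in Ioi (0 : ℝ), ‖F m t‖ := by
    refine Summable.of_nonneg_of_le (fun m => integral_nonneg fun t => norm_nonneg _)
      (fun m => le_trans ?_ (hI m)) ((summable_geometric_of_lt_one (norm_nonneg _) hρ1).mul_left _)
    refine setIntegral_mono_on (hF m).norm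
      (IntegrableOn.congr_fun (hM m).1.norm (hnorm m) measurableSet_Ioi) measurableSet_Ioi
      fun t ht => ?_
    have hp := h.poissonProb_nonneg hβ hβ₁ hξ (le_of_lt ht) m
    simp only [F]
    rw [norm_mul, norm_exp_neg_mul, norm_mul, Complex.norm_real, Real.norm_of_nonneg hp, norm_pow]
    exact mul_le_mul_of_nonneg_left
      (mul_le_of_le_one_right hp (pow_le_one₀ (norm_nonneg _) hW1)) (Real.exp_pos _).le
  have htsum : EqOn (fun t => ∑' m, F m t) (fun t : ℝ => Complex.exp (-s * t) *
      fracSeries β (fun k => (-genRate α ξ lam u) ^ k) t) (Ioi 0) := fun t ht => by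
    have ht0 : (0 : ℝ) ≤ t := le_of_lt ht
    have hX := hasSum_pSeries_mul_pow hβ (L1Bound.X.rateSeries hξ) ht0 hW1
    rw [L1Bound.X.psEval_rateSeries ξ hW1, psEval_X] at hX
    simp only
    rw [fracSeries_pow β _ ht0, genRate_eq hα₀ hα₁ hlam ξ hu, ← hW, ← neg_mul, ← hX.tsum_eq,
      ← tsum_mul_left]
    rfl
  refine ⟨IntegrableOn.congr_fun (integrable_tsum_of_summable_integral_norm hF hsum) htsum
    measurableSet_Ioi, ?_⟩
  rw [← setIntegral_congr_fun measurableSet_Ioi htsum]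
  have := hasSum_integral_of_summable_integral_norm hF hsum
  simp only [hFint] at this
  exact this.unique hMW.1

/-- The generating function of the counting probabilities at u = 0 retains only the term m = 0. -/
lemma poissonProb_zero_eq (hβ : 0 < β) (hξ : 0 < ξ) {t : ℝ} (ht : 0 ≤ t) :
    (poissonProb β ξ 0 t : ℂ) = mittagLeffler β (-(ξ * t ^ β : ℝ)) := by
  have hX := hasSum_pSeries_mul_pow hβ (L1Bound.X.rateSeries hξ) ht (u := 0) (by simp)
  rw [L1Bound.X.psEval_rateSeries ξ (by simp), psEval_X] at hX
  have h0 := hX.unique (hasSum_single 0 fun n hn => by simp [hn])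
  simp only [pow_zero, mul_one] at h0
  rw [poissonProb, ← h0]
  congr 1
  push_cast
  ring

/-- The Montroll-Weiss equation characterizes the solution of the Cauchy problem for generating
functions. -/
lemma solvesGenCauchy_iff (hα₀ : 0 < α) (hα₁ : α ≤ 1) (hβ : 0 < β) (hβ₁ : β ≤ 1) (hξ : 0 < ξ)
    (hlam : 0 < lam) {u : ℂ} (hu : ‖u‖ ≤ 1) (f : ℝ → ℂ) :
    (ContinuousOn f (Ici 0) ∧ ∀ s : ℂ, 0 < s.re →
      HasLaplaceAt f s (s ^ ((β : ℂ) - 1) / (s ^ (β : ℂ) + genRate α ξ lam u))) ↔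
    SolvesGenCauchy α β ξ lam u f := by
  -- An auxiliary walk, used only to know the transform of the explicit solution on the full
  -- half-plane.
  obtain ⟨Ω, _, P, _, T, Z, h⟩ := exists_isMontrollWeiss hα₀ hα₁ hβ hβ₁ hξ hlam
  have hL := fun (s : ℂ) (hs : 0 < s.re) =>
    h.hasLaplaceAt_fracSeries hα₀ hα₁ hβ hβ₁ hξ hlam hu hs
  have hE := solvesGenCauchy_fracSeries hβ hβ₁ α ξ lam u
  refine ⟨fun ⟨hc, hf⟩ => hE.congr ?_, fun hf => ⟨hf.regular.continuousOn, fun s hs =>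
    (hL s hs).congr (hf.eqOn hβ hβ₁ hE)⟩⟩
  have hpos : EqOn f (fracSeries β fun k => (-genRate α ξ lam u) ^ k) (Ioi 0) := fun t ht =>
    eq_of_hasLaplaceAt hf hL ht
      ((hc.continuousAt (Ici_mem_nhds ht)).sub (hE.regular.continuousOn.continuousAt
        (Ici_mem_nhds ht)))
  exact hpos.of_subset_closure hc hE.regular.continuousOn Ioi_subset_Ici_self
    (by rw [closure_Ioi])

end

end SpaceTimeML

/-! ### Assembly of the theorem -/

theorem mainTheorem8 (α β ξ lam : ℝ) (hα₀ : 0 < α) (hα₁ : α ≤ 1) (hβ₀ : 0 < β) (hβ₁ : β ≤ 1)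
    (hξ : 0 < ξ) (hlam : 0 < lam) :
    -- the Mittag-Leffler transition matrix is that of a strictly increasing walk on `ℤ`
    ((∀ i j, 0 ≤ SpaceTimeML.transitionML α lam i j) ∧
      (∀ i j, j ≤ i → SpaceTimeML.transitionML α lam i j = 0) ∧
      (∀ i, HasSum (fun j => SpaceTimeML.transitionML α lam i j) 1) ∧
      (∀ u : ℂ, ‖u‖ ≤ 1 →
        HasSum (fun n : ℕ => (SpaceTimeML.transitionML α lam 0 n : ℂ) * u ^ n)
          (SpaceTimeML.genTransitionML α lam u))) ∧
    -- the Cauchy problem has one and only one solution on `[0, ∞)`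
    (∃ p, SpaceTimeML.SolvesCauchy α β ξ lam p ∧
      ∀ q, SpaceTimeML.SolvesCauchy α β ξ lam q → ∀ n, ∀ t, 0 ≤ t → q n t = p n t) ∧
    -- there is a Montroll-Weiss walk with the prescribed jumps and waiting times
    (∃ (Ω : Type) (_ : MeasurableSpace Ω) (P : Measure Ω) (_ : IsProbabilityMeasure P)
      (T : ℕ → Ω → ℝ) (Z : ℕ → Ω → ℕ), SpaceTimeML.IsMontrollWeiss P α β ξ lam T Z) ∧
    -- every such walk has the state probabilities that solve the Cauchy problem
    (∀ (Ω : Type*) [MeasurableSpace Ω] (P : Measure Ω) [IsProbabilityMeasure P]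
      (T : ℕ → Ω → ℝ) (Z : ℕ → Ω → ℕ), SpaceTimeML.IsMontrollWeiss P α β ξ lam T Z →
      -- the waiting times are Mittag-Leffler
      (∀ k, ∀ t : ℝ, 0 ≤ t → (P.real {ω | t < T k ω} : ℂ) =
        SpaceTimeML.mittagLeffler β (-(ξ * t ^ β : ℝ))) ∧
      (∀ k, ∀ s : ℂ, 0 < s.re →
        ∫ ω, Complex.exp (-s * T k ω) ∂P = ξ / (ξ + s ^ (β : ℂ))) ∧
      ∀ p, SpaceTimeML.SolvesCauchy α β ξ lam p →
        -- state probabilities, and the Cox series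
        (∀ n : ℕ, ∀ t : ℝ, 0 ≤ t →
          P.real {ω | SpaceTimeML.position T Z t ω = n} = p n t ∧
          HasSum (fun m : ℕ => P.real {ω | SpaceTimeML.counting T t ω = m} *
            SpaceTimeML.stepMatrix (SpaceTimeML.transitionML α lam) m 0 n) (p n t)) ∧
        ∀ u : ℂ, ‖u‖ ≤ 1 →
          -- generating function of the state probabilities
          (∀ t : ℝ, 0 ≤ t → HasSum (fun n : ℕ => (p n t : ℂ) * u ^ n)
            (SpaceTimeML.mittagLeffler β
              (-SpaceTimeML.genRate α ξ lam u * (t ^ β : ℝ)))) ∧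
          SpaceTimeML.SolvesGenCauchy α β ξ lam u (fun t => ∑' n : ℕ, (p n t : ℂ) * u ^ n) ∧
          -- the Montroll-Weiss equation, for the Cox series and for the Cauchy problem
          (∀ s χ W : ℂ, 0 < s.re → χ = ξ / (ξ + s ^ (β : ℂ)) →
            W = SpaceTimeML.genTransitionML α lam u →
            ∃ v : ℂ,
              SpaceTimeML.HasLaplaceAt
                (fun t => ∑' n : ℕ, ((∑' m : ℕ,
                  P.real {ω | SpaceTimeML.counting T t ω = m} *
                    SpaceTimeML.stepMatrix (SpaceTimeML.transitionML α lam) m 0 n : ℝ) : ℂ)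
                  * u ^ n) s v ∧
              SpaceTimeML.HasLaplaceAt (fun t => ∑' n : ℕ, (p n t : ℂ) * u ^ n) s v ∧
              HasSum (fun n : ℕ => 1 / s * (1 - χ) * (χ * W) ^ n) v ∧
              v = 1 / s * (1 - χ) * (1 / (1 - W * χ)) ∧
              v = s ^ ((β : ℂ) - 1) / (s ^ (β : ℂ) + SpaceTimeML.genRate α ξ lam u))) ∧
    -- the Montroll-Weiss equation is equivalent to the Cauchy problem for generating functions
    (∀ u : ℂ, ‖u‖ ≤ 1 → ∀ f : ℝ → ℂ,
      (ContinuousOn f (Set.Ici 0) ∧ ∀ s : ℂ, 0 < s.re →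
        SpaceTimeML.HasLaplaceAt f s
          (s ^ ((β : ℂ) - 1) / (s ^ (β : ℂ) + SpaceTimeML.genRate α ξ lam u))) ↔
      SpaceTimeML.SolvesGenCauchy α β ξ lam u f) := by
  have hA := SpaceTimeML.l1Bound_mlSeries hα₀ hα₁ hlam
  have hA0 := SpaceTimeML.coeff_mlSeries_zero α lam
  have hstep : ∀ m n : ℕ, SpaceTimeML.stepMatrix (SpaceTimeML.transitionML α lam) m 0 n =
      (SpaceTimeML.mlSeries α lam ^ m).coeff n := fun m n => by
    rw [SpaceTimeML.stepMatrix_transitionML hα₀ hα₁ hlam, if_pos (by positivity), Int.toNat_natCast]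
  refine ⟨⟨fun i j => ?_, fun i j hij => ?_, SpaceTimeML.hasSum_transitionML hα₀ hα₁ hlam,
    fun u hu => ?_⟩, ⟨_, SpaceTimeML.solvesCauchy_stateProb hα₀ hα₁ hβ₀ hβ₁ hξ hlam,
      fun q hq n t ht => (SpaceTimeML.solvesCauchy_stateProb hα₀ hα₁ hβ₀ hβ₁ hξ hlam).eq hα₀ hα₁
        hβ₀ hβ₁ hlam hq n ht⟩,
    SpaceTimeML.exists_isMontrollWeiss hα₀ hα₁ hβ₀ hβ₁ hξ hlam, ?_,
    fun u hu f => SpaceTimeML.solvesGenCauchy_iff hα₀ hα₁ hβ₀ hβ₁ hξ hlam hu f⟩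
  · rw [SpaceTimeML.transitionML_eq hα₀ hα₁ hlam]
    split_ifs
    · exact SpaceTimeML.coeff_mlSeries_nonneg hα₀ hα₁ hlam _
    · exact le_rfl
  · rw [SpaceTimeML.transitionML_eq hα₀ hα₁ hlam]
    split_ifs with h
    · rw [show (j - i).toNat = 0 by omega, hA0]
    · rfl
  · rw [← SpaceTimeML.psEval_mlSeries hα₀ hα₁ hlam hu]
    simpa only [SpaceTimeML.transitionML_zero_natCast hα₀ hα₁ hlam] using hA.hasSum hu
  · intro Ω _ P _ T Z h
    refine ⟨fun k t ht => ?_, fun k s hs => h.wait_claplace hβ₀ hβ₁ hξ k hs, fun p hp => ?_⟩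
    · rw [h.survival_wait hβ₀ hβ₁ hξ k ht, SpaceTimeML.poissonProb_zero_eq hβ₀ hξ ht]
    -- By uniqueness any solution of (1) is the explicit one, so all its properties are those of the
    -- series.
    have hpe : ∀ (n : ℕ) (t : ℝ), 0 ≤ t → p n t = SpaceTimeML.stateProb α β ξ lam n t :=
      fun n t ht =>
      (SpaceTimeML.solvesCauchy_stateProb hα₀ hα₁ hβ₀ hβ₁ hξ hlam).eq hα₀ hα₁ hβ₀ hβ₁ hlam hp n ht
    have hcox : ∀ (n : ℕ) (t : ℝ), 0 ≤ t → HasSum (fun m : ℕ =>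
        P.real {ω | SpaceTimeML.counting T t ω = m} *
          SpaceTimeML.stepMatrix (SpaceTimeML.transitionML α lam) m 0 n) (p n t) :=
      fun n t ht => by
      simp only [hstep, h.prob_counting hβ₀ hβ₁ hξ ht, hpe n t ht]
      exact SpaceTimeML.hasSum_pSeries_cox hβ₀ hξ hA hA0 n ht
    refine ⟨fun n t ht => ⟨?_, hcox n t ht⟩, fun u hu => ?_⟩
    · rw [hpe n t ht]
      exact (h.hasSum_prob_position hα₀ hα₁ hβ₀ hβ₁ hξ hlam ht n).unique
        (SpaceTimeML.hasSum_pSeries_cox hβ₀ hξ hA hA0 n ht)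
    have hgen : ∀ t : ℝ, 0 ≤ t → HasSum (fun n : ℕ => (p n t : ℂ) * u ^ n)
        (SpaceTimeML.mittagLeffler β (-SpaceTimeML.genRate α ξ lam u * (t ^ β : ℝ))) :=
      fun t ht => by
      simp only [hpe _ t ht]
      exact SpaceTimeML.hasSum_stateProb_mul_pow hα₀ hα₁ hβ₀ hξ hlam hu ht
    have hfrac : EqOn (fun t => ∑' n : ℕ, (p n t : ℂ) * u ^ n)
        (SpaceTimeML.fracSeries β fun k => (-SpaceTimeML.genRate α ξ lam u) ^ k) (Ici 0) :=
      fun t ht => by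
        simp only
        rw [(hgen t ht).tsum_eq, SpaceTimeML.fracSeries_pow β _ ht]
    have hE := SpaceTimeML.solvesGenCauchy_fracSeries hβ₀ hβ₁ α ξ lam u
    refine ⟨hgen, hE.congr hfrac, fun s χ W hs hχ hW => ?_⟩
    obtain ⟨hsum, hv⟩ := SpaceTimeML.hasSum_montrollWeiss hα₀ hα₁ hβ₀ hβ₁ hξ hlam hu hs hχ hW
    have hL := (h.hasLaplaceAt_fracSeries hα₀ hα₁ hβ₀ hβ₁ hξ hlam hu hs).congr hfrac
    rw [← hv] at hL
    refine ⟨_, hL.congr fun t ht => ?_, hL, hsum, rfl, hv⟩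
    simp only [(hcox _ t ht).tsum_eq]
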